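/- **Setting.** For $N\in\mathbb N$ let $\varepsilon=\frac{2}{2N+1}$, $\Lambda_\varepsilon=\varepsilon\mathbb Z$, $D_\varepsilon=\mathbb R\times\Lambda_\varepsilon$, $\int_{D_\varepsilon}f(z)\,dz=\int_{\mathbb R}\varepsilon\sum_{x\in\Lambda_\varepsilon}f(t,x)\,dt$, $\nabla^\pm_\varepsilon g(x)=\pm\varepsilon^{-1}(g(x\pm\varepsilon)-g(x))$, $\|(t,x)\|_{\mathfrak s}=\sqrt{|t|}+|x|$, and for $j\in\mathbb N^2$ put $|j|_{\mathfrak s}=2j_0+j_1$, $D^j_\varepsilon=\partial_t^{j_0}(\nabla^-_\varepsilon)^{j_1}$. Let $$G^\varepsilon(t,x)=\int_{-1/(2\varepsilon)}^{1/(2\varepsilon)}e^{-\varepsilon^{-2}(1-\cos(2\pi\varepsilon\omega))t}\,e^{2\pi i\omega x}\,d\omega\qquad(t\ge 0,\ x\in\Lambda_\varepsilon)$$ be the Green function of $\partial_t-\frac12\Delta_\varepsilon$ on the lattice, with $G^\varepsilon(0,x)=\varepsilon^{-1}\mathbf 1_{x=0}$. Let $Q^\varepsilon=\nabla^-_\varepsilon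 G^\varepsilon\,\nabla^+_\varepsilon G^\varepsilon$, $(f\star^+_\varepsilon g)(t,x)=\int_0^t\varepsilon\sum_{y\in\Lambda_\varepsilon}f(t-s,x-y)g(s,y)\,ds$, and $$\widetilde G^\varepsilon=G^\varepsilon+\sum_{n\ge1}(-\varepsilon)^n(1+\sqrt\varepsilon)^n\,\underbrace{Q^\varepsilon\star^+_\varepsilon\cdots\star^+_\varepsilon Q^\varepsilon}_{n}\star^+_\varepsilon G^\varepsilon .$$ **Singular parts.** Let $r\ge2$ be an integer, $c,C\in\mathbb R$, and $M=-\lfloor\log_2\varepsilon\rfloor$. A function $K$ on $D_\varepsilon$ is an $(r,c,C)$-singular part of a kernel $u$ if $u=K+R$ for $t\ge0$, where $K(t,x)=0$ for $t<0$, $K(t,-x)=K(t,x)$, $K=\sum_{n=0}^MK^n$ for $t\ge0$, the functions $K^n$ and $R$ are $\lfloor r/2\rfloor$ times continuously differentiable in $t\in[0,\infty)$, and, for all $t\ge0$ and all $j$ with $|j|_{\mathfrak s}\le r$: $K^n(z)=0$ if $\|z\|_{\mathfrak s}>c2^{-n}$, $|D^j_\varepsilon K^n(z)|\le C2^{n(1+|j|_{\mathfrak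 s})}$, and $|D^j_\varepsilon R(z)|\le C$. **Renormalisation constants.** Given kernels $K^\varepsilon,\widetilde K^\varepsilon$ on $D_\varepsilon$, put for signs $l_1,l_2\in\{+,-\}$ $$Q_{l_1,l_2}(z_1,z_2)=\int_{D_\varepsilon}\nabla^{l_1}_\varepsilon K^\varepsilon(z_1-z)\,\nabla^{l_2}_\varepsilon K^\varepsilon(z_2-z)\,dz,$$ $$C^{(1)}_\varepsilon=\iint_{D_\varepsilon^2}\nabla^-_\varepsilon\widetilde K^\varepsilon(-z_1)\,\nabla^+_\varepsilon\widetilde K^\varepsilon(-z_2)\,\bigl(Q_{+,+}Q_{-,-}+Q_{+,-}Q_{-,+}\bigr)(z_1,z_2)\,dz_1dz_2,$$ and for signs $a,b\in\{+,-\}$ $$C^{(2)}_{\varepsilon}(a,b)=\iint_{D_\varepsilon^2}\nabla^a_\varepsilon\widetilde K^\varepsilon(-z_1)\,\nabla^b_\varepsilon\widetilde K^\varepsilon(z_1-z_2)\,\bigl(Q_{-b,+}(z_1,z_2)Q_{-a,-}(0,z_2)+Q_{-b,-}(z_1,z_2)Q_{-a,+}(0,z_2)\bigr)\,dz_1dz_2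 .$$ **Lemma 6.6.** There is $\varepsilon_0\in(0,1)$ such that for every $N$ with $\varepsilon=\frac2{2N+1}<\varepsilon_0$ the series defining $\widetilde G^\varepsilon$ converges absolutely at every point of $[0,\infty)\times\Lambda_\varepsilon$, and the following holds. For every integer $r\ge2$ and all $c,C$ there is a constant $B$ such that, for every $N$ with $\varepsilon=\frac2{2N+1}<\varepsilon_0$, every $(r,c,C)$-singular part $K^\varepsilon$ of $G^\varepsilon$ and every $(r,c,C)$-singular part $\widetilde K^\varepsilon$ of $\widetilde G^\varepsilon$, all the integrals above converge absolutely and $$\bigl|C^{(1)}_\varepsilon+C^{(2)}_\varepsilon(+,+)+C^{(2)}_\varepsilon(-,+)+C^{(2)}_\varepsilon(+,-)+C^{(2)}_\varepsilon(-,-)\bigr|\le B .$$ -/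

import Mathlib

open MeasureTheory

noncomputable section

namespace LatticeKPZ

/-- The mesh size `ε = 2 / (2 N + 1)`. -/
def mesh (N : ℕ) : ℝ := 2 / (2 * (N : ℝ) + 1)

/-- Space-time points of `D_ε = ℝ × ε ℤ`: the pair `(t, k)` stands for the point `(t, ε k)`. -/
abbrev Pt : Type := ℝ × ℤ

/-- The measure on `D_ε` given by `∫ f(z) dz = ∫ ε ∑ₓ f(t, x) dt`. -/
def gridMeasure (ε : ℝ) : Measure Pt :=
  (volume : Measure ℝ).prod (ENNReal.ofReal ε • (Measure.count : Measure ℤ))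

/-- The parabolic size `‖(t, x)‖ = √|t| + |x|` of the point `(t, x) = (t, ε k)`. -/
def parabolicSize (ε : ℝ) (z : Pt) : ℝ := Real.sqrt |z.1| + ε * |(z.2 : ℝ)|

/-- The spatial difference operators: `grad ε true` is the forward one
`∇⁺ g(x) = (g(x + ε) - g(x)) / ε`, and `grad ε false` is the backward one
`∇⁻ g(x) = (g(x) - g(x - ε)) / ε`. A sign is encoded as `true` for `+`, `false` for `-`. -/
def grad (ε : ℝ) (s : Bool) (u : Pt → ℝ) : Pt → ℝ := fun z =>
  if s then (u (z.1, z.2 + 1) - u z) / ε else (u z - u (z.1, z.2 - 1)) / ε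

/-- The semidiscrete mixed derivative `∂ₜ^{j₀} (∇⁻)^{j₁} u`, for `u` restricted to times `t ≥ 0`
(one-sided time derivatives at `t = 0`). -/
def mixedDeriv (ε : ℝ) (j₀ j₁ : ℕ) (u : Pt → ℝ) : Pt → ℝ := fun z =>
  iteratedDerivWithin j₀ (fun t => ((grad ε false)^[j₁] u) (t, z.2)) (Set.Ici 0) z.1

/-- The discrete heat kernel `G^ε`, the Green function of `∂ₜ - (1/2) Δ_ε` with
`G^ε(0, x) = ε⁻¹ 1_{x = 0}`, through its Fourier integral; it is set to zero for `t < 0`. -/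
def heatKernel (ε : ℝ) : Pt → ℝ := fun z =>
  if z.1 < 0 then 0 else
    ∫ ω in (-(1 / (2 * ε)))..(1 / (2 * ε)),
      Real.exp (-((1 - Real.cos (2 * Real.pi * ε * ω)) / ε ^ 2) * z.1) *
        Real.cos (2 * Real.pi * ω * (ε * (z.2 : ℝ)))

/-- The convolution `(f ⋆⁺ g)(t, x) = ∫₀ᵗ ε ∑_y f(t - s, x - y) g(s, y) ds`. -/
def convPlus (ε : ℝ) (f g : Pt → ℝ) : Pt → ℝ := fun z =>
  ∫ w in Set.Icc 0 z.1 ×ˢ (Set.univ : Set ℤ), f (z - w) * g w ∂(gridMeasure ε)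

/-- The kernel `∇⁻ G^ε ∇⁺ G^ε`. -/
def gradProduct (ε : ℝ) : Pt → ℝ := fun z =>
  grad ε false (heatKernel ε) z * grad ε true (heatKernel ε) z

/-- The terms `(-ε)ⁿ (1 + √ε)ⁿ Q ⋆⁺ ⋯ ⋆⁺ Q ⋆⁺ G^ε` (with `n` factors `Q = ∇⁻ G^ε ∇⁺ G^ε`) of the
Neumann series for `(Id + (1 + √ε) ε Q ⋆⁺ ·)⁻¹ G^ε`. -/
def neumannTerm (ε : ℝ) (n : ℕ) : Pt → ℝ := fun z =>
  (-ε * (1 + Real.sqrt ε)) ^ n * ((convPlus ε (gradProduct ε))^[n] (heatKernel ε)) z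

/-- The kernel `G̃^ε = (Id + (1 + √ε) ε Q ⋆⁺ ·)⁻¹ G^ε`. -/
def tildeHeatKernel (ε : ℝ) : Pt → ℝ := fun z => ∑' n : ℕ, neumannTerm ε n z

/-- The index `M = -⌊log₂ ε⌋` of the smallest dyadic scale. -/
def lastScale (ε : ℝ) : ℕ := (-⌊Real.logb 2 ε⌋).toNat

/-- `K` is a singular part of the kernel `u` (given on times `t ≥ 0`): `u = K + R` for `t ≥ 0`, where
`K` vanishes for negative times, is even in space and is a sum of kernels `Kn n`, `0 ≤ n ≤ M`, the
`n`-th one living on the parabolic ball of radius `c 2⁻ⁿ` and having mixed derivatives of parabolic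
order `|j| = 2 j₀ + j₁ ≤ r` of size at most `C 2^{n (1 + |j|)}`, and where the mixed derivatives
of `R` of parabolic order at most `r` are bounded by `C`. -/
def IsSingularPart (ε : ℝ) (r : ℕ) (c C : ℝ) (u K : Pt → ℝ) : Prop :=
  ∃ (Kn : ℕ → Pt → ℝ) (R : Pt → ℝ),
    (∀ z : Pt, 0 ≤ z.1 → u z = K z + R z) ∧
    (∀ z : Pt, z.1 < 0 → K z = 0) ∧
    (∀ (t : ℝ) (k : ℤ), K (t, -k) = K (t, k)) ∧
    (∀ z : Pt, 0 ≤ z.1 → K z = ∑ n ∈ Finset.range (lastScale ε + 1), Kn n z) ∧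
    (∀ n ≤ lastScale ε, ∀ z : Pt, 0 ≤ z.1 → c * 2⁻¹ ^ n < parabolicSize ε z → Kn n z = 0) ∧
    (∀ n ≤ lastScale ε, ∀ k : ℤ,
      ContDiffOn ℝ ((r / 2 : ℕ) : ℕ∞) (fun t => Kn n (t, k)) (Set.Ici 0)) ∧
    (∀ n ≤ lastScale ε, ∀ j₀ j₁ : ℕ, 2 * j₀ + j₁ ≤ r → ∀ z : Pt, 0 ≤ z.1 →
      |mixedDeriv ε j₀ j₁ (Kn n) z| ≤ C * 2 ^ (n * (1 + (2 * j₀ + j₁)))) ∧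
    (∀ k : ℤ, ContDiffOn ℝ ((r / 2 : ℕ) : ℕ∞) (fun t => R (t, k)) (Set.Ici 0)) ∧
    (∀ j₀ j₁ : ℕ, 2 * j₀ + j₁ ≤ r → ∀ z : Pt, 0 ≤ z.1 → |mixedDeriv ε j₀ j₁ R z| ≤ C)

/-- Integrand of `pairing`. -/
def pairingIntegrand (ε : ℝ) (K : Pt → ℝ) (l₁ l₂ : Bool) (z₁ z₂ : Pt) : Pt → ℝ := fun z =>
  grad ε l₁ K (z₁ - z) * grad ε l₂ K (z₂ - z)

/-- `Q_{l₁, l₂}(z₁, z₂) = ∫ ∇^{l₁} K(z₁ - z) ∇^{l₂} K(z₂ - z) dz`, the contraction of two noises. -/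
def pairing (ε : ℝ) (K : Pt → ℝ) (l₁ l₂ : Bool) (z₁ z₂ : Pt) : ℝ :=
  ∫ z, pairingIntegrand ε K l₁ l₂ z₁ z₂ z ∂(gridMeasure ε)

/-- Integrand of `symConst`. -/
def symIntegrand (ε : ℝ) (K Kt : Pt → ℝ) : Pt × Pt → ℝ := fun w =>
  grad ε false Kt (-w.1) * grad ε true Kt (-w.2) *
    (pairing ε K true true w.1 w.2 * pairing ε K false false w.1 w.2 +
      pairing ε K true false w.1 w.2 * pairing ε K false true w.1 w.2)

/-- The renormalisation constant of the symmetric tree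
`∂₋ Ĩ(V) ∂₊ Ĩ(V)`, where `V = ∂₋ I(Ξ) ∂₊ I(Ξ)`: the sum over the two contractions of the noises
of one copy of `V` with those of the other one. -/
def symConst (ε : ℝ) (K Kt : Pt → ℝ) : ℝ :=
  ∫ w, symIntegrand ε K Kt w ∂((gridMeasure ε).prod (gridMeasure ε))

/-- Integrand of `chainConst`. -/
def chainIntegrand (ε : ℝ) (K Kt : Pt → ℝ) (a b : Bool) : Pt × Pt → ℝ := fun w =>
  grad ε a Kt (-w.1) * grad ε b Kt (w.1 - w.2) *
    (pairing ε K (!b) true w.1 w.2 * pairing ε K (!a) false 0 w.2 +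
      pairing ε K (!b) false w.1 w.2 * pairing ε K (!a) true 0 w.2)

/-- The renormalisation constant of the tree
`∂₋ₐ I(Ξ) ∂ₐ Ĩ(∂₋ᵦ I(Ξ) ∂ᵦ Ĩ(V))` for two signs `a`, `b`, where `V = ∂₋ I(Ξ) ∂₊ I(Ξ)`: the sum
over the two contractions of the two outer noises with the two noises of `V`. -/
def chainConst (ε : ℝ) (K Kt : Pt → ℝ) (a b : Bool) : ℝ :=
  ∫ w, chainIntegrand ε K Kt a b w ∂((gridMeasure ε).prod (gridMeasure ε))

end LatticeKPZ

end

open MeasureTheory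

noncomputable section

namespace LatticeKPZ

/-! Measure singularities in powers of `(‖z‖ + ε)⁻¹`. The kernels `G` and `G̃` have one power, their
gradients two, and space-time has homogeneous dimension three. Each constant is a double integral of
six powers, so power counting alone allows a logarithmic divergence. Boundedness of the sum comes
from an exact lattice cancellation, available because `G̃` is close enough to `G`.

Correlations. Since `∇⁺` is a translate of `∇⁻`, all pairings are shifts of one function `corr`. The
singular part `K` of `G` solves the lattice heat equation up to a bounded defect and starts from the
lattice delta up to a bounded remainder. Differentiating `ε ∑ K(t + s, x + y) K(s, y)` in `s` and
summing by parts therefore shows that, for `t ≥ 0`, `corr` is `K` plus a function which is bounded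
together with its gradient (`corr_eq_sub`, `exists_abs_corr_sub_le`).

Comparison of `G̃` with `G`. Here `G̃ = G - ε (1 + √ε) Q ⋆⁺ G̃`, and the available bound on the mass
of `ε |Q|` is only of order one, which gives no smallness. But `ε ∑ G(t, x) G(t, x - ε)` vanishes at
`t = 0` and its time derivative is `-ε ∑ ∇⁻G ∇⁺G` up to boundary terms, so the signed mass of `Q` up
to time `t` is only of order `1 / (√t + ε)` (`abs_setIntegral_gradProduct_near_le`). The convolution
is split into this mass times `∇K̃(z)` and a commutator controlled by the Hölder-1/2 regularity of
`∇K̃`. The outcome is `|∇(G̃ - G)| ≲ √ε (‖z‖ + ε)^(-5/2) + 1` on bounded sets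
(`exists_abs_grad_tildeHeatKernel_sub_le`).

Cancellation. Let `J` be `corr` restricted to `t ≥ 0` and `L` the singular part of `G̃`. A change of
variables, with the symmetric constant split by the time order of its two inner vertices, turns the
five constants into two integrals of `totalIntegrand`, one for each sign of the outer derivative
(`PairBound.constants_eq`). If the inner copies of `L` were `J`, the integrand would be a discrete
derivative in the second variable, which integrates to zero, up to an `ε²` term with four gradients
(`totalIntegrand_eq`). The terms containing `∇(L - J)` gain `√ε` at the price of half a power, and
the resulting double integrals are bounded uniformly (`lintegral_locWt_locWt_diffWt_le`). One of
them is still marginal in absolute value; it is odd under spatial reflection up to a difference of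
`J` at two points, and averaging with the reflected integrand supplies the missing factor
(`PairBound.abs_oddPart_add_le`). -/

/-! ### The grid measure and its symmetries. -/

instance gridMeasure.instSFinite (ε : ℝ) : SFinite (gridMeasure ε) := by
  unfold gridMeasure; infer_instance

instance gridMeasure.instIsAddLeftInvariant (ε : ℝ) : (gridMeasure ε).IsAddLeftInvariant := by
  unfold gridMeasure; infer_instance

instance gridMeasure.instIsAddRightInvariant (ε : ℝ) : (gridMeasure ε).IsAddRightInvariant := by
  infer_instance

lemma measurePreserving_neg_count (c : ENNReal) :
    MeasurePreserving (fun k : ℤ => -k) (c • Measure.count) (c • Measure.count) := by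
  refine ⟨measurable_of_countable _, ?_⟩
  ext s hs
  rw [Measure.map_apply (measurable_of_countable _) hs, Measure.smul_apply, Measure.smul_apply,
    Measure.count_apply hs, Measure.count_apply (measurable_of_countable _ hs),
    Set.encard_preimage_of_bijective neg_involutive.bijective]

/-- The spatial reflection `(t, x) ↦ (t, -x)`. -/
def reflect (z : Pt) : Pt := (z.1, -z.2)

lemma measurePreserving_reflect (ε : ℝ) :
    MeasurePreserving reflect (gridMeasure ε) (gridMeasure ε) :=
  (MeasurePreserving.id volume).prod (measurePreserving_neg_count _)

instance gridMeasure.instIsNegInvariant (ε : ℝ) : (gridMeasure ε).IsNegInvariant :=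
  ⟨((Measure.measurePreserving_neg (volume : Measure ℝ)).prod
    (measurePreserving_neg_count (ENNReal.ofReal ε))).map_eq⟩

lemma lintegral_gridMeasure (ε : ℝ) {F : Pt → ENNReal} (hF : Measurable F) :
    ∫⁻ z, F z ∂(gridMeasure ε) = ∫⁻ t, ENNReal.ofReal ε * ∑' k, F (t, k) := by
  unfold gridMeasure
  rw [lintegral_prod _ hF.aemeasurable]
  simp only [lintegral_smul_measure, lintegral_count, smul_eq_mul]

lemma lintegral_gridMeasure_mul (ε : ℝ) {f : ℝ → ENNReal} {g : ℤ → ENNReal} (hf : Measurable f) :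
    ∫⁻ z, f z.1 * g z.2 ∂(gridMeasure ε) = (∫⁻ t, f t) * (ENNReal.ofReal ε * ∑' k, g k) := by
  unfold gridMeasure
  rw [lintegral_prod_mul hf.aemeasurable (measurable_of_countable _).aemeasurable]
  simp only [lintegral_smul_measure, lintegral_count, smul_eq_mul]

/-! ### Parabolic size and the basic weight. -/

lemma measurable_parabolicSize (ε : ℝ) : Measurable (parabolicSize ε) := by
  unfold parabolicSize
  have : Measurable fun z : Pt => |(z.2 : ℝ)| :=
    (measurable_of_countable fun k : ℤ => |(k : ℝ)|).comp measurable_snd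
  fun_prop

lemma parabolicSize_nonneg {ε : ℝ} (hε : 0 ≤ ε) (z : Pt) : 0 ≤ parabolicSize ε z := by
  unfold parabolicSize; positivity

lemma parabolicSize_neg (ε : ℝ) (z : Pt) : parabolicSize ε (-z) = parabolicSize ε z := by
  simp [parabolicSize]

lemma parabolicSize_reflect (ε : ℝ) (z : Pt) : parabolicSize ε (reflect z) = parabolicSize ε z := by
  simp [parabolicSize, reflect]

lemma parabolicSize_add_le {ε : ℝ} (hε : 0 ≤ ε) (z w : Pt) :
    parabolicSize ε (z + w) ≤ parabolicSize ε z + parabolicSize ε w := by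
  have h1 : Real.sqrt |z.1 + w.1| ≤ Real.sqrt |z.1| + Real.sqrt |w.1| := by
    rw [Real.sqrt_le_left (by positivity)]
    have := abs_add_le z.1 w.1
    nlinarith [Real.sq_sqrt (abs_nonneg z.1), Real.sq_sqrt (abs_nonneg w.1),
      Real.sqrt_nonneg |z.1|, Real.sqrt_nonneg |w.1|,
      mul_nonneg (Real.sqrt_nonneg |z.1|) (Real.sqrt_nonneg |w.1|)]
  have h2 : |((z.2 + w.2 : ℤ) : ℝ)| ≤ |(z.2 : ℝ)| + |(w.2 : ℝ)| := by
    push_cast; exact abs_add_le _ _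
  unfold parabolicSize
  simp only [Prod.fst_add, Prod.snd_add]
  nlinarith [mul_le_mul_of_nonneg_left h2 hε]

/-- The fourth root of the size `1 / (‖z‖ + ε)` of the heat kernel. -/
def wt (ε : ℝ) (z : Pt) : ℝ := (parabolicSize ε z + ε) ^ (-(1 / 4) : ℝ)

lemma measurable_wt (ε : ℝ) : Measurable (wt ε) := by
  unfold wt
  exact ((measurable_parabolicSize ε).add_const ε).pow_const _

lemma size_add_pos {ε : ℝ} (hε : 0 < ε) (z : Pt) : 0 < parabolicSize ε z + ε := by
  have := parabolicSize_nonneg hε.le z; linarith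

lemma wt_pos {ε : ℝ} (hε : 0 < ε) (z : Pt) : 0 < wt ε z := Real.rpow_pos_of_pos (size_add_pos hε z) _

lemma wt_pow {ε : ℝ} (hε : 0 < ε) (z : Pt) (n : ℕ) : wt ε z ^ n = (parabolicSize ε z + ε) ^ (-((n : ℝ) / 4)) := by
  unfold wt
  rw [← Real.rpow_natCast, ← Real.rpow_mul (size_add_pos hε z).le]
  congr 1; ring

lemma wt_pow_four {ε : ℝ} (hε : 0 < ε) (z : Pt) : wt ε z ^ 4 = (parabolicSize ε z + ε)⁻¹ := by
  rw [wt_pow hε, ← Real.rpow_neg_one]; norm_num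

lemma wt_pow_four_mul {ε : ℝ} (hε : 0 < ε) (z : Pt) : wt ε z ^ 4 * (parabolicSize ε z + ε) = 1 := by
  rw [wt_pow_four hε, inv_mul_cancel₀ (size_add_pos hε z).ne']

/-! ### Integrals of powers of the weight. -/

/-- Parabolic scaling `t = ε² s`, after `(√|t| + ε)² ≥ |t| + ε²`, reduces to the integral of `(1 +
|s|)^(-a/2)`, which converges because `2 < a`. -/
lemma lintegral_sqrt_abs_add_rpow_le {a : ℝ} (ha : 2 < a) :
    ∃ C : ℝ, 0 ≤ C ∧ ∀ ε : ℝ, 0 < ε →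
      ∫⁻ t : ℝ, ENNReal.ofReal ((Real.sqrt |t| + ε) ^ (-a)) ≤ ENNReal.ofReal (C * ε ^ (2 - a)) := by
  have hint : Integrable (fun s : ℝ => (1 + ‖s‖) ^ (-(a / 2))) volume :=
    integrable_one_add_norm (by simp; linarith)
  refine ⟨∫ s : ℝ, (1 + ‖s‖) ^ (-(a / 2)), integral_nonneg fun s => by positivity, fun ε hε => ?_⟩
  have hpt : ∀ t : ℝ, (Real.sqrt |t| + ε) ^ (-a) ≤
      ε ^ (-a) * (1 + ‖(ε ^ 2)⁻¹ * t‖) ^ (-(a / 2)) := by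
    intro t
    have h1 : (Real.sqrt |t| + ε) ^ (-a) = ((Real.sqrt |t| + ε) ^ 2) ^ (-(a / 2)) := by
      rw [← Real.rpow_natCast, ← Real.rpow_mul (by positivity)]
      congr 1; push_cast; ring
    have h2 : ε ^ (-a) = (ε ^ 2) ^ (-(a / 2)) := by
      rw [← Real.rpow_natCast, ← Real.rpow_mul (by positivity)]
      congr 1; push_cast; ring
    rw [h1, h2, ← Real.mul_rpow (by positivity) (by positivity)]
    refine Real.rpow_le_rpow_of_nonpos (by positivity) ?_ (by linarith)
    rw [norm_mul, norm_inv, Real.norm_of_nonneg (by positivity : (0 : ℝ) ≤ ε ^ 2), mul_add, mul_one,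
      mul_inv_cancel_left₀ (by positivity), Real.norm_eq_abs]
    nlinarith [Real.sq_sqrt (abs_nonneg t), mul_nonneg (Real.sqrt_nonneg |t|) hε.le]
  calc ∫⁻ t : ℝ, ENNReal.ofReal ((Real.sqrt |t| + ε) ^ (-a))
      ≤ ∫⁻ t : ℝ, ENNReal.ofReal (ε ^ (-a) * (1 + ‖(ε ^ 2)⁻¹ * t‖) ^ (-(a / 2))) :=
        lintegral_mono fun t => ENNReal.ofReal_le_ofReal (hpt t)
    _ = ENNReal.ofReal (∫ t : ℝ, ε ^ (-a) * (1 + ‖(ε ^ 2)⁻¹ * t‖) ^ (-(a / 2))) := by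
        rw [ofReal_integral_eq_lintegral_ofReal]
        · exact (hint.comp_mul_left' (by positivity)).const_mul _
        · exact Filter.Eventually.of_forall fun t => by positivity
    _ = _ := by
        rw [integral_const_mul, Measure.integral_comp_mul_left
          (fun s : ℝ => (1 + ‖s‖) ^ (-(a / 2))) (ε ^ 2)⁻¹]
        congr 1
        rw [inv_inv, abs_of_pos (by positivity), smul_eq_mul, Real.rpow_sub hε, Real.rpow_neg hε.le,
          Real.rpow_two]
        ring

lemma tsum_lattice_rpow_le {b : ℝ} (hb : 1 < b) :
    ∃ C : ℝ, 0 ≤ C ∧ ∀ ε : ℝ, 0 < ε →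
      ENNReal.ofReal ε * ∑' k : ℤ, ENNReal.ofReal ((ε * |(k : ℝ)| + ε) ^ (-b)) ≤
        ENNReal.ofReal (C * ε ^ (1 - b)) := by
  have hs : Summable fun k : ℤ => (|(k : ℝ)| + 1) ^ (-b) := by
    have hn : Summable fun n : ℕ => ((n : ℝ) + 1) ^ (-b) := by
      refine ((Real.summable_one_div_nat_add_rpow 1 b).2 hb).congr fun n => ?_
      rw [abs_of_nonneg (by positivity), Real.rpow_neg (by positivity), one_div]
    exact Summable.of_nat_of_neg (by simpa using hn) (by simpa using hn)
  refine ⟨∑' k : ℤ, (|(k : ℝ)| + 1) ^ (-b), tsum_nonneg fun k => by positivity, fun ε hε => ?_⟩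
  have h : ∀ k : ℤ, ENNReal.ofReal ((ε * |(k : ℝ)| + ε) ^ (-b)) =
      ENNReal.ofReal (ε ^ (-b)) * ENNReal.ofReal ((|(k : ℝ)| + 1) ^ (-b)) := by
    intro k
    rw [← ENNReal.ofReal_mul (by positivity), ← Real.mul_rpow hε.le (by positivity), mul_add,
      mul_one]
  simp_rw [h]
  rw [ENNReal.tsum_mul_left, ← ENNReal.ofReal_tsum_of_nonneg (fun k => by positivity) hs, ← mul_assoc,
    ← ENNReal.ofReal_mul hε.le, ← ENNReal.ofReal_mul (by positivity)]
  refine ENNReal.ofReal_le_ofReal (le_of_eq ?_)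
  rw [Real.rpow_sub hε, Real.rpow_neg hε.le, Real.rpow_one]
  ring

/-- The weight is dominated by a product of a time factor and a space factor. The critical exponent
is the homogeneous dimension `3 = 2 + 1`. -/
lemma lintegral_size_rpow_le {a b : ℝ} (ha : 2 < a) (hb : 1 < b) :
    ∃ C : ℝ, 0 ≤ C ∧ ∀ ε : ℝ, 0 < ε →
      ∫⁻ z, ENNReal.ofReal ((parabolicSize ε z + ε) ^ (-(a + b))) ∂(gridMeasure ε) ≤
        ENNReal.ofReal (C * ε ^ (3 - (a + b))) := by
  obtain ⟨C₁, hC₁, h₁⟩ := lintegral_sqrt_abs_add_rpow_le ha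
  obtain ⟨C₂, hC₂, h₂⟩ := tsum_lattice_rpow_le hb
  refine ⟨C₁ * C₂, by positivity, fun ε hε => ?_⟩
  calc ∫⁻ z, ENNReal.ofReal ((parabolicSize ε z + ε) ^ (-(a + b))) ∂(gridMeasure ε)
      ≤ ∫⁻ z, ENNReal.ofReal ((Real.sqrt |z.1| + ε) ^ (-a)) *
          ENNReal.ofReal ((ε * |(z.2 : ℝ)| + ε) ^ (-b)) ∂(gridMeasure ε) := by
        refine lintegral_mono fun z => ?_
        rw [← ENNReal.ofReal_mul (by positivity)]
        refine ENNReal.ofReal_le_ofReal ?_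
        rw [neg_add, Real.rpow_add (size_add_pos hε z)]
        have h3 : 0 ≤ ε * |(z.2 : ℝ)| := by positivity
        have h4 := Real.sqrt_nonneg |z.1|
        refine mul_le_mul ?_ ?_ (by have := size_add_pos hε z; positivity) (by positivity)
        · exact Real.rpow_le_rpow_of_nonpos (by positivity) (by unfold parabolicSize; linarith)
            (by linarith)
        · exact Real.rpow_le_rpow_of_nonpos (by positivity) (by unfold parabolicSize; linarith)
            (by linarith)
    _ = (∫⁻ t : ℝ, ENNReal.ofReal ((Real.sqrt |t| + ε) ^ (-a))) *
          (ENNReal.ofReal ε * ∑' k : ℤ, ENNReal.ofReal ((ε * |(k : ℝ)| + ε) ^ (-b))) :=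
        lintegral_gridMeasure_mul ε (f := fun t => ENNReal.ofReal ((Real.sqrt |t| + ε) ^ (-a)))
          (g := fun k => ENNReal.ofReal ((ε * |(k : ℝ)| + ε) ^ (-b))) (by fun_prop)
    _ ≤ ENNReal.ofReal (C₁ * ε ^ (2 - a)) * ENNReal.ofReal (C₂ * ε ^ (1 - b)) :=
        mul_le_mul' (h₁ ε hε) (h₂ ε hε)
    _ = _ := by
        rw [← ENNReal.ofReal_mul (by positivity)]
        congr 1
        rw [show 3 - (a + b) = (2 - a) + (1 - b) by ring, Real.rpow_add hε]
        ring

/-- Because `wt` is a fourth root, the critical power is 12. Supercritical powers concentrate at the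
mesh scale, which fixes the power of `ε`. -/
lemma lintegral_wt_pow_le {n : ℕ} (hn : 12 < n) :
    ∃ C : ℝ, 0 ≤ C ∧ ∀ ε : ℝ, 0 < ε →
      ∫⁻ z, ENNReal.ofReal (wt ε z ^ n) ∂(gridMeasure ε) ≤
        ENNReal.ofReal (C * ε ^ (3 - (n : ℝ) / 4)) := by
  have hn' : (12 : ℝ) < n := by exact_mod_cast hn
  -- The excess `n/4 - 3` over the dimension is shared equally between time and space.
  obtain ⟨C, hC, h⟩ := lintegral_size_rpow_le (a := (n / 4 - 3) / 2 + 2) (b := (n / 4 - 3) / 2 + 1)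
    (by linarith) (by linarith)
  refine ⟨C, hC, fun ε hε => ?_⟩
  have := h ε hε
  rw [show ((n : ℝ) / 4 - 3) / 2 + 2 + ((n / 4 - 3) / 2 + 1) = n / 4 by ring] at this
  simpa only [wt_pow hε] using this

lemma sum_range_rpow_neg_half_le (n : ℕ) :
    ∑ k ∈ Finset.range n, ((k : ℝ) + 1) ^ (-(1 / 2) : ℝ) ≤ 2 * Real.sqrt n := by
  induction n with
  | zero => simp
  | succ n ih =>
    rw [Finset.sum_range_succ]
    have h1 : ((n : ℝ) + 1) ^ (-(1 / 2) : ℝ) = (Real.sqrt (n + 1))⁻¹ := by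
      rw [Real.rpow_neg (by positivity), Real.sqrt_eq_rpow]
    have h2 : (Real.sqrt (n + 1))⁻¹ ≤ 2 * Real.sqrt (n + 1) - 2 * Real.sqrt n := by
      have hp : 0 < Real.sqrt ((n : ℝ) + 1) := Real.sqrt_pos.2 (by positivity)
      rw [inv_le_iff_one_le_mul₀ hp]
      nlinarith [Real.sq_sqrt (by positivity : (0 : ℝ) ≤ n + 1),
        Real.sq_sqrt (by positivity : (0 : ℝ) ≤ n), sq_nonneg (Real.sqrt (n + 1) - Real.sqrt n)]
    push_cast
    rw [h1]; linarith

lemma tsum_lattice_rpow_half_le {c : ℝ} (hc : 0 ≤ c) {ε : ℝ} (hε : 0 < ε) (hε1 : ε ≤ 1) :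
    ENNReal.ofReal ε * ∑' k : ℤ, (if ε * |(k : ℝ)| ≤ c then
      ENNReal.ofReal ((ε * |(k : ℝ)| + ε) ^ (-(1 / 2) : ℝ)) else 0) ≤
      ENNReal.ofReal (4 * Real.sqrt (c + 1)) := by
  set n : ℕ := ⌊c / ε⌋₊ + 1 with hn
  have hnle : (n : ℝ) * ε ≤ c + 1 := by
    have := Nat.floor_le (show 0 ≤ c / ε by positivity)
    rw [le_div_iff₀ hε] at this
    rw [hn]; push_cast; nlinarith
  have hsupp : ∀ k : ℕ, ε * (k : ℝ) ≤ c → k < n := by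
    intro k hk
    rw [hn, Nat.lt_succ_iff]
    exact Nat.le_floor (by rw [le_div_iff₀ hε]; linarith)
  have hnat : ENNReal.ofReal ε * ∑' k : ℕ, (if ε * (k : ℝ) ≤ c then
      ENNReal.ofReal ((ε * (k : ℝ) + ε) ^ (-(1 / 2) : ℝ)) else 0) ≤
      ENNReal.ofReal (2 * Real.sqrt (c + 1)) := by
    rw [tsum_eq_sum (s := Finset.range n) (fun k hk => if_neg fun h => hk
      (Finset.mem_range.2 (hsupp k h)))]
    calc ENNReal.ofReal ε * ∑ k ∈ Finset.range n, (if ε * (k : ℝ) ≤ c then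
          ENNReal.ofReal ((ε * (k : ℝ) + ε) ^ (-(1 / 2) : ℝ)) else 0)
        ≤ ENNReal.ofReal ε * ∑ k ∈ Finset.range n,
            ENNReal.ofReal (ε ^ (-(1 / 2) : ℝ) * ((k : ℝ) + 1) ^ (-(1 / 2) : ℝ)) := by
          gcongr with k
          split_ifs
          · rw [← Real.mul_rpow hε.le (by positivity), mul_add, mul_one]
          · simp
      _ = ENNReal.ofReal (ε * (ε ^ (-(1 / 2) : ℝ) *
            ∑ k ∈ Finset.range n, ((k : ℝ) + 1) ^ (-(1 / 2) : ℝ))) := by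
          rw [← ENNReal.ofReal_sum_of_nonneg (fun k _ => by positivity),
            ← ENNReal.ofReal_mul hε.le, ← Finset.mul_sum]
      _ ≤ _ := by
          refine ENNReal.ofReal_le_ofReal ?_
          have h1 : ε * ε ^ (-(1 / 2) : ℝ) = Real.sqrt ε := by
            rw [Real.sqrt_eq_rpow]
            nth_rw 1 [← Real.rpow_one ε]
            rw [← Real.rpow_add hε]; norm_num
          rw [← mul_assoc, h1]
          calc Real.sqrt ε * _ ≤ Real.sqrt ε * (2 * Real.sqrt n) := by
                gcongr; exact sum_range_rpow_neg_half_le n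
            _ = 2 * Real.sqrt (n * ε) := by
                rw [Real.sqrt_mul (by positivity)]; ring
            _ ≤ _ := by gcongr
  set F : ℤ → ENNReal := fun k => if ε * |(k : ℝ)| ≤ c then
      ENNReal.ofReal ((ε * |(k : ℝ)| + ε) ^ (-(1 / 2) : ℝ)) else 0 with hF
  -- The origin is counted twice here; only an upper bound is wanted.
  have hle : ∑' k : ℤ, F k ≤ ∑' k : ℕ, F k + ∑' k : ℕ, F (-k) := by
    rw [tsum_of_nat_of_neg_add_one ENNReal.summable ENNReal.summable]
    exact add_le_add le_rfl (ENNReal.tsum_comp_le_tsum_of_injective (f := fun n : ℕ => n + 1)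
      (add_left_injective 1) (fun n : ℕ => F (-(n : ℤ))))
  calc ENNReal.ofReal ε * ∑' k : ℤ, F k
      ≤ ENNReal.ofReal ε * (∑' k : ℕ, F k + ∑' k : ℕ, F (-k)) := by gcongr
    _ ≤ ENNReal.ofReal (2 * Real.sqrt (c + 1)) + ENNReal.ofReal (2 * Real.sqrt (c + 1)) := by
        rw [mul_add]
        refine add_le_add (le_trans (le_of_eq ?_) hnat) (le_trans (le_of_eq ?_) hnat) <;> simp [hF]
    _ = _ := by
        rw [← ENNReal.ofReal_add (by positivity) (by positivity)]; congr 1; ring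

lemma setLIntegral_abs_rpow_lt_top {r : ℝ} (hr : -1 < r) (T : ℝ) :
    ∫⁻ t in Set.Icc (-T) T, ENNReal.ofReal (|t| ^ r) < ⊤ := by
  have h0 : ∫⁻ t in Set.Icc 0 T, ENNReal.ofReal (|t| ^ r) < ⊤ := by
    rcases le_or_gt 0 T with hT | hT
    swap
    · rw [Set.Icc_eq_empty (by linarith)]; simp
    have hi : IntegrableOn (fun t : ℝ => |t| ^ r) (Set.Icc 0 T) := by
      have h := (intervalIntegrable_iff_integrableOn_Icc_of_le hT).1
        (intervalIntegral.intervalIntegrable_rpow' hr (a := 0) (b := T))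
      refine h.congr_fun (fun t ht => ?_) measurableSet_Icc
      simp only [abs_of_nonneg ht.1]
    exact hi.lintegral_lt_top
  have h1 : ∫⁻ t in Set.Icc (-T) 0, ENNReal.ofReal (|t| ^ r) < ⊤ := by
    have := (Measure.measurePreserving_neg (volume : Measure ℝ)).setLIntegral_comp_preimage
      (measurableSet_Icc (a := 0) (b := T)) (f := fun t => ENNReal.ofReal (|t| ^ r)) (by fun_prop)
    simp only [abs_neg, Set.neg_preimage, Set.neg_Icc, neg_zero] at this
    rw [this]; exact h0
  refine lt_of_le_of_lt (lintegral_mono_set (Set.Icc_subset_Icc_union_Icc (b := 0))) ?_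
  exact lt_of_le_of_lt (lintegral_union_le _ _ _) (ENNReal.add_lt_top.2 ⟨h1, h0⟩)

/-- The square of the heat kernel size `1 / (‖z‖ + ε)`, cut off at distance `c`. -/
def locWt (ε c : ℝ) (z : Pt) : ℝ := if parabolicSize ε z ≤ c then wt ε z ^ 8 else 0

lemma measurable_locWt (ε c : ℝ) : Measurable (locWt ε c) :=
  Measurable.ite (measurableSet_le (measurable_parabolicSize ε) measurable_const)
    ((measurable_wt ε).pow_const 8) measurable_const

lemma locWt_nonneg {ε : ℝ} (hε : 0 < ε) (c : ℝ) (z : Pt) : 0 ≤ locWt ε c z := by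
  unfold locWt; split_ifs
  · exact pow_nonneg (wt_pos hε z).le 8
  · exact le_rfl

lemma locWt_le {ε : ℝ} (hε : 0 < ε) (c : ℝ) (z : Pt) : locWt ε c z ≤ wt ε z ^ 8 := by
  unfold locWt; split_ifs
  · exact le_rfl
  · exact pow_nonneg (wt_pos hε z).le 8

lemma ae_fst_ne (ε a : ℝ) : ∀ᵐ z ∂(gridMeasure ε), z.1 ≠ a := by
  have : (gridMeasure ε) {z : Pt | ¬ z.1 ≠ a} = 0 := by
    have : {z : Pt | ¬ z.1 ≠ a} = {a} ×ˢ Set.univ := by ext z; simp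
    rw [this]; unfold gridMeasure
    rw [Measure.prod_prod, Real.volume_singleton, zero_mul]
  exact this

/-- The power `-2` is split as `-3/2` on `√|t|` and `-1/2` on space. Both factors are locally
integrable, so the bound is uniform in the mesh. -/
lemma lintegral_locWt_le (c : ℝ) :
    ∃ C : ℝ, 0 ≤ C ∧ ∀ ε : ℝ, 0 < ε → ε ≤ 1 →
      ∫⁻ z, ENNReal.ofReal (locWt ε c z) ∂(gridMeasure ε) ≤ ENNReal.ofReal C := by
  set I := ∫⁻ t in Set.Icc (-(|c| ^ 2)) (|c| ^ 2), ENNReal.ofReal (|t| ^ (-(3 / 4) : ℝ)) with hI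
  have hIt : I < ⊤ := setLIntegral_abs_rpow_lt_top (by norm_num) _
  refine ⟨I.toReal * (4 * Real.sqrt (|c| + 1)), by positivity, fun ε hε hε1 => ?_⟩
  calc ∫⁻ z, ENNReal.ofReal (locWt ε c z) ∂(gridMeasure ε)
      ≤ ∫⁻ z, (Set.Icc (-(|c| ^ 2)) (|c| ^ 2)).indicator
            (fun t => ENNReal.ofReal (|t| ^ (-(3 / 4) : ℝ))) z.1 *
          (if ε * |(z.2 : ℝ)| ≤ |c| then
            ENNReal.ofReal ((ε * |(z.2 : ℝ)| + ε) ^ (-(1 / 2) : ℝ)) else 0) ∂(gridMeasure ε) := by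
        refine lintegral_mono_ae ?_
        -- Time zero has to be removed: there `|t| ^ (-3/4)` takes the default value 0 and dominates
        -- nothing.
        filter_upwards [ae_fst_ne ε 0] with z hz
        unfold locWt
        split_ifs with h1 h2 h2
        · have hs : 0 < Real.sqrt |z.1| := Real.sqrt_pos.2 (abs_pos.2 hz)
          have h3 : 0 ≤ ε * |(z.2 : ℝ)| := by positivity
          have h4 : Real.sqrt |z.1| ≤ |c| := by
            have := le_abs_self c
            unfold parabolicSize at h1; linarith
          have h5 : |z.1| ≤ |c| ^ 2 := by
            rw [← Real.sq_sqrt (abs_nonneg z.1)]; gcongr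
          rw [Set.indicator_of_mem (show z.1 ∈ Set.Icc (-(|c| ^ 2)) (|c| ^ 2) from abs_le.1 h5), ← ENNReal.ofReal_mul (by positivity)]
          refine ENNReal.ofReal_le_ofReal ?_
          rw [wt_pow hε, show -(((8 : ℕ) : ℝ) / 4) = -(3 / 2) + -(1 / 2) by norm_num,
            Real.rpow_add (size_add_pos hε z)]
          have h6 : |z.1| ^ (-(3 / 4) : ℝ) = (Real.sqrt |z.1|) ^ (-(3 / 2) : ℝ) := by
            rw [Real.sqrt_eq_rpow, ← Real.rpow_mul (abs_nonneg _)]; norm_num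
          rw [h6]
          refine mul_le_mul ?_ ?_ (by have := size_add_pos hε z; positivity) (by positivity)
          · exact Real.rpow_le_rpow_of_nonpos hs (by unfold parabolicSize; linarith) (by norm_num)
          · exact Real.rpow_le_rpow_of_nonpos (by positivity) (by unfold parabolicSize; linarith)
              (by norm_num)
        · exfalso; apply h2
          have := le_abs_self c
          have := Real.sqrt_nonneg |z.1|
          unfold parabolicSize at h1; linarith
        · simp
        · simp
    _ = I * (ENNReal.ofReal ε * ∑' k : ℤ, (if ε * |(k : ℝ)| ≤ |c| then
            ENNReal.ofReal ((ε * |(k : ℝ)| + ε) ^ (-(1 / 2) : ℝ)) else 0)) := by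
        rw [lintegral_gridMeasure_mul ε (f := (Set.Icc (-(|c| ^ 2)) (|c| ^ 2)).indicator
            (fun t => ENNReal.ofReal (|t| ^ (-(3 / 4) : ℝ))))
          (g := fun k => if ε * |(k : ℝ)| ≤ |c| then
            ENNReal.ofReal ((ε * |(k : ℝ)| + ε) ^ (-(1 / 2) : ℝ)) else 0)
          (Measurable.indicator (by fun_prop) measurableSet_Icc),
          lintegral_indicator measurableSet_Icc]
    _ ≤ I * ENNReal.ofReal (4 * Real.sqrt (|c| + 1)) := by
        gcongr; exact tsum_lattice_rpow_half_le (abs_nonneg c) hε hε1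
    _ = _ := by
        rw [ENNReal.ofReal_mul ENNReal.toReal_nonneg, ENNReal.ofReal_toReal hIt.ne]

lemma wt_neg (ε : ℝ) (z : Pt) : wt ε (-z) = wt ε z := by simp [wt, parabolicSize_neg]

lemma wt_reflect (ε : ℝ) (z : Pt) : wt ε (reflect z) = wt ε z := by
  simp [wt, parabolicSize_reflect]

/-! ### Double integrals with weights at three points. -/

lemma lintegral_prod_mul_sub (ε : ℝ) {f g : Pt → ENNReal} (hf : Measurable f) (hg : Measurable g) :
    ∫⁻ p, f p.1 * g (p.2 - p.1) ∂((gridMeasure ε).prod (gridMeasure ε)) =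
      (∫⁻ z, f z ∂(gridMeasure ε)) * ∫⁻ z, g z ∂(gridMeasure ε) := by
  rw [← lintegral_prod_mul hf.aemeasurable hg.aemeasurable]
  exact (measurePreserving_prod_sub (gridMeasure ε) (gridMeasure ε)).lintegral_comp
    (f := fun p : Pt × Pt => f p.1 * g p.2) (by fun_prop)

lemma lintegral_prod_mul_sub' (ε : ℝ) {f g : Pt → ENNReal} (hf : Measurable f) (hg : Measurable g)
    (hgn : ∀ z, g (-z) = g z) :
    ∫⁻ p, f p.2 * g (p.2 - p.1) ∂((gridMeasure ε).prod (gridMeasure ε)) =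
      (∫⁻ z, f z ∂(gridMeasure ε)) * ∫⁻ z, g z ∂(gridMeasure ε) := by
  rw [← lintegral_prod_mul_sub ε hf hg]
  refine (Measure.measurePreserving_swap (μ := gridMeasure ε) (ν := gridMeasure ε)).lintegral_comp
    (f := fun p : Pt × Pt => f p.1 * g (p.2 - p.1)) (by fun_prop) |>.symm.trans ?_ |>.symm
  refine lintegral_congr fun p => ?_
  simp only [Prod.fst_swap, Prod.snd_swap]
  rw [← hgn, neg_sub]

/-- The smallest of the three factors is absorbed into the two larger ones. The total power 26
becomes 13 + 13, just above the critical 12 in each variable. -/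
lemma pow_mul_pow_le_add {x y v : ℝ} (hx : 0 < x) (hy : 0 < y) (hv : 0 < v) :
    x ^ 8 * y ^ 8 * v ^ 10 ≤ x ^ 13 * y ^ 13 + x ^ 13 * v ^ 13 + y ^ 13 * v ^ 13 := by
  have key : ∀ a b d : ℝ, 0 < a → 0 < b → 0 < d → d ≤ a → d ≤ b →
      a ^ 8 * b ^ 8 * d ^ 10 ≤ a ^ 13 * b ^ 13 ∧ a ^ 8 * b ^ 10 * d ^ 8 ≤ a ^ 13 * b ^ 13 := by
    intro a b d ha hb hd h1 h2
    constructor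
    · calc a ^ 8 * b ^ 8 * d ^ 10 = a ^ 8 * b ^ 8 * (d ^ 5 * d ^ 5) := by ring
        _ ≤ a ^ 8 * b ^ 8 * (a ^ 5 * b ^ 5) := by gcongr
        _ = _ := by ring
    · calc a ^ 8 * b ^ 10 * d ^ 8 = a ^ 8 * b ^ 10 * (d ^ 5 * d ^ 3) := by ring
        _ ≤ a ^ 8 * b ^ 10 * (a ^ 5 * b ^ 3) := by gcongr
        _ = _ := by ring
  have p1 : 0 < x ^ 13 * y ^ 13 := by positivity
  have p2 : 0 < x ^ 13 * v ^ 13 := by positivity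
  have p3 : 0 < y ^ 13 * v ^ 13 := by positivity
  rcases le_total x y with h | h
  · rcases le_total x v with h' | h'
    · have := (key y v x hy hv hx h h').2; nlinarith
    · have := (key x y v hx hy hv h' (h'.trans h)).1; nlinarith
  · rcases le_total y v with h' | h'
    · have := (key x v y hx hv hy h h').2; nlinarith
    · have := (key x y v hx hy hv (h'.trans h) h').1; nlinarith

/-- Each integral of `wt ^ 13` costs `ε^(-1/4)`, and two of them are paid for exactly by `√ε`. Any
two of the points `p.1`, `p.2`, `p.2 - p.1` serve as independent variables. -/
lemma lintegral_three_wt_le :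
    ∃ C : ℝ, 0 ≤ C ∧ ∀ ε : ℝ, 0 < ε →
      ∫⁻ p, ENNReal.ofReal (Real.sqrt ε * (wt ε p.1 ^ 13 * wt ε p.2 ^ 13 +
        wt ε p.1 ^ 13 * wt ε (p.2 - p.1) ^ 13 + wt ε p.2 ^ 13 * wt ε (p.2 - p.1) ^ 13))
        ∂((gridMeasure ε).prod (gridMeasure ε)) ≤ ENNReal.ofReal C := by
  obtain ⟨C, hC, h⟩ := lintegral_wt_pow_le (n := 13) (by norm_num)
  refine ⟨3 * C ^ 2, by positivity, fun ε hε => ?_⟩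
  have hm := measurable_wt ε
  have hq := fun z => (wt_pos hε z).le
  set f : Pt → ENNReal := fun z => ENNReal.ofReal (wt ε z ^ 13) with hf
  have hfm : Measurable f := by fun_prop
  have e1 : ∀ p : Pt × Pt, ENNReal.ofReal (Real.sqrt ε * (wt ε p.1 ^ 13 * wt ε p.2 ^ 13 +
        wt ε p.1 ^ 13 * wt ε (p.2 - p.1) ^ 13 + wt ε p.2 ^ 13 * wt ε (p.2 - p.1) ^ 13)) =
      ENNReal.ofReal (Real.sqrt ε) * (f p.1 * f p.2 + f p.1 * f (p.2 - p.1) +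
        f p.2 * f (p.2 - p.1)) := by
    intro p
    have h1 := hq p.1
    have h2 := hq p.2
    have h3 := hq (p.2 - p.1)
    rw [ENNReal.ofReal_mul (by positivity), ENNReal.ofReal_add (by positivity) (by positivity),
      ENNReal.ofReal_add (by positivity) (by positivity), ENNReal.ofReal_mul (by positivity),
      ENNReal.ofReal_mul (by positivity), ENNReal.ofReal_mul (by positivity)]
  simp_rw [e1]
  rw [lintegral_const_mul _ (by fun_prop), lintegral_add_left (by fun_prop),
    lintegral_add_left (by fun_prop), lintegral_prod_mul_sub ε hfm hfm,
    lintegral_prod_mul_sub' ε hfm hfm (fun z => by simp [hf, wt_neg]),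
    lintegral_prod_mul hfm.aemeasurable hfm.aemeasurable]
  have h' := h ε hε
  calc _ ≤ ENNReal.ofReal (Real.sqrt ε) * (3 * (ENNReal.ofReal (C * ε ^ (3 - ((13 : ℕ) : ℝ) / 4)) *
        ENNReal.ofReal (C * ε ^ (3 - ((13 : ℕ) : ℝ) / 4)))) := by
        rw [show ∀ a : ENNReal, a + a + a = 3 * a by intro a; ring]
        gcongr
    _ = _ := by
        rw [← ENNReal.ofReal_mul (by positivity),
          show (3 : ENNReal) = ENNReal.ofReal 3 by norm_num,
          ← ENNReal.ofReal_mul (by positivity), ← ENNReal.ofReal_mul (by positivity)]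
        congr 1
        have : Real.sqrt ε * (ε ^ (3 - ((13 : ℕ) : ℝ) / 4) * ε ^ (3 - ((13 : ℕ) : ℝ) / 4)) = 1 := by
          rw [Real.sqrt_eq_rpow, ← Real.rpow_add hε, ← Real.rpow_add hε]; norm_num
        linear_combination 3 * C ^ 2 * this

/-- The size `√ε / (‖z‖ + ε)^{5/2} + 1` of the gradient of the difference of two kernels. -/
def diffWt (ε : ℝ) (z : Pt) : ℝ := Real.sqrt ε * wt ε z ^ 10 + 1

lemma measurable_diffWt (ε : ℝ) : Measurable (diffWt ε) := by
  have := measurable_wt ε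
  unfold diffWt; fun_prop

lemma diffWt_pos {ε : ℝ} (hε : 0 < ε) (z : Pt) : 0 < diffWt ε z := by
  have := wt_pos hε z
  unfold diffWt; positivity

/-- This is the power count behind all error terms: `8 + 8 + 10 = 26` exceeds the critical `24` by
half a power of the mesh, which the prefactor `√ε` in `diffWt` compensates. The bounded part of
`diffWt` leaves two integrable factors. -/
lemma lintegral_locWt_locWt_diffWt_le (c : ℝ) :
    ∃ C : ℝ, 0 ≤ C ∧ ∀ ε : ℝ, 0 < ε → ε ≤ 1 →
      ∫⁻ p, ENNReal.ofReal (locWt ε c p.1 * locWt ε c p.2 * diffWt ε (p.2 - p.1))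
        ∂((gridMeasure ε).prod (gridMeasure ε)) ≤ ENNReal.ofReal C ∧
      ∫⁻ p, ENNReal.ofReal (locWt ε c p.1 * locWt ε c (p.2 - p.1) * diffWt ε p.2)
        ∂((gridMeasure ε).prod (gridMeasure ε)) ≤ ENNReal.ofReal C := by
  obtain ⟨C₁, hC₁, h₁⟩ := lintegral_locWt_le c
  obtain ⟨C₂, hC₂, h₂⟩ := lintegral_three_wt_le
  refine ⟨C₁ * C₁ + C₂, by positivity, fun ε hε hε1 => ?_⟩
  have hq := fun z => wt_pos hε z
  have hl := fun z => locWt_le hε c z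
  have hl0 := fun z => locWt_nonneg hε c z
  have hm := measurable_wt ε
  have hlm := measurable_locWt ε c
  have hfm : Measurable fun z => ENNReal.ofReal (locWt ε c z) := by fun_prop
  have key : ∀ a b d : Pt, locWt ε c a * locWt ε c b * diffWt ε d ≤ locWt ε c a * locWt ε c b +
      Real.sqrt ε * (wt ε a ^ 13 * wt ε b ^ 13 + wt ε a ^ 13 * wt ε d ^ 13 +
        wt ε b ^ 13 * wt ε d ^ 13) := by
    intro a b d
    have h3 : locWt ε c a * locWt ε c b * wt ε d ^ 10 ≤ wt ε a ^ 8 * wt ε b ^ 8 * wt ε d ^ 10 := by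
      have := hq d
      gcongr
      · exact hl0 b
      · exact hl a
      · exact hl b
    have h4 := mul_le_mul_of_nonneg_left (h3.trans (pow_mul_pow_le_add (hq a) (hq b) (hq d)))
      (Real.sqrt_nonneg ε)
    unfold diffWt; linarith
  have hP : ENNReal.ofReal (C₁ * C₁ + C₂) = ENNReal.ofReal C₁ * ENNReal.ofReal C₁ +
      ENNReal.ofReal C₂ := by
    rw [ENNReal.ofReal_add (by positivity) hC₂, ENNReal.ofReal_mul hC₁]
  rw [hP]
  constructor
  · calc _ ≤ ∫⁻ p, (ENNReal.ofReal (locWt ε c p.1) * ENNReal.ofReal (locWt ε c p.2) +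
          ENNReal.ofReal (Real.sqrt ε * (wt ε p.1 ^ 13 * wt ε p.2 ^ 13 +
        wt ε p.1 ^ 13 * wt ε (p.2 - p.1) ^ 13 + wt ε p.2 ^ 13 * wt ε (p.2 - p.1) ^ 13)))
        ∂((gridMeasure ε).prod (gridMeasure ε)) := by
          refine lintegral_mono fun p => ?_
          rw [← ENNReal.ofReal_mul (hl0 _)]
          exact (ENNReal.ofReal_le_ofReal (key p.1 p.2 (p.2 - p.1))).trans ENNReal.ofReal_add_le
      _ ≤ _ := by
          rw [lintegral_add_left (by fun_prop), lintegral_prod_mul hfm.aemeasurable hfm.aemeasurable]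
          gcongr
          exacts [h₁ ε hε hε1, h₁ ε hε hε1, h₂ ε hε]
  · calc _ ≤ ∫⁻ p, (ENNReal.ofReal (locWt ε c p.1) * ENNReal.ofReal (locWt ε c (p.2 - p.1)) +
          ENNReal.ofReal (Real.sqrt ε * (wt ε p.1 ^ 13 * wt ε p.2 ^ 13 +
        wt ε p.1 ^ 13 * wt ε (p.2 - p.1) ^ 13 + wt ε p.2 ^ 13 * wt ε (p.2 - p.1) ^ 13)))
        ∂((gridMeasure ε).prod (gridMeasure ε)) := by
          refine lintegral_mono fun p => ?_
          rw [← ENNReal.ofReal_mul (hl0 _)]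
          refine (ENNReal.ofReal_le_ofReal ((key p.1 (p.2 - p.1) p.2).trans (le_of_eq ?_))).trans
            ENNReal.ofReal_add_le
          ring
      _ ≤ _ := by
          rw [lintegral_add_left (by fun_prop), lintegral_prod_mul_sub ε hfm hfm]
          gcongr
          exacts [h₁ ε hε hε1, h₁ ε hε hε1, h₂ ε hε]

/-! ### Weights at neighbouring points; elementary facts on gradients. -/

/-- The ratio 16 is `2 ^ 4`, as `wt` is a fourth root. -/
lemma wt_le_two_mul {ε : ℝ} (hε : 0 < ε) {z z' : Pt}
    (h : parabolicSize ε z + ε ≤ 16 * (parabolicSize ε z' + ε)) : wt ε z' ≤ 2 * wt ε z := by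
  have h1 := size_add_pos hε z
  have h2 := size_add_pos hε z'
  unfold wt
  calc (parabolicSize ε z' + ε) ^ (-(1 / 4) : ℝ)
      ≤ ((1 / 16) * (parabolicSize ε z + ε)) ^ (-(1 / 4) : ℝ) :=
        Real.rpow_le_rpow_of_nonpos (by positivity) (by linarith) (by norm_num)
    _ = 2 * _ := by
        rw [Real.mul_rpow (by norm_num) h1.le]
        congr 1
        rw [show (1 / 16 : ℝ) = (2 : ℝ) ^ (-4 : ℝ) by
          rw [Real.rpow_neg (by norm_num)]; norm_num, ← Real.rpow_mul (by norm_num)]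
        norm_num

lemma parabolicSize_shift_le {ε : ℝ} (hε : 0 ≤ ε) (t : ℝ) (k j : ℤ) :
    parabolicSize ε (t, k + j) ≤ parabolicSize ε (t, k) + ε * |(j : ℝ)| := by
  unfold parabolicSize
  push_cast
  nlinarith [mul_le_mul_of_nonneg_left (abs_add_le (k : ℝ) (j : ℝ)) hε]

lemma wt_succ_le {ε : ℝ} (hε : 0 < ε) (t : ℝ) (k : ℤ) : wt ε (t, k + 1) ≤ 2 * wt ε (t, k) := by
  refine wt_le_two_mul hε ?_
  have h1 := parabolicSize_shift_le hε.le t (k + 1) (-1)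
  have h2 := parabolicSize_nonneg hε.le (t, k + 1)
  simp only [add_neg_cancel_right, Int.cast_neg, Int.cast_one, abs_neg, abs_one, mul_one] at h1
  linarith

lemma wt_pred_le {ε : ℝ} (hε : 0 < ε) (t : ℝ) (k : ℤ) : wt ε (t, k - 1) ≤ 2 * wt ε (t, k) := by
  refine wt_le_two_mul hε ?_
  have h1 := parabolicSize_shift_le hε.le t (k - 1) 1
  have h2 := parabolicSize_nonneg hε.le (t, k - 1)
  simp only [sub_add_cancel, Int.cast_one, abs_one, mul_one] at h1
  linarith

lemma grad_true_eq (ε : ℝ) (u : Pt → ℝ) (z : Pt) :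
    grad ε true u z = grad ε false u (z.1, z.2 + 1) := by
  simp [grad]

lemma grad_false_eq (ε : ℝ) (u : Pt → ℝ) (z : Pt) :
    grad ε false u z = (u z - u (z.1, z.2 - 1)) / ε := by
  simp [grad]

/-! ### From dyadic decompositions to pointwise kernel bounds. -/

/-- A bounded remainder, with bounded discrete space derivatives up to order two and bounded
time derivative. -/
structure RegularBound (ε C : ℝ) (R : Pt → ℝ) : Prop where
  contDiffOn : ∀ k : ℤ, ContDiffOn ℝ 1 (fun t => R (t, k)) (Set.Ici 0)
  bound : ∀ z : Pt, 0 ≤ z.1 → |R z| ≤ C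
  grad_bound : ∀ z : Pt, 0 ≤ z.1 → |grad ε false R z| ≤ C
  grad_grad_bound : ∀ z : Pt, 0 ≤ z.1 → |grad ε false (grad ε false R) z| ≤ C
  deriv_bound : ∀ z : Pt, 0 ≤ z.1 → |derivWithin (fun t => R (t, z.2)) (Set.Ici 0) z.1| ≤ C

/-- Bounds on a compactly supported kernel with the singularity of the heat kernel. -/
structure KernelBound (ε c A : ℝ) (K : Pt → ℝ) : Prop where
  measurable : Measurable K
  eq_zero_of_neg : ∀ z : Pt, z.1 < 0 → K z = 0
  even : ∀ (t : ℝ) (k : ℤ), K (t, -k) = K (t, k)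
  eq_zero_of_lt : ∀ z : Pt, c < parabolicSize ε z → K z = 0
  bound : ∀ z : Pt, |K z| ≤ A * wt ε z ^ 4
  grad_bound : ∀ (s : Bool) (z : Pt), |grad ε s K z| ≤ A * wt ε z ^ 8
  lipschitz : ∀ (t : ℝ) (k l : ℤ),
    |K (t, k) - K (t, l)| ≤ A * (ε * |(k : ℝ) - l|) * (wt ε (t, k) ^ 8 + wt ε (t, l) ^ 8)
  holder : ∀ z z' : Pt, 0 ≤ z.1 → 0 ≤ z'.1 → |grad ε false K z - grad ε false K z'| ≤
    A * Real.sqrt (parabolicSize ε (z - z')) * (wt ε z ^ 10 + wt ε z' ^ 10)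

lemma abs_sub_le_mul_of_grad_bound {ε B : ℝ} {u : ℤ → ℝ}
    (h : ∀ k, |u k - u (k - 1)| ≤ ε * B) (k l : ℤ) : |u k - u l| ≤ ε * |(k : ℝ) - l| * B := by
  have main : ∀ (n : ℕ) (l : ℤ), |u (l + n) - u l| ≤ ε * n * B := by
    intro n l
    induction n with
    | zero => simp
    | succ n ih =>
      have h1 := h (l + (n + 1 : ℕ))
      rw [show l + ((n + 1 : ℕ) : ℤ) - 1 = l + n by push_cast; ring] at h1
      have h2 := abs_sub_le (u (l + (n + 1 : ℕ))) (u (l + n)) (u l)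
      push_cast at *
      linarith
  rcases le_total l k with hkl | hkl
  · obtain ⟨n, rfl⟩ := Int.le.dest hkl
    have := main n l
    push_cast
    rwa [add_sub_cancel_left, abs_of_nonneg (by positivity : (0 : ℝ) ≤ n)]
  · obtain ⟨n, rfl⟩ := Int.le.dest hkl
    have := main n k
    push_cast
    rw [abs_sub_comm, sub_add_cancel_left, abs_neg, abs_of_nonneg (by positivity : (0 : ℝ) ≤ n)]
    exact this

lemma abs_sub_le_of_derivWithin_bound {B : ℝ} {f : ℝ → ℝ} (hf : ContDiffOn ℝ 1 f (Set.Ici 0))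
    (hB : ∀ t, 0 ≤ t → |derivWithin f (Set.Ici 0) t| ≤ B) {s t : ℝ} (hs : 0 ≤ s) (ht : 0 ≤ t) :
    |f t - f s| ≤ B * |t - s| :=
  (convex_Ici (0 : ℝ)).norm_image_sub_le_of_norm_derivWithin_le
    (hf.differentiableOn one_ne_zero) (fun x hx => hB x hx) hs ht

lemma sum_range_grad (ε : ℝ) (u : Pt → ℝ) (t : ℝ) (k : ℤ) (m : ℕ) :
    ∑ i ∈ Finset.range m, grad ε false u (t, k - i) = (u (t, k) - u (t, k - m)) / ε := by
  induction m with
  | zero => simp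
  | succ m ih =>
    rw [Finset.sum_range_succ, ih, grad_false_eq]
    push_cast
    rw [sub_add_eq_sub_sub]
    ring

/-- Interpolation between `∂ₜu` and `∇²u`. The gradient at a site is compared with its average over
a block of length about `d = √|t - s|`, at cost `B d` for each time. The average is a difference
quotient of `u` over that block, and it changes in time by at most `2 B d² / d`. -/
lemma abs_grad_sub_le_sqrt {ε B : ℝ} (hε : 0 < ε) {u : Pt → ℝ}
    (hu : ∀ k : ℤ, ContDiffOn ℝ 1 (fun t => u (t, k)) (Set.Ici 0))
    (hg : ∀ z : Pt, 0 ≤ z.1 → |grad ε false (grad ε false u) z| ≤ B)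
    (hd : ∀ z : Pt, 0 ≤ z.1 → |derivWithin (fun t => u (t, z.2)) (Set.Ici 0) z.1| ≤ B)
    {s t : ℝ} (hs : 0 ≤ s) (ht : 0 ≤ t) (k : ℤ) :
    |grad ε false u (t, k) - grad ε false u (s, k)| ≤ 4 * B * Real.sqrt |t - s| := by
  have hB : 0 ≤ B := (abs_nonneg _).trans (hd (0, 0) le_rfl)
  set d := Real.sqrt |t - s| with hdd
  have hd2 : d ^ 2 = |t - s| := Real.sq_sqrt (abs_nonneg _)
  -- For equal times the block below would be empty.
  rcases (Real.sqrt_nonneg |t - s|).eq_or_lt with h0 | h0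
  · have : t = s := by
      have := (Real.sqrt_eq_zero (abs_nonneg _)).1 h0.symm
      linarith [abs_eq_zero.1 this]
    subst this
    simp only [sub_self, abs_zero]; positivity
  rw [← hdd] at h0
  have hL : ∀ j : ℤ, |u (t, j) - u (s, j)| ≤ B * d ^ 2 := by
    intro j
    rw [hd2]
    exact abs_sub_le_of_derivWithin_bound (hu j) (fun r hr => hd (r, j) hr) hs ht
  have hG : ∀ r, 0 ≤ r → ∀ i : ℕ,
      |grad ε false u (r, k) - grad ε false u (r, k - i)| ≤ ε * i * B := by
    intro r hr i
    have := abs_sub_le_mul_of_grad_bound (ε := ε) (u := fun j => grad ε false u (r, j)) (B := B)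
      (fun j => by
        have := hg (r, j) hr
        rw [grad_false_eq, abs_div, abs_of_pos hε, div_le_iff₀ hε] at this
        linarith) k (k - i)
    push_cast at this
    rwa [sub_sub_cancel, abs_of_nonneg (by positivity : (0 : ℝ) ≤ i)] at this
  -- The block has `m` sites with `(m - 1) ε ≤ d ≤ m ε`: the lower bound on `m ε` controls the
  -- difference quotient, the upper bound the oscillation inside the block.
  set m := ⌈d / ε⌉₊ with hm
  have hmpos : 0 < m := Nat.ceil_pos.2 (by positivity)
  have hm1 : d ≤ m * ε := by
    have := Nat.le_ceil (d / ε); rwa [div_le_iff₀ hε] at this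
  have hm2 : (m - 1) * ε ≤ d := by
    have := Nat.ceil_lt_add_one (show 0 ≤ d / ε by positivity)
    rw [← hm, ← sub_lt_iff_lt_add, lt_div_iff₀ hε] at this
    exact this.le
  have hmR : (1 : ℝ) ≤ m := by exact_mod_cast hmpos
  have e1 : (m : ℝ) * (grad ε false u (t, k) - grad ε false u (s, k)) =
      ∑ i ∈ Finset.range m, ((grad ε false u (t, k) - grad ε false u (t, k - i)) -
        (grad ε false u (s, k) - grad ε false u (s, k - i))) +
      ((u (t, k) - u (s, k)) - (u (t, k - m) - u (s, k - m))) / ε := by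
    rw [Finset.sum_sub_distrib, Finset.sum_sub_distrib, Finset.sum_sub_distrib, sum_range_grad,
      sum_range_grad]
    simp only [Finset.sum_const, Finset.card_range, nsmul_eq_mul]
    ring
  have e2 : (m : ℝ) * |grad ε false u (t, k) - grad ε false u (s, k)| ≤
      m * (2 * (d * B)) + 2 * (B * d ^ 2) / ε := by
    rw [← abs_of_pos (show (0 : ℝ) < m by linarith), ← abs_mul, e1,
      abs_of_pos (show (0 : ℝ) < m by linarith)]
    refine (abs_add_le _ _).trans (add_le_add ?_ ?_)
    · refine (Finset.abs_sum_le_sum_abs _ _).trans ?_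
      calc _ ≤ ∑ i ∈ Finset.range m, 2 * (d * B) := by
            refine Finset.sum_le_sum fun i hi => ?_
            have h1 := hG t ht i
            have h2 := hG s hs i
            have h3 : (i : ℝ) ≤ m - 1 := by
              have : i + 1 ≤ m := Finset.mem_range.1 hi
              have : ((i + 1 : ℕ) : ℝ) ≤ m := by exact_mod_cast this
              push_cast at this; linarith
            have h4 : ε * i * B ≤ d * B := by
              refine mul_le_mul_of_nonneg_right ?_ hB
              nlinarith
            have h5 := abs_sub (grad ε false u (t, k) - grad ε false u (t, k - i))
              (grad ε false u (s, k) - grad ε false u (s, k - i))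
            linarith
        _ = _ := by simp
    · rw [abs_div, abs_of_pos hε]
      gcongr
      have h5 := abs_sub (u (t, k) - u (s, k)) (u (t, k - m) - u (s, k - m))
      have := hL k
      have := hL (k - m)
      linarith
  have e3 : 2 * (B * d ^ 2) / ε ≤ m * (2 * (d * B)) := by
    rw [div_le_iff₀ hε]
    nlinarith [mul_le_mul_of_nonneg_left hm1 (mul_nonneg hB h0.le)]
  have e4 : (m : ℝ) * |grad ε false u (t, k) - grad ε false u (s, k)| ≤ m * (4 * B * d) := by
    linarith
  exact le_of_mul_le_mul_left e4 (by linarith)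

lemma sum_pow_le_two_mul {b X : ℝ} (hb : 2 ≤ b) (hX : 0 ≤ X) (S : Finset ℕ)
    (h : ∀ n ∈ S, b ^ n ≤ X) : ∑ n ∈ S, b ^ n ≤ 2 * X := by
  rcases S.eq_empty_or_nonempty with rfl | hS
  · simpa using hX
  have hgeo : ∀ N : ℕ, ∑ n ∈ Finset.range (N + 1), b ^ n ≤ 2 * b ^ N := by
    intro N
    induction N with
    | zero => simp
    | succ N ih =>
      rw [Finset.sum_range_succ, pow_succ]
      have : 0 < b ^ N := by positivity
      nlinarith
  calc ∑ n ∈ S, b ^ n ≤ ∑ n ∈ Finset.range (S.max' hS + 1), b ^ n := by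
        refine Finset.sum_le_sum_of_subset_of_nonneg (fun n hn => ?_) (fun n _ _ => by positivity)
        exact Finset.mem_range.2 (Nat.lt_succ_of_le (S.le_max' n hn))
    _ ≤ 2 * b ^ (S.max' hS) := hgeo _
    _ ≤ 2 * X := by have := h _ (S.max'_mem hS); linarith

/-- A geometric sum is at most twice its last term, and the support condition caps the largest scale
that contributes. The condition `1 ≤ α` makes the ratio at least 2. -/
lemma abs_sum_le_of_dyadic {α A Y : ℝ} (hα : 1 ≤ α) (hA : 0 ≤ A) (hY : 0 ≤ Y) (m : ℕ) (f : ℕ → ℝ)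
    (h0 : ∀ n < m, f n ≠ 0 → (2 : ℝ) ^ n ≤ Y)
    (h1 : ∀ n < m, |f n| ≤ A * ((2 : ℝ) ^ n) ^ α) :
    |∑ n ∈ Finset.range m, f n| ≤ 2 * A * Y ^ α := by
  classical
  have hb : ∀ n : ℕ, ((2 : ℝ) ^ n) ^ α = ((2 : ℝ) ^ α) ^ n := by
    intro n
    rw [← Real.rpow_natCast, ← Real.rpow_natCast, ← Real.rpow_mul (by norm_num),
      ← Real.rpow_mul (by norm_num), mul_comm]
  have h2 : (2 : ℝ) ≤ 2 ^ α := by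
    conv_lhs => rw [← Real.rpow_one 2]
    exact Real.rpow_le_rpow_of_exponent_le (by norm_num) hα
  rw [← Finset.sum_filter_ne_zero]
  refine (Finset.abs_sum_le_sum_abs _ _).trans ?_
  calc _ ≤ ∑ n ∈ (Finset.range m).filter (fun n => f n ≠ 0), A * ((2 : ℝ) ^ α) ^ n := by
        refine Finset.sum_le_sum fun n hn => ?_
        rw [← hb]
        exact h1 n (Finset.mem_range.1 (Finset.mem_filter.1 hn).1)
    _ ≤ A * (2 * Y ^ α) := by
        rw [← Finset.mul_sum]
        refine mul_le_mul_of_nonneg_left (sum_pow_le_two_mul h2 (by positivity) _ ?_) hA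
        intro n hn
        rw [Finset.mem_filter, Finset.mem_range] at hn
        rw [← hb]
        exact Real.rpow_le_rpow (by positivity) (h0 n hn.1 hn.2) (by linarith)
    _ = _ := by ring

/-- Version for increments: a piece contributes if it is alive at one of two points, so the cap is
the larger of the two. -/
lemma abs_sum_le_of_dyadic₂ {α A Y Y' : ℝ} (hα : 1 ≤ α) (hA : 0 ≤ A) (hY : 0 ≤ Y) (hY' : 0 ≤ Y')
    (m : ℕ) (f : ℕ → ℝ) (h0 : ∀ n < m, f n ≠ 0 → (2 : ℝ) ^ n ≤ Y ∨ (2 : ℝ) ^ n ≤ Y')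
    (h1 : ∀ n < m, |f n| ≤ A * ((2 : ℝ) ^ n) ^ α) :
    |∑ n ∈ Finset.range m, f n| ≤ 2 * A * (Y ^ α + Y' ^ α) := by
  refine (abs_sum_le_of_dyadic hα hA (le_max_of_le_left hY) m f
    (fun n hn h => le_max_iff.2 (h0 n hn h)) h1).trans ?_
  gcongr
  rcases max_choice Y Y' with h | h <;> rw [h]
  · linarith [Real.rpow_nonneg hY' α]
  · linarith [Real.rpow_nonneg hY α]

/-- No piece lives essentially below the mesh: `2 ^ M` exceeds `1 / ε` by at most a factor 2. Hence
adding `ε` to the parabolic size is harmless at every scale. -/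
lemma mesh_mul_two_pow_le {ε : ℝ} (hε : 0 < ε) (hε1 : ε < 1) {n : ℕ} (hn : n ≤ lastScale ε) :
    ε * 2 ^ n ≤ 2 := by
  have hlog : Real.logb 2 ε < 0 := Real.logb_neg (by norm_num) hε hε1
  have hfl : ⌊Real.logb 2 ε⌋ < 0 := Int.floor_lt.2 (by exact_mod_cast hlog)
  have h1 : ((lastScale ε : ℕ) : ℤ) = -⌊Real.logb 2 ε⌋ := by
    unfold lastScale; exact Int.toNat_of_nonneg (by omega)
  have h2 : ((lastScale ε : ℕ) : ℝ) ≤ 1 - Real.logb 2 ε := by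
    have h3 : ((lastScale ε : ℕ) : ℝ) = -(⌊Real.logb 2 ε⌋ : ℝ) := by exact_mod_cast h1
    have := Int.lt_floor_add_one (Real.logb 2 ε)
    rw [h3]; linarith
  calc ε * 2 ^ n ≤ ε * 2 ^ (lastScale ε) := by gcongr; norm_num
    _ = ε * (2 : ℝ) ^ ((lastScale ε : ℕ) : ℝ) := by rw [Real.rpow_natCast]
    _ ≤ ε * (2 : ℝ) ^ (1 - Real.logb 2 ε) := by gcongr; norm_num
    _ = 2 := by
        rw [Real.rpow_sub (by norm_num), Real.rpow_logb (by norm_num) (by norm_num) hε,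
          Real.rpow_one, mul_div_cancel₀ _ hε.ne']

lemma mixedDeriv_zero_left (ε : ℝ) (j : ℕ) (u : Pt → ℝ) (z : Pt) :
    mixedDeriv ε 0 j u z = ((grad ε false)^[j] u) z := by
  simp [mixedDeriv]

lemma mixedDeriv_one_zero (ε : ℝ) (u : Pt → ℝ) (z : Pt) :
    mixedDeriv ε 1 0 u z = derivWithin (fun t => u (t, z.2)) (Set.Ici 0) z.1 := by
  simp [mixedDeriv, iteratedDerivWithin_one]

lemma measurable_of_slices {f : Pt → ℝ} (h : ∀ k : ℤ, Measurable fun t => f (t, k)) :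
    Measurable f :=
  measurable_from_prod_countable_left h

lemma measurable_of_continuousOn_slices {f : Pt → ℝ}
    (h : ∀ k : ℤ, ContinuousOn (fun t => f (t, k)) (Set.Ici 0)) (h0 : ∀ z : Pt, z.1 < 0 → f z = 0) :
    Measurable f := by
  classical
  refine measurable_of_slices fun k => ?_
  have : (fun t => f (t, k)) = (Set.Ici (0 : ℝ)).piecewise (fun t => f (t, k)) (fun _ => 0) := by
    ext t
    by_cases ht : t ∈ Set.Ici (0 : ℝ)
    · rw [Set.piecewise_eq_of_mem _ _ _ ht]
    · rw [Set.piecewise_eq_of_notMem _ _ _ ht]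
      exact h0 (t, k) (not_le.1 ht)
  rw [this]
  exact ContinuousOn.measurable_piecewise (h k) continuousOn_const measurableSet_Ici

lemma grad_sum (ε : ℝ) (s : Bool) (m : ℕ) (f : ℕ → Pt → ℝ) (z : Pt) :
    grad ε s (fun w => ∑ n ∈ Finset.range m, f n w) z = ∑ n ∈ Finset.range m, grad ε s (f n) z := by
  cases s <;> simp [grad, ← Finset.sum_sub_distrib, ← Finset.sum_div]

lemma grad_congr {ε : ℝ} {s : Bool} {u v : Pt → ℝ} {z : Pt} (h : ∀ k : ℤ, u (z.1, k) = v (z.1, k)) :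
    grad ε s u z = grad ε s v z := by
  cases s <;> simp [grad, h]

/-- The scale `2ⁿ` is at most the size of the heat kernel on the support of the piece of
scale `n`. -/
lemma two_pow_le_of_size_le {ε c : ℝ} (hε : 0 < ε) {n : ℕ} (hn : ε * 2 ^ n ≤ 2) {z : Pt}
    (h : parabolicSize ε z ≤ c * 2⁻¹ ^ n + ε) : (2 : ℝ) ^ n ≤ (c + 4) * wt ε z ^ 4 := by
  have h2 : (0 : ℝ) < 2 ^ n := by positivity
  rw [wt_pow_four hε, ← div_eq_mul_inv, le_div_iff₀ (size_add_pos hε z)]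
  rw [inv_pow] at h
  have h3 : (2 : ℝ) ^ n * parabolicSize ε z ≤ c + ε * 2 ^ n := by
    calc (2 : ℝ) ^ n * parabolicSize ε z ≤ 2 ^ n * (c * (2 ^ n)⁻¹ + ε) := by gcongr
      _ = _ := by field_simp
  nlinarith

lemma wt_pow_four_rpow {ε : ℝ} (hε : 0 < ε) (z : Pt) : (wt ε z ^ 4) ^ (5 / 2 : ℝ) = wt ε z ^ 10 := by
  rw [← Real.rpow_natCast, ← Real.rpow_natCast, ← Real.rpow_mul (wt_pos hε z).le]
  norm_num

/-- One dyadic piece of a singular part. -/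
structure PieceBound (ε c C : ℝ) (n : ℕ) (k : Pt → ℝ) : Prop where
  contDiffOn : ∀ j : ℤ, ContDiffOn ℝ 1 (fun t => k (t, j)) (Set.Ici 0)
  scale : ε * 2 ^ n ≤ 2
  eq_zero : ∀ z : Pt, 0 ≤ z.1 → c * 2⁻¹ ^ n < parabolicSize ε z → k z = 0
  bound : ∀ z : Pt, 0 ≤ z.1 → |k z| ≤ C * 2 ^ n
  grad_bound : ∀ z : Pt, 0 ≤ z.1 → |grad ε false k z| ≤ C * (2 ^ n) ^ 2
  grad_grad_bound : ∀ z : Pt, 0 ≤ z.1 → |grad ε false (grad ε false k) z| ≤ C * (2 ^ n) ^ 3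
  deriv_bound : ∀ z : Pt, 0 ≤ z.1 →
    |derivWithin (fun t => k (t, z.2)) (Set.Ici 0) z.1| ≤ C * (2 ^ n) ^ 3

namespace PieceBound

variable {ε c C : ℝ} {n : ℕ} {k : Pt → ℝ}

lemma two_pow_le (h : PieceBound ε c C n k) (hε : 0 < ε) {z : Pt} (hz : 0 ≤ z.1) (hk : k z ≠ 0) :
    (2 : ℝ) ^ n ≤ (c + 4) * wt ε z ^ 4 := by
  refine two_pow_le_of_size_le hε h.scale ?_
  by_contra hcon
  exact hk (h.eq_zero z hz (by linarith))

/-- A backward difference enlarges the support by one mesh step, for which `two_pow_le_of_size_le`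
leaves room. -/
lemma two_pow_le_of_grad (h : PieceBound ε c C n k) (hε : 0 < ε) {z : Pt} (hz : 0 ≤ z.1)
    (hk : grad ε false k z ≠ 0) : (2 : ℝ) ^ n ≤ (c + 4) * wt ε z ^ 4 := by
  refine two_pow_le_of_size_le hε h.scale ?_
  by_contra hcon
  apply hk
  have h1 : k z = 0 := h.eq_zero z hz (by linarith)
  have h2 : k (z.1, z.2 - 1) = 0 := by
    refine h.eq_zero _ hz ?_
    have := parabolicSize_shift_le hε.le z.1 (z.2 - 1) 1
    simp only [sub_add_cancel, Int.cast_one, abs_one, mul_one] at this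
    rw [Prod.mk.eta] at this
    linarith
  rw [grad_false_eq, h1, h2]; simp

lemma abs_sub_le (h : PieceBound ε c C n k) (hε : 0 < ε) {t : ℝ} (ht : 0 ≤ t) (i j : ℤ) :
    |k (t, i) - k (t, j)| ≤ C * (ε * |(i : ℝ) - j|) * (2 ^ n) ^ 2 := by
  have := abs_sub_le_mul_of_grad_bound (ε := ε) (u := fun j => k (t, j)) (B := C * (2 ^ n) ^ 2)
    (fun j => by
      have := h.grad_bound (t, j) ht
      rw [grad_false_eq, abs_div, abs_of_pos hε, div_le_iff₀ hε] at this
      linarith) i j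
  linarith

/-- The Lipschitz bound `2^(3n) d` and the trivial bound `2^(2n)` are interpolated to `2^(5n/2) √d`.
-/
lemma abs_grad_sub_le (h : PieceBound ε c C n k) (hε : 0 < ε) {z z' : Pt} (hz : 0 ≤ z.1)
    (hz' : 0 ≤ z'.1) : |grad ε false k z - grad ε false k z'| ≤
      4 * C * Real.sqrt (parabolicSize ε (z - z')) * ((2 : ℝ) ^ n) ^ (5 / 2 : ℝ) := by
  have hC : 0 ≤ C := by
    have := (abs_nonneg _).trans (h.bound (0, 0) le_rfl)
    exact nonneg_of_mul_nonneg_left this (by positivity)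
  set d := parabolicSize ε (z - z') with hd
  have hd0 : 0 ≤ d := parabolicSize_nonneg hε.le _
  set b : ℝ := 2 ^ n with hb
  have hb0 : 0 < b := by positivity
  have hrp : b ^ (5 / 2 : ℝ) = b ^ 2 * Real.sqrt b := by
    rw [Real.sqrt_eq_rpow, ← Real.rpow_two, ← Real.rpow_add hb0]; norm_num
  have h1 : |grad ε false k z - grad ε false k (z.1, z'.2)| ≤
      ε * |(z.2 : ℝ) - z'.2| * (C * b ^ 3) := by
    exact abs_sub_le_mul_of_grad_bound (ε := ε) (u := fun j => grad ε false k (z.1, j))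
      (fun j => by
        have := h.grad_grad_bound (z.1, j) hz
        rw [grad_false_eq, abs_div, abs_of_pos hε, div_le_iff₀ hε] at this
        linarith) z.2 z'.2
  have h2 : |grad ε false k (z.1, z'.2) - grad ε false k z'| ≤
      4 * (C * b ^ 3) * Real.sqrt |z.1 - z'.1| :=
    abs_grad_sub_le_sqrt hε h.contDiffOn h.grad_grad_bound h.deriv_bound hz' hz z'.2
  have h3 : |grad ε false k z - grad ε false k z'| ≤ 4 * C * b ^ 3 * d := by
    have h4 := _root_.abs_sub_le (grad ε false k z) (grad ε false k (z.1, z'.2)) (grad ε false k z')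
    have h5 : d = Real.sqrt |z.1 - z'.1| + ε * |(z.2 : ℝ) - z'.2| := by
      rw [hd]; simp [parabolicSize]
    have h6 : 0 ≤ ε * |(z.2 : ℝ) - z'.2| * (C * b ^ 3) := by positivity
    rw [h5]; linarith
  have h7 : |grad ε false k z - grad ε false k z'| ≤ 2 * C * b ^ 2 := by
    have h4 := abs_sub (grad ε false k z) (grad ε false k z')
    have := h.grad_bound z hz
    have := h.grad_bound z' hz'
    linarith
  rw [hrp, show 4 * C * Real.sqrt d * (b ^ 2 * Real.sqrt b) =
    4 * C * b ^ 2 * (Real.sqrt b * Real.sqrt d) by ring, ← Real.sqrt_mul hb0.le]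
  -- Below the scale of the piece the Lipschitz bound is the better one, above it the trivial one.
  rcases le_total (b * d) 1 with hbd | hbd
  · have : b * d ≤ Real.sqrt (b * d) := Real.le_sqrt_of_sq_le (by nlinarith [mul_nonneg hb0.le hd0])
    calc _ ≤ _ := h3
      _ = 4 * C * b ^ 2 * (b * d) := by ring
      _ ≤ _ := by gcongr
  · have : 1 ≤ Real.sqrt (b * d) := Real.one_le_sqrt.2 hbd
    calc _ ≤ _ := h7
      _ ≤ 4 * C * b ^ 2 * 1 := by nlinarith [mul_nonneg hC (sq_nonneg b)]
      _ ≤ _ := by gcongr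

end PieceBound

/-- At each point the sum over scales is governed by the finest piece still alive there, so the
dyadic bounds become powers of the weight. -/
lemma kernelBound_of_pieces {ε c C : ℝ} (hε : 0 < ε) (hc : 0 ≤ c) {m : ℕ} {Kn : ℕ → Pt → ℝ}
    {K : Pt → ℝ} (hn : ∀ n < m, PieceBound ε c C n (Kn n)) (hC : 0 ≤ C)
    (hneg : ∀ z : Pt, z.1 < 0 → K z = 0) (heven : ∀ (t : ℝ) (k : ℤ), K (t, -k) = K (t, k))
    (hK : ∀ z : Pt, 0 ≤ z.1 → K z = ∑ n ∈ Finset.range m, Kn n z) :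
    KernelBound ε c (512 * C * (c + 4) ^ 3) K := by
  have hq := fun z => wt_pos hε z
  have hY : ∀ z, 0 ≤ (c + 4) * wt ε z ^ 4 := fun z => by have := hq z; positivity
  have hY1 : ∀ z, ((c + 4) * wt ε z ^ 4) ^ (1 : ℝ) = (c + 4) * wt ε z ^ 4 := fun z =>
    Real.rpow_one _
  have hY2 : ∀ z, ((c + 4) * wt ε z ^ 4) ^ (2 : ℝ) = (c + 4) ^ 2 * wt ε z ^ 8 := fun z => by
    rw [Real.rpow_two]; ring
  have hc1 : 1 ≤ c + 4 := by linarith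
  have hc3 : (c + 4) ^ 2 ≤ (c + 4) ^ 3 := pow_le_pow_right₀ hc1 (by norm_num)
  have hc4 : (c + 4) ≤ (c + 4) ^ 3 := le_self_pow₀ hc1 (by norm_num)
  have hY3 : ∀ z, ((c + 4) * wt ε z ^ 4) ^ (5 / 2 : ℝ) ≤ (c + 4) ^ 3 * wt ε z ^ 10 := fun z => by
    have := hq z
    rw [Real.mul_rpow (by positivity) (by positivity), wt_pow_four_rpow hε]
    refine mul_le_mul_of_nonneg_right ?_ (by positivity)
    rw [← Real.rpow_natCast]
    exact Real.rpow_le_rpow_of_exponent_le hc1 (by norm_num)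
  have hgradK : ∀ z : Pt, 0 ≤ z.1 → grad ε false K z = ∑ n ∈ Finset.range m, grad ε false (Kn n) z :=
    fun z hz => by
      rw [← grad_sum]
      exact grad_congr fun k => hK (z.1, k) hz
  have hgneg : ∀ (s : Bool) (z : Pt), z.1 < 0 → grad ε s K z = 0 := fun s z hz => by
    cases s <;> simp [grad, hneg z hz, hneg (z.1, z.2 + 1) hz, hneg (z.1, z.2 - 1) hz]
  have hgf : ∀ z : Pt, |grad ε false K z| ≤ 2 * C * ((c + 4) ^ 2 * wt ε z ^ 8) := by
    intro z
    have := hq z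
    rcases lt_or_ge z.1 0 with hz | hz
    · rw [hgneg _ z hz, abs_zero]; positivity
    rw [hgradK z hz, ← hY2]
    refine abs_sum_le_of_dyadic (by norm_num) hC (hY z) m _
      (fun n hnm h => (hn n hnm).two_pow_le_of_grad hε hz h) (fun n hnm => ?_)
    rw [Real.rpow_two]
    exact (hn n hnm).grad_bound z hz
  refine ⟨?_, hneg, heven, ?_, ?_, ?_, ?_, ?_⟩
  · refine measurable_of_continuousOn_slices (fun k => ?_) hneg
    have : ContinuousOn (fun t => ∑ n ∈ Finset.range m, Kn n (t, k)) (Set.Ici 0) :=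
      continuousOn_finsetSum _ fun n hnm =>
        ((hn n (Finset.mem_range.1 hnm)).contDiffOn k).continuousOn
    exact this.congr fun t ht => hK (t, k) ht
  · intro z hz
    rcases lt_or_ge z.1 0 with h0 | h0
    · exact hneg z h0
    rw [hK z h0]
    refine Finset.sum_eq_zero fun n hnm => (hn n (Finset.mem_range.1 hnm)).eq_zero z h0 ?_
    refine lt_of_le_of_lt ?_ hz
    exact mul_le_of_le_one_right hc (pow_le_one₀ (by norm_num) (by norm_num))
  · intro z
    have hqz := hq z
    rcases lt_or_ge z.1 0 with h0 | h0
    · rw [hneg z h0, abs_zero]; positivity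
    rw [hK z h0]
    refine (abs_sum_le_of_dyadic (α := 1) le_rfl hC (hY z) m _
      (fun n hnm h => (hn n hnm).two_pow_le hε h0 h) (fun n hnm => ?_)).trans ?_
    · rw [Real.rpow_one]; exact (hn n hnm).bound z h0
    · rw [hY1]
      have : C * (c + 4) * wt ε z ^ 4 ≤ C * (c + 4) ^ 3 * wt ε z ^ 4 := by gcongr
      have : 0 ≤ C * (c + 4) ^ 3 * wt ε z ^ 4 := by positivity
      linarith
  · intro s z
    have hqz := hq z
    cases s
    · refine (hgf z).trans ?_
      have : C * (c + 4) ^ 2 * wt ε z ^ 8 ≤ C * (c + 4) ^ 3 * wt ε z ^ 8 := by gcongr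
      have : 0 ≤ C * (c + 4) ^ 3 * wt ε z ^ 8 := by positivity
      linarith
    -- The forward gradient is the backward one at the next site; the shift costs `2 ^ 8`, which
    -- with the factor 2 of the dyadic sum gives the 512 in the constant.
    · rw [grad_true_eq]
      refine (hgf _).trans ?_
      have h1 : wt ε (z.1, z.2 + 1) ^ 8 ≤ (2 * wt ε z) ^ 8 :=
        pow_le_pow_left₀ (hq _).le (wt_succ_le hε z.1 z.2) 8
      have h2 : C * (c + 4) ^ 2 * wt ε (z.1, z.2 + 1) ^ 8 ≤
          C * (c + 4) ^ 3 * (2 * wt ε z) ^ 8 := by gcongr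
      rw [mul_pow] at h2
      linarith
  · intro t k l
    have hqz := hq (t, k)
    have hqz' := hq (t, l)
    rcases lt_or_ge t 0 with h0 | h0
    · rw [hneg (t, k) h0, hneg (t, l) h0, sub_zero, abs_zero]; positivity
    rw [hK (t, k) h0, hK (t, l) h0, ← Finset.sum_sub_distrib]
    refine (abs_sum_le_of_dyadic₂ (α := 2) (A := C * (ε * |(k : ℝ) - l|)) (by norm_num)
      (by positivity) (hY (t, k)) (hY (t, l)) m _ (fun n hnm h => ?_) (fun n hnm => ?_)).trans ?_
    · by_contra hcon
      rw [not_or] at hcon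
      apply h
      have h1 : Kn n (t, k) = 0 := by
        by_contra hne; exact hcon.1 ((hn n hnm).two_pow_le hε h0 hne)
      have h2 : Kn n (t, l) = 0 := by
        by_contra hne; exact hcon.2 ((hn n hnm).two_pow_le hε h0 hne)
      rw [h1, h2, sub_zero]
    · rw [Real.rpow_two]
      exact (hn n hnm).abs_sub_le hε h0 k l
    · rw [hY2, hY2]
      set D := ε * |(k : ℝ) - l| with hD
      have hD0 : 0 ≤ D := by positivity
      set W := wt ε (t, k) ^ 8 + wt ε (t, l) ^ 8 with hW
      have h1 : C * D * (c + 4) ^ 2 * W ≤ C * D * (c + 4) ^ 3 * W := by gcongr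
      have h2 : 0 ≤ C * D * (c + 4) ^ 3 * W := by positivity
      nlinarith
  · intro z z' h0 h0'
    have hqz := hq z
    have hqz' := hq z'
    rw [hgradK z h0, hgradK z' h0', ← Finset.sum_sub_distrib]
    set d := Real.sqrt (parabolicSize ε (z - z')) with hd
    have hd0 : 0 ≤ d := Real.sqrt_nonneg _
    refine (abs_sum_le_of_dyadic₂ (α := 5 / 2) (A := 4 * C * d) (by norm_num)
      (by positivity) (hY z) (hY z') m _ (fun n hnm h => ?_) (fun n hnm => ?_)).trans ?_
    · by_contra hcon
      rw [not_or] at hcon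
      apply h
      have h1 : grad ε false (Kn n) z = 0 := by
        by_contra hne; exact hcon.1 ((hn n hnm).two_pow_le_of_grad hε h0 hne)
      have h2 : grad ε false (Kn n) z' = 0 := by
        by_contra hne; exact hcon.2 ((hn n hnm).two_pow_le_of_grad hε h0' hne)
      rw [h1, h2, sub_zero]
    · exact (hn n hnm).abs_grad_sub_le hε h0 h0'
    · have h1 := mul_le_mul_of_nonneg_left (add_le_add (hY3 z) (hY3 z'))
        (show 0 ≤ 2 * (4 * C * d) by positivity)
      have h2 : 0 ≤ C * d * (c + 4) ^ 3 * (wt ε z ^ 10 + wt ε z' ^ 10) := by positivity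
      refine h1.trans ?_
      nlinarith

/-- The bounds on kernels which follow from the definition of a singular part. -/
lemma IsSingularPart.exists_bounds {ε c C : ℝ} (hε : 0 < ε) (hε1 : ε < 1) {r : ℕ} (hr : 2 ≤ r)
    {u K : Pt → ℝ} (h : IsSingularPart ε r c C u K) :
    KernelBound ε (max c 1) (512 * |C| * (max c 1 + 4) ^ 3) K ∧
      ∃ R, RegularBound ε |C| R ∧ ∀ z : Pt, 0 ≤ z.1 → u z = K z + R z := by
  obtain ⟨Kn, R, hu, hneg, heven, hsum, hsupp, hsm, hKn, hRsm, hR⟩ := h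
  -- The bound on `R` forces nonnegativity of `C`; the radius `c` has no sign and is replaced by
  -- `max c 1`.
  have hC : 0 ≤ C := (abs_nonneg _).trans (hR 0 0 (by omega) (0, 0) le_rfl)
  rw [abs_of_nonneg hC]
  have hr1 : ((1 : ℕ∞) : WithTop ℕ∞) ≤ (((r / 2 : ℕ) : ℕ∞) : WithTop ℕ∞) := by
    have : 1 ≤ r / 2 := by omega
    exact_mod_cast this
  refine ⟨?_, R, ⟨fun k => (hRsm k).of_le hr1, ?_, ?_, ?_, ?_⟩, hu⟩
  · refine kernelBound_of_pieces hε (by positivity) (m := lastScale ε + 1) (Kn := Kn)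
      (fun n hnm => ?_) hC hneg heven hsum
    have hn : n ≤ lastScale ε := Nat.lt_succ_iff.1 hnm
    refine ⟨fun k => (hsm n hn k).of_le hr1, mesh_mul_two_pow_le hε hε1 hn, fun z hz hlt => ?_,
      ?_, ?_, ?_, ?_⟩
    · refine hsupp n hn z hz (lt_of_le_of_lt ?_ hlt)
      gcongr; exact le_max_left _ _
    · intro z hz
      have := hKn n hn 0 0 (by omega) z hz
      simpa [mixedDeriv_zero_left] using this
    · intro z hz
      have := hKn n hn 0 1 (by omega) z hz
      simpa [mixedDeriv_zero_left, pow_mul] using this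
    · intro z hz
      have := hKn n hn 0 2 (by omega) z hz
      simpa [mixedDeriv_zero_left, pow_mul] using this
    · intro z hz
      have := hKn n hn 1 0 (by omega) z hz
      simpa [mixedDeriv_one_zero, pow_mul] using this
  · intro z hz
    simpa [mixedDeriv_zero_left] using hR 0 0 (by omega) z hz
  · intro z hz
    simpa [mixedDeriv_zero_left] using hR 0 1 (by omega) z hz
  · intro z hz
    simpa [mixedDeriv_zero_left] using hR 0 2 (by omega) z hz
  · intro z hz
    simpa [mixedDeriv_one_zero] using hR 1 0 (by omega) z hz

/-! ### Positivity and mass of the random walk kernel. -/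

/-- The `j`-step transition probabilities of simple random walk on `ℤ`, as Fourier integrals. -/
def walkProb (j : ℕ) (k : ℤ) : ℝ :=
  (2 * Real.pi)⁻¹ * ∫ θ in (-Real.pi)..Real.pi, Real.cos θ ^ j * Real.cos (k * θ)

/-- The heat kernel of continuous time simple random walk on `ℤ`. -/
def walkKernel (l : ℝ) (k : ℤ) : ℝ :=
  (2 * Real.pi)⁻¹ * ∫ θ in (-Real.pi)..Real.pi,
    Real.exp (-((1 - Real.cos θ) * l)) * Real.cos (k * θ)

lemma integral_cos_int_mul (k : ℤ) :
    ∫ θ in (-Real.pi)..Real.pi, Real.cos (k * θ) = if k = 0 then 2 * Real.pi else 0 := by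
  split_ifs with hk
  · subst hk; simp; ring
  · have hk' : (k : ℝ) ≠ 0 := by exact_mod_cast hk
    rw [intervalIntegral.integral_comp_mul_left (fun x => Real.cos x) hk', integral_cos]
    simp [Real.sin_int_mul_pi]

lemma walkProb_zero (k : ℤ) : walkProb 0 k = if k = 0 then 1 else 0 := by
  unfold walkProb
  simp only [pow_zero, one_mul]
  rw [integral_cos_int_mul]
  have := Real.pi_pos
  split_ifs
  · field_simp
  · simp

lemma cos_mul_cos_int (k : ℤ) (θ : ℝ) : Real.cos θ * Real.cos (k * θ) =
    (Real.cos ((k + 1 : ℤ) * θ) + Real.cos ((k - 1 : ℤ) * θ)) / 2 := by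
  push_cast
  rw [add_mul, sub_mul, one_mul, Real.cos_add, Real.cos_sub]; ring

lemma walkProb_succ (j : ℕ) (k : ℤ) :
    walkProb (j + 1) k = (walkProb j (k + 1) + walkProb j (k - 1)) / 2 := by
  unfold walkProb
  rw [← mul_add, ← intervalIntegral.integral_add (Continuous.intervalIntegrable (by fun_prop) _ _)
    (Continuous.intervalIntegrable (by fun_prop) _ _), mul_div_assoc,
    ← intervalIntegral.integral_div]
  congr 1
  refine intervalIntegral.integral_congr fun θ _ => ?_
  rw [pow_succ, mul_assoc, cos_mul_cos_int]; ring

/-- Positivity is invisible in the Fourier integral but is preserved by the one-step recursion. -/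
lemma walkProb_nonneg (j : ℕ) (k : ℤ) : 0 ≤ walkProb j k := by
  induction j generalizing k with
  | zero => rw [walkProb_zero]; split_ifs <;> norm_num
  | succ j ih => rw [walkProb_succ]; have := ih (k + 1); have := ih (k - 1); linarith

lemma sum_walkProb_le_one (j : ℕ) (S : Finset ℤ) : ∑ k ∈ S, walkProb j k ≤ 1 := by
  induction j generalizing S with
  | zero =>
    simp_rw [walkProb_zero]
    rw [Finset.sum_ite_eq' S 0 (fun _ => (1 : ℝ))]
    split_ifs <;> norm_num
  | succ j ih =>
    simp_rw [walkProb_succ]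
    rw [← Finset.sum_div, Finset.sum_add_distrib]
    have h1 := ih (S.map (addRightEmbedding 1))
    have h2 := ih (S.map (addRightEmbedding (-1)))
    rw [Finset.sum_map] at h1 h2
    simp only [addRightEmbedding_apply, ← sub_eq_add_neg] at h1 h2
    linarith

/-- Expanding `exp (l cos θ)` exhibits the continuous time walk as the discrete one run for a
Poisson number of steps. Positivity and the mass bound are transferred through this series. -/
lemma hasSum_walkKernel (l : ℝ) (k : ℤ) :
    HasSum (fun j : ℕ => Real.exp (-l) * (l ^ j / (Nat.factorial j)) * walkProb j k)
      (walkKernel l k) := by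
  have hs : Summable fun j : ℕ => |l| ^ j / (Nat.factorial j) := Real.summable_pow_div_factorial |l|
  have h := intervalIntegral.hasSum_integral_of_dominated_convergence (μ := volume)
    (a := -Real.pi) (b := Real.pi)
    (F := fun (j : ℕ) θ => Real.exp (-l) * (l ^ j / (Nat.factorial j)) *
      (Real.cos θ ^ j * Real.cos (k * θ)))
    (f := fun θ => Real.exp (-((1 - Real.cos θ) * l)) * Real.cos (k * θ))
    (bound := fun j _ => Real.exp (-l) * (|l| ^ j / (Nat.factorial j)))
    (fun j => Continuous.aestronglyMeasurable (by fun_prop)) (fun j => ?_) ?_ ?_ ?_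
  · have h2 := h.mul_left (2 * Real.pi)⁻¹
    refine (congrArg (fun f => HasSum f _) (funext fun j => ?_)).mp h2
    unfold walkProb
    rw [intervalIntegral.integral_const_mul]; ring
  · refine Filter.Eventually.of_forall fun θ _ => ?_
    rw [norm_mul, norm_mul, norm_mul, norm_div, norm_pow, norm_pow, Real.norm_eq_abs,
      Real.norm_eq_abs, Real.norm_eq_abs, Real.norm_eq_abs, Real.norm_eq_abs, Real.abs_exp,
      Nat.abs_cast]
    refine mul_le_of_le_one_right (by positivity) ?_
    exact mul_le_one₀ (pow_le_one₀ (abs_nonneg _) (Real.abs_cos_le_one _)) (abs_nonneg _)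
      (Real.abs_cos_le_one _)
  · exact Filter.Eventually.of_forall fun θ _ => hs.mul_left _
  · exact intervalIntegrable_const
  · refine Filter.Eventually.of_forall fun θ _ => ?_
    have h3 : HasSum (fun j : ℕ => (l * Real.cos θ) ^ j / (Nat.factorial j))
        (Real.exp (l * Real.cos θ)) := by
      rw [Real.exp_eq_exp_ℝ]
      exact NormedSpace.expSeries_div_hasSum_exp (l * Real.cos θ)
    have h4 := (h3.mul_left (Real.exp (-l))).mul_right (Real.cos (k * θ))
    rw [← Real.exp_add, show -l + l * Real.cos θ = -((1 - Real.cos θ) * l) by ring] at h4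
    refine (congrArg (fun f => HasSum f _) (funext fun j => ?_)).mp h4
    rw [mul_pow]; ring

lemma walkKernel_nonneg {l : ℝ} (hl : 0 ≤ l) (k : ℤ) : 0 ≤ walkKernel l k :=
  (hasSum_walkKernel l k).nonneg fun j => by have := walkProb_nonneg j k; positivity

lemma sum_walkKernel_le_one {l : ℝ} (hl : 0 ≤ l) (S : Finset ℤ) : ∑ k ∈ S, walkKernel l k ≤ 1 := by
  have h1 := hasSum_sum (s := S) fun k _ => hasSum_walkKernel l k
  have h3 : HasSum (fun j : ℕ => l ^ j / (Nat.factorial j)) (Real.exp l) := by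
    rw [Real.exp_eq_exp_ℝ]
    exact NormedSpace.expSeries_div_hasSum_exp l
  have h4 := h3.mul_left (Real.exp (-l))
  rw [← Real.exp_add, neg_add_cancel, Real.exp_zero] at h4
  refine hasSum_le (fun j => ?_) h1 h4
  rw [← Finset.mul_sum]
  exact mul_le_of_le_one_right (by positivity) (sum_walkProb_le_one j S)

/-- The Fourier weight is positive, so replacing `cos (kθ)` by 1 can only increase the integral. -/
lemma walkKernel_le_zero (l : ℝ) (k : ℤ) : walkKernel l k ≤ walkKernel l 0 := by
  unfold walkKernel
  have := Real.pi_pos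
  refine mul_le_mul_of_nonneg_left ?_ (by positivity)
  refine intervalIntegral.integral_mono_on (by linarith)
    (Continuous.intervalIntegrable (by fun_prop) _ _)
    (Continuous.intervalIntegrable (by fun_prop) _ _) fun θ _ => ?_
  simp only [Int.cast_zero, zero_mul, Real.cos_zero]
  exact mul_le_mul_of_nonneg_left (Real.cos_le_one _) (Real.exp_pos _).le

lemma walkKernel_zero (k : ℤ) : walkKernel 0 k = if k = 0 then 1 else 0 := by
  rw [← walkProb_zero]
  simp [walkKernel, walkProb]

/-- Differentiation under the integral; the multiplier `cos θ - 1` is half the lattice Laplacian. -/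
lemma hasDerivAt_walkKernel (l : ℝ) (k : ℤ) :
    HasDerivAt (fun l => walkKernel l k)
      ((walkKernel l (k + 1) + walkKernel l (k - 1)) / 2 - walkKernel l k) l := by
  have h := (intervalIntegral.hasDerivAt_integral_of_dominated_loc_of_deriv_le (μ := volume)
    (𝕜 := ℝ) (a := -Real.pi) (b := Real.pi) (s := Metric.ball l 1) (x₀ := l)
    (F := fun l θ => Real.exp (-((1 - Real.cos θ) * l)) * Real.cos (k * θ))
    (F' := fun l θ => -(1 - Real.cos θ) * Real.exp (-((1 - Real.cos θ) * l)) * Real.cos (k * θ))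
    (bound := fun _ => 2 * Real.exp (2 * (|l| + 1))) (Metric.ball_mem_nhds l one_pos)
    (Filter.Eventually.of_forall fun x => Continuous.aestronglyMeasurable (by fun_prop))
    (Continuous.intervalIntegrable (by fun_prop) _ _)
    (Continuous.aestronglyMeasurable (by fun_prop)) ?_ intervalIntegrable_const ?_).2
  · have h2 := h.const_mul (2 * Real.pi)⁻¹
    refine h2.congr_deriv ?_
    unfold walkKernel
    rw [← mul_add, ← intervalIntegral.integral_add
      (Continuous.intervalIntegrable (by fun_prop) _ _)
      (Continuous.intervalIntegrable (by fun_prop) _ _), mul_div_assoc,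
      ← intervalIntegral.integral_div, ← mul_sub, ← intervalIntegral.integral_sub
      (Continuous.intervalIntegrable (by fun_prop) _ _)
      (Continuous.intervalIntegrable (by fun_prop) _ _)]
    congr 1
    refine intervalIntegral.integral_congr fun θ _ => ?_
    have := cos_mul_cos_int k θ
    linear_combination Real.exp (-((1 - Real.cos θ) * l)) * this
  · refine Filter.Eventually.of_forall fun θ _ x hx => ?_
    have h1 := Real.abs_cos_le_one θ
    rw [abs_le] at h1
    have hx' : |x| ≤ |l| + 1 := by
      rw [Metric.mem_ball, Real.dist_eq] at hx
      have := abs_sub_abs_le_abs_sub x l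
      linarith
    rw [norm_mul, norm_mul, norm_neg, Real.norm_eq_abs, Real.norm_eq_abs, Real.norm_eq_abs,
      Real.abs_exp, abs_of_nonneg (by linarith : 0 ≤ 1 - Real.cos θ)]
    have h3 : Real.exp (-((1 - Real.cos θ) * x)) ≤ Real.exp (2 * (|l| + 1)) := by
      refine Real.exp_le_exp.2 ?_
      have := neg_abs_le x
      nlinarith [abs_nonneg x]
    calc _ ≤ (1 - Real.cos θ) * Real.exp (-((1 - Real.cos θ) * x)) * 1 := by
          refine mul_le_mul_of_nonneg_left (Real.abs_cos_le_one _) ?_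
          have : 0 ≤ 1 - Real.cos θ := by linarith
          positivity
      _ ≤ 2 * Real.exp (2 * (|l| + 1)) := by
          rw [mul_one]; gcongr; linarith
  · refine Filter.Eventually.of_forall fun θ _ x _ => ?_
    have h1 : HasDerivAt (fun x : ℝ => -((1 - Real.cos θ) * x)) (-(1 - Real.cos θ)) x := by
      simpa using ((hasDerivAt_id' x).const_mul (1 - Real.cos θ)).fun_neg
    exact ((h1.exp).mul_const (Real.cos (k * θ))).congr_deriv (by ring)

/-! ### The lattice heat kernel and its equation. -/

/-- The extension of the lattice heat kernel to all times. -/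
def heatExt (ε t : ℝ) (k : ℤ) : ℝ := ε⁻¹ * walkKernel (t / ε ^ 2) k

/-- The substitution `θ = 2π ε ω`. -/
lemma heatKernel_eq {ε : ℝ} (hε : 0 < ε) {z : Pt} (hz : 0 ≤ z.1) :
    heatKernel ε z = heatExt ε z.1 z.2 := by
  have hπ := Real.pi_pos
  unfold heatKernel heatExt walkKernel
  rw [if_neg (not_lt.2 hz)]
  have h := intervalIntegral.integral_comp_mul_left (a := -(1 / (2 * ε))) (b := 1 / (2 * ε))
    (fun θ => Real.exp (-((1 - Real.cos θ) * (z.1 / ε ^ 2))) * Real.cos (z.2 * θ))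
    (c := 2 * Real.pi * ε) (by positivity)
  rw [show 2 * Real.pi * ε * -(1 / (2 * ε)) = -Real.pi by field_simp,
    show 2 * Real.pi * ε * (1 / (2 * ε)) = Real.pi by field_simp, smul_eq_mul] at h
  rw [← mul_assoc, show ε⁻¹ * (2 * Real.pi)⁻¹ = (2 * Real.pi * ε)⁻¹ by field_simp, ← h]
  refine intervalIntegral.integral_congr fun ω _ => ?_
  congr 2
  · field_simp
  · ring

lemma heatKernel_of_neg (ε : ℝ) {z : Pt} (hz : z.1 < 0) : heatKernel ε z = 0 := by
  simp [heatKernel, hz]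

lemma hasDerivAt_heatExt {ε : ℝ} (hε : 0 < ε) (t : ℝ) (k : ℤ) :
    HasDerivAt (fun t => heatExt ε t k)
      ((heatExt ε t (k + 1) + heatExt ε t (k - 1) - 2 * heatExt ε t k) / (2 * ε ^ 2)) t := by
  have h1 : HasDerivAt (fun t : ℝ => t / ε ^ 2) (1 / ε ^ 2) t := (hasDerivAt_id t).div_const _
  have h := ((hasDerivAt_walkKernel (t / ε ^ 2) k).comp t h1).const_mul ε⁻¹
  unfold heatExt
  refine h.congr_deriv ?_
  field_simp

lemma contDiff_heatExt {ε : ℝ} (hε : 0 < ε) (k : ℤ) : ContDiff ℝ 1 fun t => heatExt ε t k := by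
  have hc : ∀ k, Continuous fun t => heatExt ε t k := fun k =>
    continuous_iff_continuousAt.2 fun t => (hasDerivAt_heatExt hε t k).continuousAt
  rw [contDiff_one_iff_deriv]
  refine ⟨fun t => (hasDerivAt_heatExt hε t k).differentiableAt, ?_⟩
  have : deriv (fun t => heatExt ε t k) = fun t =>
      (heatExt ε t (k + 1) + heatExt ε t (k - 1) - 2 * heatExt ε t k) / (2 * ε ^ 2) :=
    funext fun t => (hasDerivAt_heatExt hε t k).deriv
  rw [this]
  exact (((hc _).add (hc _)).sub ((hc k).const_mul 2)).div_const _

lemma heatKernel_nonneg {ε : ℝ} (hε : 0 < ε) (z : Pt) : 0 ≤ heatKernel ε z := by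
  rcases lt_or_ge z.1 0 with h | h
  · rw [heatKernel_of_neg ε h]
  · rw [heatKernel_eq hε h]
    have := walkKernel_nonneg (l := z.1 / ε ^ 2) (by positivity) z.2
    unfold heatExt; positivity

lemma sum_heatKernel_le {ε : ℝ} (hε : 0 < ε) (t : ℝ) (S : Finset ℤ) :
    ∑ k ∈ S, heatKernel ε (t, k) ≤ ε⁻¹ := by
  rcases lt_or_ge t 0 with h | h
  · rw [Finset.sum_eq_zero fun k _ => heatKernel_of_neg ε (z := (t, k)) h]; positivity
  · simp_rw [fun k => heatKernel_eq hε (z := (t, k)) h, heatExt, ← Finset.mul_sum]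
    exact mul_le_of_le_one_right (by positivity) (sum_walkKernel_le_one (by positivity) S)

lemma heatKernel_le {ε : ℝ} (hε : 0 < ε) (z : Pt) : heatKernel ε z ≤ ε⁻¹ := by
  simpa using sum_heatKernel_le hε z.1 {z.2}

lemma heatKernel_le_zero {ε : ℝ} (hε : 0 < ε) (z : Pt) :
    heatKernel ε z ≤ heatKernel ε (z.1, 0) := by
  rcases lt_or_ge z.1 0 with h | h
  · rw [heatKernel_of_neg ε h, heatKernel_of_neg ε (z := (z.1, 0)) h]
  · rw [heatKernel_eq hε h, heatKernel_eq hε (z := (z.1, 0)) h]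
    exact mul_le_mul_of_nonneg_left (walkKernel_le_zero _ _) (by positivity)

lemma heatKernel_zero {ε : ℝ} (hε : 0 < ε) (k : ℤ) :
    heatKernel ε (0, k) = if k = 0 then ε⁻¹ else 0 := by
  rw [heatKernel_eq hε le_rfl]
  simp [heatExt, walkKernel_zero]

lemma contDiffOn_heatKernel {ε : ℝ} (hε : 0 < ε) (k : ℤ) :
    ContDiffOn ℝ 1 (fun t => heatKernel ε (t, k)) (Set.Ici 0) :=
  (contDiff_heatExt hε k).contDiffOn.congr fun _ ht => heatKernel_eq hε ht

lemma measurable_heatKernel {ε : ℝ} (hε : 0 < ε) : Measurable (heatKernel ε) :=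
  measurable_of_continuousOn_slices (fun k => (contDiffOn_heatKernel hε k).continuousOn)
    fun _ => heatKernel_of_neg ε

lemma derivWithin_heatKernel {ε : ℝ} (hε : 0 < ε) {t : ℝ} (ht : 0 ≤ t) (k : ℤ) :
    HasDerivWithinAt (fun t => heatKernel ε (t, k))
      ((heatKernel ε (t, k + 1) + heatKernel ε (t, k - 1) - 2 * heatKernel ε (t, k)) /
        (2 * ε ^ 2)) (Set.Ici 0) t := by
  have h := (hasDerivAt_heatExt hε t k).hasDerivWithinAt (s := Set.Ici 0)
  rw [heatKernel_eq hε (z := (t, k + 1)) ht, heatKernel_eq hε (z := (t, k - 1)) ht,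
    heatKernel_eq hε (z := (t, k)) ht]
  exact h.congr (fun s hs => heatKernel_eq hε (z := (s, k)) hs) (heatKernel_eq hε (z := (t, k)) ht)

/-! ### Mesh-dependent bounds and convergence of the Neumann series. -/

lemma measurable_grad {ε : ℝ} {u : Pt → ℝ} (hu : Measurable u) (s : Bool) :
    Measurable (grad ε s u) := by
  have h1 : Measurable fun z : Pt => u (z.1, z.2 + 1) := by
    refine hu.comp (measurable_fst.prodMk ?_)
    exact (measurable_of_countable fun k : ℤ => k + 1).comp measurable_snd
  have h2 : Measurable fun z : Pt => u (z.1, z.2 - 1) := by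
    refine hu.comp (measurable_fst.prodMk ?_)
    exact (measurable_of_countable fun k : ℤ => k - 1).comp measurable_snd
  cases s
  · have : grad ε false u = fun z => (u z - u (z.1, z.2 - 1)) / ε := by ext; simp [grad]
    rw [this]; exact (hu.sub h2).div_const ε
  · have : grad ε true u = fun z => (u (z.1, z.2 + 1) - u z) / ε := by ext; simp [grad]
    rw [this]; exact (h1.sub hu).div_const ε

lemma measurable_gradProduct {ε : ℝ} (hε : 0 < ε) : Measurable (gradProduct ε) :=
  (measurable_grad (measurable_heatKernel hε) false).mul
    (measurable_grad (measurable_heatKernel hε) true)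

lemma abs_grad_heatKernel_le {ε : ℝ} (hε : 0 < ε) (z : Pt) :
    |grad ε false (heatKernel ε) z| ≤ ε⁻¹ ^ 2 := by
  have h1 := heatKernel_nonneg hε z
  have h2 := heatKernel_nonneg hε (z.1, z.2 - 1)
  have h3 := heatKernel_le hε z
  have h4 := heatKernel_le hε (z.1, z.2 - 1)
  rw [grad_false_eq, abs_div, abs_of_pos hε, div_eq_mul_inv, sq]
  refine mul_le_mul_of_nonneg_right (abs_sub_le_iff.2 ⟨?_, ?_⟩) (by positivity) <;> linarith

lemma abs_grad_true_heatKernel_le {ε : ℝ} (hε : 0 < ε) (z : Pt) :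
    |grad ε true (heatKernel ε) z| ≤ ε⁻¹ * (heatKernel ε z + heatKernel ε (z.1, z.2 + 1)) := by
  have h1 := heatKernel_nonneg hε z
  have h2 := heatKernel_nonneg hε (z.1, z.2 + 1)
  simp only [grad, if_true]
  rw [abs_div, abs_of_pos hε, div_eq_mul_inv, mul_comm]
  refine mul_le_mul_of_nonneg_left (abs_sub_le_iff.2 ⟨?_, ?_⟩) (by positivity) <;> linarith

lemma sum_abs_grad_true_heatKernel_le {ε : ℝ} (hε : 0 < ε) (t : ℝ) (S : Finset ℤ) :
    ∑ k ∈ S, |grad ε true (heatKernel ε) (t, k)| ≤ 2 * ε⁻¹ ^ 2 := by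
  have h1 := sum_heatKernel_le hε t S
  have h2 := sum_heatKernel_le hε t (S.map (addRightEmbedding 1))
  rw [Finset.sum_map] at h2
  simp only [addRightEmbedding_apply] at h2
  calc _ ≤ ∑ k ∈ S, ε⁻¹ * (heatKernel ε (t, k) + heatKernel ε (t, k + 1)) :=
        Finset.sum_le_sum fun k _ => abs_grad_true_heatKernel_le hε (t, k)
    _ = ε⁻¹ * (∑ k ∈ S, heatKernel ε (t, k) + ∑ k ∈ S, heatKernel ε (t, k + 1)) := by
        rw [← Finset.mul_sum, Finset.sum_add_distrib]
    _ ≤ ε⁻¹ * (ε⁻¹ + ε⁻¹) := by gcongr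
    _ = _ := by ring

lemma tsum_ofReal_abs_le {f : ℤ → ℝ} {B : ℝ} (h : ∀ S : Finset ℤ, ∑ k ∈ S, |f k| ≤ B) :
    ∑' k, ENNReal.ofReal |f k| ≤ ENNReal.ofReal B := by
  rw [ENNReal.tsum_eq_iSup_sum]
  refine iSup_le fun S => ?_
  rw [← ENNReal.ofReal_sum_of_nonneg fun k _ => abs_nonneg _]
  exact ENNReal.ofReal_le_ofReal (h S)

lemma sum_abs_gradProduct_le {ε : ℝ} (hε : 0 < ε) (t : ℝ) (S : Finset ℤ) :
    ∑ k ∈ S, |gradProduct ε (t, k)| ≤ 2 * ε⁻¹ ^ 4 := by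
  calc _ ≤ ∑ k ∈ S, ε⁻¹ ^ 2 * |grad ε true (heatKernel ε) (t, k)| := by
        refine Finset.sum_le_sum fun k _ => ?_
        unfold gradProduct
        rw [abs_mul]
        gcongr
        exact abs_grad_heatKernel_le hε _
    _ ≤ ε⁻¹ ^ 2 * (2 * ε⁻¹ ^ 2) := by
        rw [← Finset.mul_sum]
        gcongr
        exact sum_abs_grad_true_heatKernel_le hε t S
    _ = _ := by ring

lemma tsum_gradProduct_le {ε : ℝ} (hε : 0 < ε) (t : ℝ) (j : ℤ) :
    ENNReal.ofReal ε * ∑' k : ℤ, ENNReal.ofReal |gradProduct ε (t, j - k)| ≤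
      ENNReal.ofReal (2 * ε⁻¹ ^ 3) := by
  have he := (Equiv.subLeft j).tsum_eq (fun k => ENNReal.ofReal |gradProduct ε (t, k)|)
  simp only [Equiv.subLeft_apply] at he
  rw [he]
  refine (mul_le_mul' le_rfl (tsum_ofReal_abs_le (sum_abs_gradProduct_le hε t))).trans ?_
  rw [← ENNReal.ofReal_mul hε.le]
  refine ENNReal.ofReal_le_ofReal (le_of_eq ?_)
  field_simp

/-- Summing over space first, with a bound uniform in time, dominates convolution with `Q` by a
Volterra operator in time alone. The constant is far from uniform in `ε`; it serves only convergence
and integrability. -/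
lemma lintegral_gradProduct_mul_le {ε : ℝ} (hε : 0 < ε) (z : Pt) {h : ℝ → ENNReal}
    (hh : Measurable h) :
    ∫⁻ w in Set.Icc 0 z.1 ×ˢ (Set.univ : Set ℤ),
      ENNReal.ofReal |gradProduct ε (z - w)| * h w.1 ∂(gridMeasure ε) ≤
        ENNReal.ofReal (2 * ε⁻¹ ^ 3) * ∫⁻ s in Set.Icc 0 z.1, h s := by
  have hm := measurable_gradProduct hε
  rw [← lintegral_indicator (measurableSet_Icc.prod MeasurableSet.univ),
    lintegral_gridMeasure _ (Measurable.indicator (by fun_prop)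
      (measurableSet_Icc.prod MeasurableSet.univ)), ← lintegral_indicator measurableSet_Icc,
    ← lintegral_const_mul _ (hh.indicator measurableSet_Icc)]
  refine lintegral_mono fun s => ?_
  by_cases hs : s ∈ Set.Icc 0 z.1
  · have : ∀ k : ℤ, (s, k) ∈ Set.Icc 0 z.1 ×ˢ (Set.univ : Set ℤ) := fun k => ⟨hs, trivial⟩
    simp only [Set.indicator_of_mem hs, Set.indicator_of_mem (this _)]
    rw [ENNReal.tsum_mul_right, ← mul_assoc]
    refine mul_le_mul' ?_ le_rfl
    exact tsum_gradProduct_le hε (z.1 - s) z.2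
  · have : ∀ k : ℤ, (s, k) ∉ Set.Icc 0 z.1 ×ˢ (Set.univ : Set ℤ) := fun k hk => hs hk.1
    simp only [Set.indicator_of_notMem hs, Set.indicator_of_notMem (this _)]
    simp

lemma measurable_convPlus {ε : ℝ} {f g : Pt → ℝ} (hf : Measurable f) (hg : Measurable g) :
    Measurable (convPlus ε f g) := by
  have hS : MeasurableSet {p : Pt × Pt | p.2.1 ∈ Set.Icc 0 p.1.1} := by
    have h1 : MeasurableSet {p : Pt × Pt | 0 ≤ p.2.1} :=
      measurableSet_le measurable_const (by fun_prop)
    have h2 : MeasurableSet {p : Pt × Pt | p.2.1 ≤ p.1.1} :=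
      measurableSet_le (by fun_prop) (by fun_prop)
    exact h1.inter h2
  have h : StronglyMeasurable fun p : Pt × Pt =>
      {p : Pt × Pt | p.2.1 ∈ Set.Icc 0 p.1.1}.indicator (fun p => f (p.1 - p.2) * g p.2) p := by
    refine Measurable.stronglyMeasurable (Measurable.indicator (by fun_prop) hS)
  have h2 := (h.integral_prod_right' (ν := gridMeasure ε)).measurable
  refine (congrArg Measurable (funext fun z => ?_)).mp h2
  unfold convPlus
  rw [← integral_indicator (measurableSet_Icc.prod MeasurableSet.univ)]
  refine integral_congr_ae (Filter.Eventually.of_forall fun w => ?_)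
  simp [Set.indicator, Set.mem_prod]

lemma measurable_neumannTerm {ε : ℝ} (hε : 0 < ε) (n : ℕ) : Measurable (neumannTerm ε n) := by
  have h : Measurable ((convPlus ε (gradProduct ε))^[n] (heatKernel ε)) := by
    induction n with
    | zero => exact measurable_heatKernel hε
    | succ n ih =>
      rw [Function.iterate_succ_apply']
      exact measurable_convPlus (measurable_gradProduct hε) ih
  exact h.const_mul _

lemma neumannTerm_succ (ε : ℝ) (n : ℕ) (z : Pt) :
    neumannTerm ε (n + 1) z = -ε * (1 + Real.sqrt ε) *
      convPlus ε (gradProduct ε) (neumannTerm ε n) z := by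
  unfold neumannTerm
  rw [Function.iterate_succ_apply', pow_succ']
  unfold convPlus
  rw [mul_assoc, ← integral_const_mul]
  congr 1
  refine integral_congr_ae (Filter.Eventually.of_forall fun w => ?_)
  simp only
  ring

/-- The rate `2 (1 + √ε) / ε²` of the Volterra bound on the Neumann series. -/
def neumannRate (ε : ℝ) : ℝ := ε * (1 + Real.sqrt ε) * (2 * ε⁻¹ ^ 3)

lemma lintegral_gradProduct_mul_neumannTerm_le {ε : ℝ} (hε : 0 < ε) (n : ℕ)
    (h : ∀ z : Pt, 0 ≤ z.1 →
      |neumannTerm ε n z| ≤ ε⁻¹ * ((neumannRate ε * z.1) ^ n / (Nat.factorial n)))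
    {z : Pt} (hz : 0 ≤ z.1) :
    ∫⁻ w in Set.Icc 0 z.1 ×ˢ (Set.univ : Set ℤ),
      ENNReal.ofReal |gradProduct ε (z - w) * neumannTerm ε n w| ∂(gridMeasure ε) ≤
      ENNReal.ofReal (2 * ε⁻¹ ^ 3 *
        (ε⁻¹ * (neumannRate ε ^ n * (z.1 ^ (n + 1) / (Nat.factorial (n + 1)))))) := by
  have hr : 0 ≤ neumannRate ε := by unfold neumannRate; positivity
  calc _ ≤ ∫⁻ w in Set.Icc 0 z.1 ×ˢ (Set.univ : Set ℤ), ENNReal.ofReal |gradProduct ε (z - w)| *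
        ENNReal.ofReal (ε⁻¹ * ((neumannRate ε * w.1) ^ n / (Nat.factorial n))) ∂(gridMeasure ε) := by
        refine setLIntegral_mono' (measurableSet_Icc.prod MeasurableSet.univ) fun w hw => ?_
        rw [abs_mul, ENNReal.ofReal_mul (abs_nonneg _)]
        gcongr
        exact h w hw.1.1
    _ ≤ ENNReal.ofReal (2 * ε⁻¹ ^ 3) * ∫⁻ s in Set.Icc 0 z.1,
        ENNReal.ofReal (ε⁻¹ * ((neumannRate ε * s) ^ n / (Nat.factorial n))) :=
        lintegral_gradProduct_mul_le hε z
          (h := fun s => ENNReal.ofReal (ε⁻¹ * ((neumannRate ε * s) ^ n / (Nat.factorial n))))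
          (by fun_prop)
    _ = _ := by
        rw [← ofReal_integral_eq_lintegral_ofReal, ← ENNReal.ofReal_mul (by positivity)]
        · congr 2
          rw [integral_Icc_eq_integral_Ioc, ← intervalIntegral.integral_of_le hz]
          simp_rw [mul_pow, mul_div_assoc, ← mul_assoc]
          rw [intervalIntegral.integral_const_mul, intervalIntegral.integral_div, integral_pow,
            Nat.factorial_succ]
          push_cast
          field_simp
          simp
        · exact (Continuous.continuousOn (by fun_prop)).integrableOn_compact isCompact_Icc
        · refine (ae_restrict_iff' measurableSet_Icc).2 (Filter.Eventually.of_forall fun s hs => ?_)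
          have := hs.1
          simp only [Pi.zero_apply]; positivity

/-- Iterating the Volterra bound integrates `sⁿ / n!` at every step, so the factorial gives
convergence for every mesh and every time. -/
lemma abs_neumannTerm_le {ε : ℝ} (hε : 0 < ε) (n : ℕ) (z : Pt) (hz : 0 ≤ z.1) :
    |neumannTerm ε n z| ≤ ε⁻¹ * ((neumannRate ε * z.1) ^ n / (Nat.factorial n)) := by
  induction n generalizing z with
  | zero =>
    have h1 := heatKernel_nonneg hε z
    simpa [neumannTerm, abs_of_nonneg h1] using heatKernel_le hε z
  | succ n ih =>
    rw [neumannTerm_succ, abs_mul]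
    have h1 := lintegral_gradProduct_mul_neumannTerm_le hε n ih hz
    have hr : 0 ≤ neumannRate ε := by unfold neumannRate; positivity
    have h2 : |convPlus ε (gradProduct ε) (neumannTerm ε n) z| ≤ 2 * ε⁻¹ ^ 3 *
        (ε⁻¹ * (neumannRate ε ^ n * (z.1 ^ (n + 1) / (Nat.factorial (n + 1))))) := by
      refine (norm_integral_le_lintegral_norm
        (fun w => gradProduct ε (z - w) * neumannTerm ε n w)).trans ?_
      exact ENNReal.toReal_le_of_le_ofReal (by positivity) h1
    have h3 : |-ε * (1 + Real.sqrt ε)| = ε * (1 + Real.sqrt ε) := by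
      rw [neg_mul, abs_neg, abs_of_nonneg (by positivity)]
    rw [h3]
    refine (mul_le_mul_of_nonneg_left h2 (by positivity)).trans (le_of_eq ?_)
    rw [mul_pow, pow_succ (neumannRate ε) n]
    nth_rw 3 [neumannRate]
    ring

lemma summable_neumannTerm {ε : ℝ} (hε : 0 < ε) (z : Pt) (hz : 0 ≤ z.1) :
    Summable fun n => |neumannTerm ε n z| :=
  Summable.of_nonneg_of_le (fun _ => abs_nonneg _) (fun n => abs_neumannTerm_le hε n z hz)
    ((Real.summable_pow_div_factorial _).mul_left _)

/-- The fixed point form of the series. The interchange of sum and integral is justified by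
comparing the integrated norms with an exponential series. -/
lemma tildeHeatKernel_eq {ε : ℝ} (hε : 0 < ε) (z : Pt) (hz : 0 ≤ z.1) :
    tildeHeatKernel ε z = heatKernel ε z - ε * (1 + Real.sqrt ε) *
      convPlus ε (gradProduct ε) (tildeHeatKernel ε) z := by
  have hs := (summable_neumannTerm hε z hz).of_abs
  have hr : 0 ≤ neumannRate ε := by unfold neumannRate; positivity
  unfold tildeHeatKernel
  rw [hs.tsum_eq_zero_add]
  have h0 : neumannTerm ε 0 z = heatKernel ε z := by simp [neumannTerm]
  have hb := fun n => lintegral_gradProduct_mul_neumannTerm_le hε n (abs_neumannTerm_le hε n) hz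
  have hm := measurable_gradProduct hε
  have hint : ∀ n, Integrable (fun w => gradProduct ε (z - w) * neumannTerm ε n w)
      ((gridMeasure ε).restrict (Set.Icc 0 z.1 ×ˢ (Set.univ : Set ℤ))) := by
    intro n
    have hmn := measurable_neumannTerm hε n
    refine ⟨Measurable.aestronglyMeasurable (by fun_prop), ?_⟩
    rw [hasFiniteIntegral_iff_norm]
    exact (hb n).trans_lt ENNReal.ofReal_lt_top
  have hsum := hasSum_integral_of_summable_integral_norm hint ?_
  · rw [h0, sub_eq_add_neg]
    congr 1
    simp_rw [neumannTerm_succ]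
    rw [tsum_mul_left, neg_mul, neg_mul]
    congr 2
    unfold convPlus
    rw [hsum.tsum_eq]
    refine setIntegral_congr_fun (measurableSet_Icc.prod MeasurableSet.univ) fun w hw => ?_
    exact tsum_mul_left
  · refine Summable.of_nonneg_of_le (fun n => integral_nonneg fun w => norm_nonneg _)
      (fun n => ?_) ((Real.summable_pow_div_factorial (neumannRate ε * z.1)).mul_left
        (2 * ε⁻¹ ^ 3 * ε⁻¹ * z.1))
    rw [integral_norm_eq_lintegral_enorm (hint n).1]
    refine ENNReal.toReal_le_of_le_ofReal (by positivity) ?_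
    refine le_trans (le_of_eq ?_) ((hb n).trans (ENNReal.ofReal_le_ofReal ?_))
    · refine lintegral_congr fun w => ?_
      rw [← ofReal_norm, Real.norm_eq_abs]
    · have : z.1 ^ (n + 1) / (Nat.factorial (n + 1)) ≤ z.1 * (z.1 ^ n / (Nat.factorial n)) := by
        rw [pow_succ', mul_div_assoc]
        gcongr
        exact Nat.le_succ n
      calc _ ≤ 2 * ε⁻¹ ^ 3 * (ε⁻¹ * (neumannRate ε ^ n * (z.1 * (z.1 ^ n / (Nat.factorial n))))) := by
            gcongr
        _ = _ := by rw [mul_pow]; ring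

lemma abs_tildeHeatKernel_le {ε : ℝ} (hε : 0 < ε) (z : Pt) (hz : 0 ≤ z.1) :
    |tildeHeatKernel ε z| ≤ ε⁻¹ * Real.exp (neumannRate ε * z.1) := by
  have hs := summable_neumannTerm hε z hz
  have h3 : HasSum (fun j : ℕ => (neumannRate ε * z.1) ^ j / (Nat.factorial j))
      (Real.exp (neumannRate ε * z.1)) := by
    rw [Real.exp_eq_exp_ℝ]
    exact NormedSpace.expSeries_div_hasSum_exp _
  have h1 : ‖∑' n, neumannTerm ε n z‖ ≤ ∑' n, ‖neumannTerm ε n z‖ := norm_tsum_le_tsum_norm hs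
  have h2 : ∑' n, |neumannTerm ε n z| ≤ ε⁻¹ * Real.exp (neumannRate ε * z.1) :=
    hasSum_le (fun n => abs_neumannTerm_le hε n z hz) hs.hasSum (h3.mul_left _)
  exact h1.trans h2

/-- At time zero the domain of the convolution is null. The common initial datum is what later
controls `∇K̃` away from the time axis. -/
lemma tildeHeatKernel_zero {ε : ℝ} (hε : 0 < ε) (k : ℤ) :
    tildeHeatKernel ε (0, k) = heatKernel ε (0, k) := by
  rw [tildeHeatKernel_eq hε _ le_rfl]
  have : gridMeasure ε (Set.Icc 0 0 ×ˢ (Set.univ : Set ℤ)) = 0 := by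
    unfold gridMeasure
    rw [Measure.prod_prod]; simp
  unfold convPlus
  rw [setIntegral_measure_zero _ this]; simp

/-- Commutativity through `w ↦ z - w`, which frees the other factor to carry the gradient. -/
lemma convPlus_eq (ε : ℝ) (f g : Pt → ℝ) (z : Pt) :
    convPlus ε f g z =
      ∫ w in Set.Icc 0 z.1 ×ˢ (Set.univ : Set ℤ), f w * g (z - w) ∂(gridMeasure ε) := by
  unfold convPlus
  rw [← integral_indicator (measurableSet_Icc.prod MeasurableSet.univ),
    ← integral_indicator (measurableSet_Icc.prod MeasurableSet.univ),
    ← integral_sub_left_eq_self _ (gridMeasure ε) z]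
  refine integral_congr_ae (Filter.Eventually.of_forall fun w => ?_)
  simp only [Set.indicator, Set.mem_prod, Set.mem_Icc, Set.mem_univ, and_true, Prod.fst_sub,
    sub_sub_cancel, sub_nonneg, sub_le_self_iff]
  simp only [and_comm]

/-! ### The integral equation for the gradient of the modified kernel. -/

lemma measurableSet_slab (s : Set ℝ) (hs : MeasurableSet s) :
    MeasurableSet (s ×ˢ (Set.univ : Set ℤ)) := hs.prod MeasurableSet.univ

lemma integrableOn_gradProduct {ε : ℝ} (hε : 0 < ε) (T : ℝ) :
    IntegrableOn (gradProduct ε) (Set.Icc 0 T ×ˢ (Set.univ : Set ℤ)) (gridMeasure ε) := by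
  have hm := measurable_gradProduct hε
  refine ⟨hm.aestronglyMeasurable, ?_⟩
  rw [hasFiniteIntegral_iff_norm, ← lintegral_indicator (measurableSet_slab _ measurableSet_Icc),
    ← lintegral_sub_left_eq_self _ (T, 0)]
  have h := lintegral_gradProduct_mul_le hε (T, 0) (h := fun _ => 1) measurable_const
  rw [← lintegral_indicator (measurableSet_slab _ measurableSet_Icc)] at h
  refine lt_of_le_of_lt (le_of_eq ?_) (h.trans_lt ?_)
  · refine lintegral_congr fun w => ?_
    simp [Set.indicator, Set.mem_prod, and_comm]
  · refine ENNReal.mul_lt_top ENNReal.ofReal_lt_top ?_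
    simp

lemma RegularBound.measurable_cut {ε C : ℝ} {R : Pt → ℝ} (h : RegularBound ε C R) :
    Measurable fun z : Pt => if z.1 < 0 then 0 else R z := by
  refine measurable_of_continuousOn_slices (fun k => ?_) (fun z hz => by simp [hz])
  refine (h.contDiffOn k).continuousOn.congr fun t ht => ?_
  exact if_neg (not_lt.2 ht)

/-- Measurability of `G̃` is read off its decomposition instead of the series. Extension by zero is
needed because a remainder is unconstrained at negative times. -/
lemma measurable_cut_of_decomposition {ε c A C : ℝ} {u K R : Pt → ℝ} (hK : KernelBound ε c A K)
    (hR : RegularBound ε C R) (hu : ∀ z : Pt, 0 ≤ z.1 → u z = K z + R z) :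
    Measurable fun z : Pt => if z.1 < 0 then 0 else u z := by
  refine (congrArg Measurable (funext fun z => ?_)).mp (hK.measurable.add hR.measurable_cut)
  simp only [Pi.add_apply]
  split_ifs with h
  · rw [hK.eq_zero_of_neg z h, zero_add]
  · rw [hu z (not_lt.1 h)]

lemma integrableOn_gradProduct_mul {ε : ℝ} (hε : 0 < ε) {T B : ℝ} {g : Pt → ℝ}
    (hg : Measurable fun z : Pt => if z.1 < 0 then 0 else g z)
    (hB : ∀ z : Pt, 0 ≤ z.1 → z.1 ≤ T → |g z| ≤ B) (k : ℤ) :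
    IntegrableOn (fun w => gradProduct ε w * g ((T, k) - w))
      (Set.Icc 0 T ×ˢ (Set.univ : Set ℤ)) (gridMeasure ε) := by
  have h1 : IntegrableOn (fun w => gradProduct ε w *
      (fun z : Pt => if z.1 < 0 then 0 else g z) ((T, k) - w))
      (Set.Icc 0 T ×ˢ (Set.univ : Set ℤ)) (gridMeasure ε) := by
    refine Integrable.mul_bdd (c := B) (integrableOn_gradProduct hε T)
      (Measurable.aestronglyMeasurable (hg.comp (measurable_const.sub measurable_id))) ?_
    refine (ae_restrict_iff' (measurableSet_slab _ measurableSet_Icc)).2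
      (Filter.Eventually.of_forall fun w hw => ?_)
    have h0 := hw.1.1
    have h0' := hw.1.2
    beta_reduce
    rw [if_neg (not_lt.2 (show 0 ≤ ((T, k) - w).1 by simpa using h0'))]
    exact hB _ (by simpa using h0') (by simpa using h0)
  refine h1.congr_fun (fun w hw => ?_) (measurableSet_slab _ measurableSet_Icc)
  have h0' := hw.1.2
  simp only
  rw [if_neg (not_lt.2 (show 0 ≤ ((T, k) - w).1 by simpa using h0'))]

/-- The spatial difference commutes with the convolution once it acts on the unreversed factor. -/
lemma grad_tildeHeatKernel_eq {ε : ℝ} (hε : 0 < ε)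
    (hm : Measurable fun z : Pt => if z.1 < 0 then 0 else tildeHeatKernel ε z)
    (z : Pt) (hz : 0 ≤ z.1) :
    grad ε false (tildeHeatKernel ε) z = grad ε false (heatKernel ε) z - ε * (1 + Real.sqrt ε) *
      ∫ w in Set.Icc 0 z.1 ×ˢ (Set.univ : Set ℤ),
        gradProduct ε w * grad ε false (tildeHeatKernel ε) (z - w) ∂(gridMeasure ε) := by
  have hr : 0 ≤ neumannRate ε := by unfold neumannRate; positivity
  have hi : ∀ k : ℤ, IntegrableOn (fun w => gradProduct ε w * tildeHeatKernel ε ((z.1, k) - w))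
      (Set.Icc 0 z.1 ×ˢ (Set.univ : Set ℤ)) (gridMeasure ε) := fun k =>
    integrableOn_gradProduct_mul hε (B := ε⁻¹ * Real.exp (neumannRate ε * z.1)) hm
      (fun w h0 h1 => (abs_tildeHeatKernel_le hε w h0).trans (by gcongr)) k
  have h1 := tildeHeatKernel_eq hε z hz
  have h2 := tildeHeatKernel_eq hε (z.1, z.2 - 1) hz
  rw [convPlus_eq] at h1 h2
  simp only at h2
  have h3 : ∫ w in Set.Icc 0 z.1 ×ˢ (Set.univ : Set ℤ),
        gradProduct ε w * grad ε false (tildeHeatKernel ε) (z - w) ∂(gridMeasure ε) =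
      ((∫ w in Set.Icc 0 z.1 ×ˢ (Set.univ : Set ℤ),
        gradProduct ε w * tildeHeatKernel ε (z - w) ∂(gridMeasure ε)) -
      ∫ w in Set.Icc 0 z.1 ×ˢ (Set.univ : Set ℤ),
        gradProduct ε w * tildeHeatKernel ε ((z.1, z.2 - 1) - w) ∂(gridMeasure ε)) / ε := by
    rw [← integral_sub (hi z.2) (hi (z.2 - 1)), ← integral_div]
    refine integral_congr_ae (Filter.Eventually.of_forall fun w => ?_)
    simp only [grad_false_eq]
    rw [show ((z.1, z.2 - 1) : Pt) - w = ((z - w).1, (z - w).2 - 1) by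
      ext <;> simp; ring]
    ring
  rw [h3, grad_false_eq, grad_false_eq, h1, h2]
  ring

/-! ### The absolute mass of `∇⁻G ∇⁺G`. -/

section Difference

variable {ε c A C : ℝ} {K R : Pt → ℝ}

lemma RegularBound.grad_true_bound (h : RegularBound ε C R) (z : Pt) (hz : 0 ≤ z.1) :
    |grad ε true R z| ≤ C := by
  rw [grad_true_eq]; exact h.grad_bound _ hz

lemma grad_add (s : Bool) (u v : Pt → ℝ) (z : Pt) :
    grad ε s (fun w => u w + v w) z = grad ε s u z + grad ε s v z := by
  cases s <;> simp [grad] <;> ring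

lemma grad_eq_of_decomposition {u : Pt → ℝ} (hu : ∀ z : Pt, 0 ≤ z.1 → u z = K z + R z) (s : Bool)
    (z : Pt) (hz : 0 ≤ z.1) : grad ε s u z = grad ε s K z + grad ε s R z := by
  rw [← grad_add]
  exact grad_congr fun k => hu (z.1, k) hz

lemma abs_grad_le_of_decomposition (hK : KernelBound ε c A K) (hR : RegularBound ε C R)
    {u : Pt → ℝ} (hu : ∀ z : Pt, 0 ≤ z.1 → u z = K z + R z) (s : Bool) (z : Pt) (hz : 0 ≤ z.1) :
    |grad ε s u z| ≤ A * wt ε z ^ 8 + C := by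
  rw [grad_eq_of_decomposition hu s z hz]
  refine (abs_add_le _ _).trans (add_le_add (hK.grad_bound s z) ?_)
  cases s
  · exact hR.grad_bound z hz
  · exact hR.grad_true_bound z hz

lemma lintegral_abs_grad_true_heatKernel_le (hε : 0 < ε) (T : ℝ) :
    ∫⁻ w in Set.Icc 0 T ×ˢ (Set.univ : Set ℤ),
      ENNReal.ofReal |grad ε true (heatKernel ε) w| ∂(gridMeasure ε) ≤
      ENNReal.ofReal (2 * ε⁻¹ * T) := by
  have hm := measurable_grad (ε := ε) (measurable_heatKernel hε) true
  rw [← lintegral_indicator (measurableSet_slab _ measurableSet_Icc),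
    lintegral_gridMeasure _ (Measurable.indicator (by fun_prop)
      (measurableSet_slab _ measurableSet_Icc))]
  calc _ ≤ ∫⁻ t, (Set.Icc 0 T).indicator (fun _ => ENNReal.ofReal (2 * ε⁻¹)) t := by
        refine lintegral_mono fun s => ?_
        by_cases hs : s ∈ Set.Icc 0 T
        · have : ∀ k : ℤ, (s, k) ∈ Set.Icc 0 T ×ˢ (Set.univ : Set ℤ) := fun k => ⟨hs, trivial⟩
          simp only [Set.indicator_of_mem hs, Set.indicator_of_mem (this _)]
          refine (mul_le_mul' le_rfl
            (tsum_ofReal_abs_le (sum_abs_grad_true_heatKernel_le hε s))).trans ?_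
          rw [← ENNReal.ofReal_mul hε.le]
          refine ENNReal.ofReal_le_ofReal (le_of_eq ?_)
          field_simp
        · have : ∀ k : ℤ, (s, k) ∉ Set.Icc 0 T ×ˢ (Set.univ : Set ℤ) := fun k hk => hs hk.1
          simp only [Set.indicator_of_notMem hs, Set.indicator_of_notMem (this _)]
          simp
    _ = _ := by
        rw [lintegral_indicator measurableSet_Icc, setLIntegral_const, Real.volume_Icc, sub_zero,
          ← ENNReal.ofReal_mul (by positivity)]

/-- Near the origin both gradients obey the singular bound. Far away the remainder is bounded but
its decay is unknown, so one factor is bounded and the other is kept, to be summed over space by the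
mass bound for `G`. -/
lemma abs_gradProduct_le (hε : 0 < ε) (hA : 0 ≤ A) (hC : 0 ≤ C) (hK : KernelBound ε c A K)
    (hR : RegularBound ε C R) (hu : ∀ z : Pt, 0 ≤ z.1 → heatKernel ε z = K z + R z) (z : Pt)
    (hz : 0 ≤ z.1) : |gradProduct ε z| ≤
      (A + C) ^ 2 * wt ε z ^ 16 + (A + C) * |grad ε true (heatKernel ε) z| := by
  have hq := wt_pos hε z
  have h1 := abs_grad_le_of_decomposition hK hR hu false z hz
  have h2 := abs_grad_le_of_decomposition hK hR hu true z hz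
  have h3 := abs_nonneg (grad ε true (heatKernel ε) z)
  unfold gradProduct
  rw [abs_mul]
  rcases le_total 1 (wt ε z ^ 8) with h | h
  · have h4 : A * wt ε z ^ 8 + C ≤ (A + C) * wt ε z ^ 8 := by nlinarith
    calc _ ≤ ((A + C) * wt ε z ^ 8) * ((A + C) * wt ε z ^ 8) := by
          gcongr
          · exact h1.trans h4
          · exact h2.trans h4
      _ = (A + C) ^ 2 * wt ε z ^ 16 := by ring
      _ ≤ _ := by have : 0 ≤ (A + C) * |grad ε true (heatKernel ε) z| := by positivity
                  linarith
  · have h4 : A * wt ε z ^ 8 + C ≤ A + C := by nlinarith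
    calc _ ≤ (A + C) * |grad ε true (heatKernel ε) z| := by gcongr; exact h1.trans h4
      _ ≤ _ := by have : 0 ≤ (A + C) ^ 2 * wt ε z ^ 16 := by positivity
                  linarith

end Difference

/-- The power 4 of the singularity exceeds the dimension by one, so the mass is of order `1 / ε` and
is not made small by the prefactor `ε`. This suffices against a bounded remainder; against the
singular part the sign of `Q` has to be used. -/
lemma mul_setIntegral_abs_gradProduct_le (A C : ℝ) (hA : 0 ≤ A) (hC : 0 ≤ C) :
    ∃ B : ℝ, 0 ≤ B ∧ ∀ (ε c : ℝ) (K R : Pt → ℝ), 0 < ε → KernelBound ε c A K →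
      RegularBound ε C R → (∀ z : Pt, 0 ≤ z.1 → heatKernel ε z = K z + R z) →
      ∀ T : ℝ, 0 ≤ T → ε * ∫ w in Set.Icc 0 T ×ˢ (Set.univ : Set ℤ),
        |gradProduct ε w| ∂(gridMeasure ε) ≤ B * (1 + T) := by
  obtain ⟨C₁, hC₁, h₁⟩ := lintegral_wt_pow_le (n := 16) (by norm_num)
  refine ⟨(A + C) ^ 2 * C₁ + (A + C) * 2, by positivity, fun ε c K R hε hK hR hu T hT => ?_⟩
  have hm := measurable_wt ε
  have hm2 := measurable_grad (ε := ε) (measurable_heatKernel hε) true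
  have h2 : ∫⁻ w in Set.Icc 0 T ×ˢ (Set.univ : Set ℤ),
      ENNReal.ofReal |gradProduct ε w| ∂(gridMeasure ε) ≤
      ENNReal.ofReal ((A + C) ^ 2 * (C₁ * ε⁻¹) + (A + C) * (2 * ε⁻¹ * T)) := by
    calc _ ≤ ∫⁻ w in Set.Icc 0 T ×ˢ (Set.univ : Set ℤ), (ENNReal.ofReal ((A + C) ^ 2) *
            ENNReal.ofReal (wt ε w ^ 16) + ENNReal.ofReal (A + C) *
            ENNReal.ofReal |grad ε true (heatKernel ε) w|) ∂(gridMeasure ε) := by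
          refine setLIntegral_mono' (measurableSet_slab _ measurableSet_Icc) fun w hw => ?_
          rw [← ENNReal.ofReal_mul (by positivity), ← ENNReal.ofReal_mul (by positivity)]
          exact (ENNReal.ofReal_le_ofReal (abs_gradProduct_le hε hA hC hK hR hu w hw.1.1)).trans
            ENNReal.ofReal_add_le
      _ ≤ ENNReal.ofReal ((A + C) ^ 2) * ENNReal.ofReal (C₁ * ε⁻¹) + ENNReal.ofReal (A + C) *
            ENNReal.ofReal (2 * ε⁻¹ * T) := by
          rw [lintegral_add_left (by fun_prop), lintegral_const_mul _ (by fun_prop),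
            lintegral_const_mul _ (by fun_prop)]
          gcongr
          · refine (setLIntegral_le_lintegral _ _).trans ((h₁ ε hε).trans (le_of_eq ?_))
            rw [← Real.rpow_neg_one]; norm_num
          · exact lintegral_abs_grad_true_heatKernel_le hε T
      _ = _ := by
          rw [← ENNReal.ofReal_mul (by positivity), ← ENNReal.ofReal_mul (by positivity),
            ← ENNReal.ofReal_add (by positivity) (by positivity)]
  have h3 : ∫ w in Set.Icc 0 T ×ˢ (Set.univ : Set ℤ), |gradProduct ε w| ∂(gridMeasure ε) ≤
      (A + C) ^ 2 * (C₁ * ε⁻¹) + (A + C) * (2 * ε⁻¹ * T) := by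
    refine (le_abs_self _).trans
      ((norm_integral_le_lintegral_norm (fun w => |gradProduct ε w|)).trans ?_)
    refine ENNReal.toReal_le_of_le_ofReal (by positivity) (le_trans (le_of_eq ?_) h2)
    simp only [norm_abs_eq_norm, Real.norm_eq_abs]
  calc _ ≤ ε * ((A + C) ^ 2 * (C₁ * ε⁻¹) + (A + C) * (2 * ε⁻¹ * T)) := by gcongr
    _ = (A + C) ^ 2 * C₁ + (A + C) * 2 * T := by field_simp
    _ ≤ _ := by
      have : 0 ≤ (A + C) ^ 2 * C₁ * T := by positivity
      have : 0 ≤ (A + C) * 2 := by positivity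
      nlinarith

/-! ### The energy identity and the signed mass of `∇⁻G ∇⁺G`. -/

lemma setIntegral_slab_finset {ε : ℝ} (hε : 0 < ε) {t : ℝ} (ht : 0 ≤ t) (F : Finset ℤ) {g : Pt → ℝ}
    (hg : IntegrableOn g (Set.Icc 0 t ×ˢ (F : Set ℤ)) (gridMeasure ε)) :
    ∫ w in Set.Icc 0 t ×ˢ (F : Set ℤ), g w ∂(gridMeasure ε) =
      ∫ s in (0 : ℝ)..t, ε * ∑ k ∈ F, g (s, k) := by
  unfold gridMeasure at hg ⊢
  rw [setIntegral_prod _ hg, integral_Icc_eq_integral_Ioc, ← intervalIntegral.integral_of_le ht]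
  refine intervalIntegral.integral_congr fun s _ => ?_
  rw [Measure.restrict_smul, integral_smul_measure, ENNReal.toReal_ofReal hε.le, smul_eq_mul,
    setIntegral_finset]
  · simp
  · have : (F : Set ℤ) = ⋃ k ∈ F, {k} := by ext; simp
    rw [this, integrableOn_finset_iUnion]
    exact fun k _ => integrableOn_singleton (hx := by rw [Measure.count_singleton]; norm_num)

lemma sum_Ico_int_telescope (T : ℤ → ℝ) (a : ℤ) (n : ℕ) :
    ∑ k ∈ Finset.Ico a (a + n), (T (k + 1) - T k) = T (a + n) - T a := by
  induction n with
  | zero => simp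
  | succ n ih =>
    have : Finset.Ico a (a + ((n + 1 : ℕ) : ℤ)) = insert (a + n) (Finset.Ico a (a + n)) := by
      ext k; simp only [Finset.mem_Ico, Finset.mem_insert]; push_cast; omega
    rw [this, Finset.sum_insert (by simp), ih]
    push_cast
    rw [add_assoc]; ring

/-- The part of the lattice at distance at most `m` from the origin. -/
def nearSet (m : ℕ) : Finset ℤ := Finset.Ico (-(m : ℤ)) (m + 1)

lemma mem_nearSet {m : ℕ} {k : ℤ} : k ∈ nearSet m ↔ |k| ≤ m := by
  rw [nearSet, Finset.mem_Ico, abs_le]; omega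

/-- The boundary flux in the energy identity for the lattice heat equation. -/
def heatFlux (ε s : ℝ) (k : ℤ) : ℝ :=
  (heatExt ε s k - heatExt ε s (k - 1)) / ε * heatExt ε s (k - 1) +
    (heatExt ε s (k - 1) - heatExt ε s (k - 2)) / ε * heatExt ε s k

/-- Shifting one factor of the energy by one site is what produces the mixed product `∇⁻G ∇⁺G` after
summation by parts. The window is finite, hence the flux through its two ends. -/
lemma hasDerivAt_energy {ε : ℝ} (hε : 0 < ε) (m : ℕ) (s : ℝ) :
    HasDerivAt (fun s => ε * ∑ k ∈ nearSet m, heatExt ε s k * heatExt ε s (k - 1))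
      ((heatFlux ε s (m + 1) - heatFlux ε s (-m)) / 2 - ε * ∑ k ∈ nearSet m,
        (heatExt ε s k - heatExt ε s (k - 1)) / ε * ((heatExt ε s (k + 1) - heatExt ε s k) / ε))
      s := by
  have h := (HasDerivAt.fun_sum (u := nearSet m) fun k _ =>
    (hasDerivAt_heatExt hε s k).mul (hasDerivAt_heatExt hε s (k - 1))).const_mul ε
  refine h.congr_deriv ?_
  have ht := sum_Ico_int_telescope (heatFlux ε s) (-m) (2 * m + 1)
  rw [show -(m : ℤ) + ((2 * m + 1 : ℕ) : ℤ) = m + 1 by push_cast; ring] at ht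
  change ∑ k ∈ nearSet m, _ = _ at ht
  rw [← ht, Finset.sum_div, Finset.mul_sum, Finset.mul_sum, ← Finset.sum_sub_distrib]
  refine Finset.sum_congr rfl fun k _ => ?_
  unfold heatFlux
  rw [show k - 1 + 1 = k by ring, show k + 1 - 1 = k by ring, show k + 1 - 2 = k - 1 by ring,
    show k - 1 - 1 = k - 2 by ring]
  field_simp
  ring

lemma continuous_heatExt {ε : ℝ} (hε : 0 < ε) (k : ℤ) : Continuous fun s => heatExt ε s k :=
  (contDiff_heatExt hε k).continuous

/-- The fundamental theorem of calculus for the shifted energy: the signed mass is the boundary flux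
minus the energy at time `t`, because the initial energy vanishes. The mass is thus of order `1 /
(√t + ε)` where absolute values give `1 / ε`. -/
lemma abs_setIntegral_gradProduct_near_le {ε c A C : ℝ} {K R : Pt → ℝ} (hε : 0 < ε) (hC : 0 ≤ C)
    (hK : KernelBound ε c A K) (hR : RegularBound ε C R)
    (hu : ∀ z : Pt, 0 ≤ z.1 → heatKernel ε z = K z + R z) {m : ℕ} (hm : c + 2 * ε < ε * m)
    {t : ℝ} (ht : 0 ≤ t) :
    |∫ w in Set.Icc 0 t ×ˢ (nearSet m : Set ℤ), gradProduct ε w ∂(gridMeasure ε)| ≤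
      A * wt ε (t, 0) ^ 4 + C + 2 * C ^ 2 * t := by
  have hint : IntegrableOn (gradProduct ε) (Set.Icc 0 t ×ˢ (nearSet m : Set ℤ)) (gridMeasure ε) :=
    (integrableOn_gradProduct hε t).mono_set (Set.prod_mono le_rfl (Set.subset_univ _))
  rw [setIntegral_slab_finset hε ht _ hint]
  have hce := continuous_heatExt hε
  have hcf : ∀ k, Continuous fun s => heatFlux ε s k := fun k => by
    have h1 := hce k
    have h2 := hce (k - 1)
    have h3 := hce (k - 2)
    unfold heatFlux; fun_prop
  have hcs : Continuous fun s => ε * ∑ k ∈ nearSet m,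
        (heatExt ε s k - heatExt ε s (k - 1)) / ε * ((heatExt ε s (k + 1) - heatExt ε s k) / ε) := by
    refine continuous_const.mul (continuous_finsetSum _ fun k _ => ?_)
    have h1 := hce k
    have h2 := hce (k - 1)
    have h3 := hce (k + 1)
    fun_prop
  have hcd : Continuous fun s => (heatFlux ε s (m + 1) - heatFlux ε s (-m)) / 2 := by
    have h1 := hcf (m + 1)
    have h2 := hcf (-m)
    fun_prop
  have hftc := intervalIntegral.integral_eq_sub_of_hasDerivAt (a := 0) (b := t)
    (fun s _ => hasDerivAt_energy hε m s)
    (Continuous.intervalIntegrable (hcd.sub hcs) _ _)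
  rw [intervalIntegral.integral_sub
    (Continuous.intervalIntegrable hcd _ _)
    (Continuous.intervalIntegrable hcs _ _)] at hftc
  have hQ : ∫ s in (0 : ℝ)..t, ε * ∑ k ∈ nearSet m, gradProduct ε (s, k) =
      ∫ s in (0 : ℝ)..t, ε * ∑ k ∈ nearSet m,
        (heatExt ε s k - heatExt ε s (k - 1)) / ε * ((heatExt ε s (k + 1) - heatExt ε s k) / ε) := by
    refine intervalIntegral.integral_congr fun s hs => ?_
    rw [Set.uIcc_of_le ht] at hs
    congr 1
    refine Finset.sum_congr rfl fun k _ => ?_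
    simp only [gradProduct, grad, if_true, Bool.false_eq_true, if_false]
    rw [heatKernel_eq hε (z := (s, k)) hs.1, heatKernel_eq hε (z := (s, k - 1)) hs.1,
      heatKernel_eq hε (z := (s, k + 1)) hs.1]
  -- The initial datum is supported on one site, so its product with its own shift is zero.
  have hzero : ε * ∑ k ∈ nearSet m, heatExt ε 0 k * heatExt ε 0 (k - 1) = 0 := by
    rw [Finset.sum_eq_zero, mul_zero]
    intro k _
    have h1 := heatKernel_zero hε k
    have h2 := heatKernel_zero hε (k - 1)
    rw [heatKernel_eq hε (z := (0, k)) le_rfl] at h1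
    rw [heatKernel_eq hε (z := (0, k - 1)) le_rfl] at h2
    simp only at h1 h2
    rw [h1, h2]
    split_ifs <;> first | omega | simp
  rw [hzero, sub_zero, ← hQ] at hftc
  -- Two steps inside the edge of the window `K` already vanishes, so the flux, which reaches two
  -- sites back, sees only the bounded remainder.
  have hfarK : ∀ s : ℝ, ∀ k : ℤ, (m : ℤ) - 2 ≤ |k| → K (s, k) = 0 := by
    intro s k hk
    refine hK.eq_zero_of_lt _ ?_
    have h1 : (m : ℝ) - 2 ≤ |(k : ℝ)| := by exact_mod_cast hk
    have h2 := Real.sqrt_nonneg |s|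
    unfold parabolicSize
    simp only
    nlinarith
  have hfar : ∀ s : ℝ, 0 ≤ s → ∀ k : ℤ, (m : ℤ) - 2 ≤ |k| → |heatExt ε s k| ≤ C := by
    intro s hs k hk
    have h1 := hu (s, k) hs
    rw [heatKernel_eq hε (z := (s, k)) hs, hfarK s k hk, zero_add] at h1
    simp only at h1
    rw [h1]; exact hR.bound (s, k) hs
  have hfarg : ∀ s : ℝ, 0 ≤ s → ∀ k : ℤ, (m : ℤ) - 2 ≤ |k| → (m : ℤ) - 2 ≤ |k - 1| →
      |(heatExt ε s k - heatExt ε s (k - 1)) / ε| ≤ C := by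
    intro s hs k hk hk'
    have h1 := hu (s, k) hs
    have h2 := hu (s, k - 1) hs
    rw [heatKernel_eq hε (z := (s, k)) hs, hfarK s k hk, zero_add] at h1
    rw [heatKernel_eq hε (z := (s, k - 1)) hs, hfarK s (k - 1) hk', zero_add] at h2
    simp only at h1 h2
    have := hR.grad_bound (s, k) hs
    rw [grad_false_eq] at this
    rwa [h1, h2]
  have hfluxb : ∀ s : ℝ, 0 ≤ s → ∀ k : ℤ, (m : ℤ) - 2 ≤ |k| → (m : ℤ) - 2 ≤ |k - 1| →
      (m : ℤ) - 2 ≤ |k - 2| → |heatFlux ε s k| ≤ 2 * C ^ 2 := by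
    intro s hs k h0 h1 h2
    unfold heatFlux
    refine (abs_add_le _ _).trans ?_
    rw [abs_mul, abs_mul]
    have e1 := hfarg s hs k h0 h1
    have e2 := hfarg s hs (k - 1) h1 (by rwa [show k - 1 - 1 = k - 2 by ring])
    rw [show k - 1 - 1 = k - 2 by ring] at e2
    have e3 := hfar s hs k h0
    have e4 := hfar s hs (k - 1) h1
    nlinarith [mul_le_mul e1 e4 (abs_nonneg _) hC, mul_le_mul e2 e3 (abs_nonneg _) hC]
  have hflux : |∫ s in (0 : ℝ)..t, (heatFlux ε s (m + 1) - heatFlux ε s (-m)) / 2| ≤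
      2 * C ^ 2 * t := by
    have := intervalIntegral.norm_integral_le_of_norm_le_const (a := 0) (b := t) (C := 2 * C ^ 2)
      (f := fun s => (heatFlux ε s (m + 1) - heatFlux ε s (-m)) / 2) ?_
    · rwa [sub_zero, abs_of_nonneg ht] at this
    · intro s hs
      rw [Set.uIoc_of_le ht] at hs
      have h1 := hfluxb s hs.1.le (m + 1) (by rw [abs_of_nonneg] <;> omega)
        (by rw [abs_of_nonneg] <;> omega) (by
          rw [show (m : ℤ) + 1 - 2 = m - 1 by ring]; have := le_abs_self ((m : ℤ) - 1); omega)
      have h2 := hfluxb s hs.1.le (-m) (by rw [abs_neg, abs_of_nonneg] <;> omega)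
        (by have := neg_le_abs (-(m : ℤ) - 1); omega) (by have := neg_le_abs (-(m : ℤ) - 2); omega)
      rw [norm_div, Real.norm_eq_abs, Real.norm_eq_abs, abs_of_pos (by norm_num : (0 : ℝ) < 2)]
      have := abs_sub (heatFlux ε s (m + 1)) (heatFlux ε s (-m))
      linarith
  -- One factor is bounded by the value at the origin, the other is summed to total mass at most
  -- one.
  have hen : |ε * ∑ k ∈ nearSet m, heatExt ε t k * heatExt ε t (k - 1)| ≤
      A * wt ε (t, 0) ^ 4 + C := by
    have e : ∀ k, heatExt ε t k = heatKernel ε (t, k) := fun k =>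
      (heatKernel_eq hε (z := (t, k)) ht).symm
    simp_rw [e]
    have hn := heatKernel_nonneg hε
    rw [abs_of_nonneg (mul_nonneg hε.le (Finset.sum_nonneg fun k _ => mul_nonneg (hn _) (hn _)))]
    have h0 : heatKernel ε (t, 0) ≤ A * wt ε (t, 0) ^ 4 + C := by
      rw [hu (t, 0) ht]
      have h1 := hK.bound (t, 0)
      have h2 := hR.bound (t, 0) ht
      linarith [le_abs_self (K (t, 0)), le_abs_self (R (t, 0))]
    calc _ ≤ ε * ∑ k ∈ nearSet m, heatKernel ε (t, k) * heatKernel ε (t, 0) := by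
          gcongr with k
          · exact hn _
          · exact heatKernel_le_zero hε (t, k - 1)
      _ = (ε * ∑ k ∈ nearSet m, heatKernel ε (t, k)) * heatKernel ε (t, 0) := by
          rw [← Finset.sum_mul]; ring
      _ ≤ (ε * ε⁻¹) * heatKernel ε (t, 0) := by
          gcongr
          · exact hn _
          · exact sum_heatKernel_le hε t _
      _ ≤ _ := by rw [mul_inv_cancel₀ hε.ne', one_mul]; exact h0
  have : ∫ s in (0 : ℝ)..t, ε * ∑ k ∈ nearSet m, gradProduct ε (s, k) =
      (∫ s in (0 : ℝ)..t, (heatFlux ε s (m + 1) - heatFlux ε s (-m)) / 2) -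
      ε * ∑ k ∈ nearSet m, heatExt ε t k * heatExt ε t (k - 1) := by linarith
  rw [this]
  refine (abs_sub _ _).trans ?_
  linarith

/-! ### Commutator estimate and the gain in the difference of the two kernels. -/

lemma wt_anti {ε : ℝ} (hε : 0 < ε) {z z' : Pt} (h : parabolicSize ε z' ≤ parabolicSize ε z) :
    wt ε z ≤ wt ε z' :=
  Real.rpow_le_rpow_of_nonpos (size_add_pos hε z') (by linarith) (by norm_num)

lemma mul_wt_pow_four_le {ε : ℝ} (hε : 0 < ε) (z : Pt) : ε * wt ε z ^ 4 ≤ 1 := by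
  have h1 := wt_pow_four_mul hε z
  have h2 := parabolicSize_nonneg hε.le z
  have h3 := pow_pos (wt_pos hε z) 4
  nlinarith [mul_nonneg h3.le h2]

lemma sqrt_mul_wt_sq_le {ε : ℝ} (hε : 0 < ε) (z : Pt) : Real.sqrt ε * wt ε z ^ 2 ≤ 1 := by
  have h1 := mul_wt_pow_four_le hε z
  have h2 : (Real.sqrt ε * wt ε z ^ 2) ^ 2 ≤ 1 := by
    rw [mul_pow, Real.sq_sqrt hε.le, ← pow_mul]; exact h1
  have h3 := wt_pos hε z
  exact (sq_le_one_iff₀ (by positivity)).1 h2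

lemma sqrt_size_mul_wt_sq_le {ε : ℝ} (hε : 0 < ε) (z : Pt) :
    Real.sqrt (parabolicSize ε z) * wt ε z ^ 2 ≤ 1 := by
  have h1 := wt_pow_four_mul hε z
  have h0 := parabolicSize_nonneg hε.le z
  have h3 := wt_pos hε z
  have h2 : (Real.sqrt (parabolicSize ε z) * wt ε z ^ 2) ^ 2 ≤ 1 := by
    rw [mul_pow, Real.sq_sqrt h0, ← pow_mul]
    have h4 : 0 ≤ wt ε z ^ 4 * ε := by positivity
    linear_combination h1 + h4
  exact (sq_le_one_iff₀ (by positivity)).1 h2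

lemma one_le_of_size_le {ε : ℝ} (hε : 0 < ε) (hε1 : ε ≤ 1) {b : ℝ} {z : Pt}
    (h : parabolicSize ε z ≤ b) : 1 ≤ (b + 1) * wt ε z ^ 4 := by
  have h1 := wt_pow_four_mul hε z
  have h3 := pow_pos (wt_pos hε z) 4
  nlinarith

lemma one_le_of_size_le' {ε : ℝ} (hε : 0 < ε) (hε1 : ε ≤ 1) {b : ℝ} {z : Pt}
    (h : parabolicSize ε z ≤ b) : 1 ≤ (b + 1) ^ 2 * wt ε z ^ 8 := by
  have h1 := one_le_of_size_le hε hε1 h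
  nlinarith

/-- One of `w`, `z - w` has at least half the size of `z`, so ten powers can always be moved to `z`.
-/
lemma wt_mul_wt_le {ε : ℝ} (hε : 0 < ε) (z w : Pt) : wt ε w ^ 14 * wt ε (z - w) ^ 10 ≤
    2 ^ 10 * wt ε z ^ 10 * (wt ε w ^ 14 + wt ε (z - w) ^ 14) := by
  have p1 := wt_pos hε w
  have p2 := wt_pos hε (z - w)
  have p3 := wt_pos hε z
  have htri := parabolicSize_add_le hε.le w (z - w)
  rw [add_sub_cancel] at htri
  have n1 := parabolicSize_nonneg hε.le w
  have n2 := parabolicSize_nonneg hε.le (z - w)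
  rcases le_total (parabolicSize ε w) (parabolicSize ε (z - w)) with h | h
  · have h1 : wt ε (z - w) ≤ 2 * wt ε z := wt_le_two_mul hε (by linarith)
    calc wt ε w ^ 14 * wt ε (z - w) ^ 10 ≤ wt ε w ^ 14 * (2 * wt ε z) ^ 10 := by gcongr
      _ = 2 ^ 10 * wt ε z ^ 10 * (wt ε w ^ 14 + 0) := by ring
      _ ≤ _ := by gcongr; positivity
  · have h1 : wt ε w ≤ 2 * wt ε z := wt_le_two_mul hε (by linarith)
    have h2 : wt ε w ≤ wt ε (z - w) := wt_anti hε h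
    calc wt ε w ^ 14 * wt ε (z - w) ^ 10 = wt ε w ^ 10 * wt ε w ^ 4 * wt ε (z - w) ^ 10 := by ring
      _ ≤ (2 * wt ε z) ^ 10 * wt ε (z - w) ^ 4 * wt ε (z - w) ^ 10 := by gcongr
      _ = 2 ^ 10 * wt ε z ^ 10 * (0 + wt ε (z - w) ^ 14) := by ring
      _ ≤ _ := by gcongr; positivity

lemma mul_wt_pow_eight_le {ε : ℝ} (hε : 0 < ε) (hε1 : ε ≤ 1) (z : Pt) :
    ε * wt ε z ^ 8 ≤ diffWt ε z := by
  have h1 := mul_wt_pow_four_le hε z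
  have h2 := wt_pos hε z
  have h3 : ε ≤ Real.sqrt ε := Real.le_sqrt_of_sq_le (by nlinarith)
  unfold diffWt
  rcases le_total 1 (wt ε z) with h | h
  · have h4 : wt ε z ^ 8 ≤ wt ε z ^ 10 := pow_le_pow_right₀ h (by norm_num)
    have : ε * wt ε z ^ 8 ≤ Real.sqrt ε * wt ε z ^ 10 := by gcongr
    linarith
  · have h4 : wt ε z ^ 8 ≤ 1 := pow_le_one₀ h2.le h
    have : 0 ≤ Real.sqrt ε * wt ε z ^ 10 := by positivity
    nlinarith

lemma KernelBound.grad_eq_zero {ε c A : ℝ} {K : Pt → ℝ} (hε : 0 < ε) (hK : KernelBound ε c A K)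
    (s : Bool) {z : Pt} (hz : c + ε < parabolicSize ε z) : grad ε s K z = 0 := by
  have h0 : K z = 0 := hK.eq_zero_of_lt z (by linarith)
  have h1 : K (z.1, z.2 + 1) = 0 := by
    refine hK.eq_zero_of_lt _ ?_
    have := parabolicSize_shift_le hε.le z.1 (z.2 + 1) (-1)
    simp only [add_neg_cancel_right, Int.cast_neg, Int.cast_one, abs_neg, abs_one, mul_one,
      Prod.mk.eta] at this
    linarith
  have h2 : K (z.1, z.2 - 1) = 0 := by
    refine hK.eq_zero_of_lt _ ?_
    have := parabolicSize_shift_le hε.le z.1 (z.2 - 1) 1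
    simp only [sub_add_cancel, Int.cast_one, abs_one, mul_one, Prod.mk.eta] at this
    linarith
  cases s <;> simp [grad, h0, h1, h2]

lemma grad_of_neg {ε : ℝ} {u : Pt → ℝ} (hu : ∀ z : Pt, z.1 < 0 → u z = 0) (s : Bool) {z : Pt}
    (hz : z.1 < 0) : grad ε s u z = 0 := by
  cases s <;> simp [grad, hu z hz, hu (z.1, z.2 + 1) hz, hu (z.1, z.2 - 1) hz]

/-- Commutator estimate for the convolution of `∇⁻G ∇⁺G` with the gradient of a kernel. -/
lemma abs_setIntegral_commutator_le (A D : ℝ) (hA : 0 ≤ A) (hD : 0 ≤ D) :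
    ∃ B : ℝ, 0 ≤ B ∧ ∀ (ε c : ℝ) (K : Pt → ℝ), 0 < ε → KernelBound ε c A K →
      ∀ (z : Pt) (F : Set ℤ), 0 ≤ z.1 →
      (∀ w : Pt, w.1 ∈ Set.Icc 0 z.1 → w.2 ∈ F → |gradProduct ε w| ≤ D * wt ε w ^ 16) →
      ε * |∫ w in Set.Icc 0 z.1 ×ˢ F, gradProduct ε w *
        (grad ε false K (z - w) - grad ε false K z) ∂(gridMeasure ε)| ≤
        B * (Real.sqrt ε * wt ε z ^ 10) := by
  obtain ⟨C₁, hC₁, h₁⟩ := lintegral_wt_pow_le (n := 14) (by norm_num)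
  refine ⟨D * A * (2 ^ 10 * 2 + 1) * C₁, by positivity, fun ε c K hε hK z F hz hQ => ?_⟩
  have hm := measurable_wt ε
  have hqz := wt_pos hε z
  have hF : MeasurableSet (Set.Icc 0 z.1 ×ˢ F) := measurableSet_Icc.prod (Set.to_countable F).measurableSet
  have hpt : ∀ w ∈ Set.Icc 0 z.1 ×ˢ F,
      |gradProduct ε w * (grad ε false K (z - w) - grad ε false K z)| ≤
      D * A * (2 ^ 10 + 1) * wt ε z ^ 10 * wt ε w ^ 14 +
        D * A * 2 ^ 10 * wt ε z ^ 10 * wt ε (z - w) ^ 14 := by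
    intro w hw
    have hqw := wt_pos hε w
    have hqzw := wt_pos hε (z - w)
    have h0 : 0 ≤ (z - w).1 := by simpa using hw.1.2
    -- The increment of the gradient gives `√‖w‖`, which removes two of the sixteen powers of the
    -- weight at `w`.
    have h1 := hK.holder (z - w) z h0 hz
    rw [sub_sub_cancel_left, parabolicSize_neg] at h1
    rw [abs_mul]
    calc _ ≤ (D * wt ε w ^ 16) * (A * Real.sqrt (parabolicSize ε w) *
          (wt ε (z - w) ^ 10 + wt ε z ^ 10)) :=
          mul_le_mul (hQ w hw.1 hw.2) h1 (abs_nonneg _) (by positivity)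
      _ = D * A * (Real.sqrt (parabolicSize ε w) * wt ε w ^ 2) *
          (wt ε w ^ 14 * wt ε (z - w) ^ 10 + wt ε z ^ 10 * wt ε w ^ 14) := by ring
      _ ≤ D * A * 1 * (2 ^ 10 * wt ε z ^ 10 * (wt ε w ^ 14 + wt ε (z - w) ^ 14) +
          wt ε z ^ 10 * wt ε w ^ 14) :=
          mul_le_mul (mul_le_mul_of_nonneg_left (sqrt_size_mul_wt_sq_le hε w) (by positivity))
            (add_le_add (wt_mul_wt_le hε z w) le_rfl) (by positivity) (by positivity)
      _ = _ := by ring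
  have hl : ∫⁻ w in Set.Icc 0 z.1 ×ˢ F, ENNReal.ofReal |gradProduct ε w *
        (grad ε false K (z - w) - grad ε false K z)| ∂(gridMeasure ε) ≤
      ENNReal.ofReal (D * A * (2 ^ 10 + 1) * wt ε z ^ 10 * (C₁ * ε ^ (3 - ((14 : ℕ) : ℝ) / 4)) +
        D * A * 2 ^ 10 * wt ε z ^ 10 * (C₁ * ε ^ (3 - ((14 : ℕ) : ℝ) / 4))) := by
    calc _ ≤ ∫⁻ w in Set.Icc 0 z.1 ×ˢ F,
          (ENNReal.ofReal (D * A * (2 ^ 10 + 1) * wt ε z ^ 10) * ENNReal.ofReal (wt ε w ^ 14) +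
          ENNReal.ofReal (D * A * 2 ^ 10 * wt ε z ^ 10) * ENNReal.ofReal (wt ε (z - w) ^ 14))
          ∂(gridMeasure ε) := by
          refine setLIntegral_mono' hF fun w hw => ?_
          rw [← ENNReal.ofReal_mul (by positivity), ← ENNReal.ofReal_mul (by positivity)]
          exact (ENNReal.ofReal_le_ofReal (hpt w hw)).trans ENNReal.ofReal_add_le
      _ ≤ ∫⁻ w,
          (ENNReal.ofReal (D * A * (2 ^ 10 + 1) * wt ε z ^ 10) * ENNReal.ofReal (wt ε w ^ 14) +
          ENNReal.ofReal (D * A * 2 ^ 10 * wt ε z ^ 10) * ENNReal.ofReal (wt ε (z - w) ^ 14))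
          ∂(gridMeasure ε) := setLIntegral_le_lintegral _ _
      _ ≤ _ := by
          rw [lintegral_add_left (by fun_prop), lintegral_const_mul _ (by fun_prop),
            lintegral_const_mul _ (by fun_prop),
            lintegral_sub_left_eq_self (fun w => ENNReal.ofReal (wt ε w ^ 14)),
            ENNReal.ofReal_add (by positivity) (by positivity), ENNReal.ofReal_mul
            (p := D * A * (2 ^ 10 + 1) * wt ε z ^ 10) (by positivity), ENNReal.ofReal_mul
            (p := D * A * 2 ^ 10 * wt ε z ^ 10) (by positivity)]
          gcongr
          · exact h₁ ε hε
          · exact h₁ ε hε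
  have h3 : |∫ w in Set.Icc 0 z.1 ×ˢ F, gradProduct ε w *
        (grad ε false K (z - w) - grad ε false K z) ∂(gridMeasure ε)| ≤
      D * A * (2 ^ 10 + 1) * wt ε z ^ 10 * (C₁ * ε ^ (3 - ((14 : ℕ) : ℝ) / 4)) +
        D * A * 2 ^ 10 * wt ε z ^ 10 * (C₁ * ε ^ (3 - ((14 : ℕ) : ℝ) / 4)) :=
    (norm_integral_le_lintegral_norm (fun w => gradProduct ε w *
        (grad ε false K (z - w) - grad ε false K z))).trans
      (ENNReal.toReal_le_of_le_ofReal (by positivity) hl)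
  -- The integral of `wt ^ 14` costs `ε^(-1/2)`; with the prefactor `ε`, a net gain of `√ε` is left.
  have h4 : ε * ε ^ (3 - ((14 : ℕ) : ℝ) / 4) = Real.sqrt ε := by
    rw [Real.sqrt_eq_rpow]
    nth_rw 1 [← Real.rpow_one ε]
    rw [← Real.rpow_add hε]; norm_num
  refine (mul_le_mul_of_nonneg_left h3 hε.le).trans (le_of_eq ?_)
  linear_combination (D * A * (2 ^ 10 * 2 + 1) * wt ε z ^ 10 * C₁) * h4

/-- The gradient of a singular part of `G̃` times the total mass of `ε ∇⁻G ∇⁺G` up to the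
current time. -/
lemma mul_abs_grad_mul_wt_le {ε c A C : ℝ} {Kt Rt : Pt → ℝ} (hε : 0 < ε) (hA : 0 ≤ A)
    (hC : 0 ≤ C) (hK : KernelBound ε c A Kt) (hR : RegularBound ε C Rt)
    (hu : ∀ z : Pt, 0 ≤ z.1 → tildeHeatKernel ε z = Kt z + Rt z) (z : Pt) (hz : 0 ≤ z.1) :
    ε * |grad ε false Kt z| * wt ε (z.1, 0) ^ 4 ≤ (C + A * 2 ^ 11) * diffWt ε z := by
  have hq := wt_pos hε z
  have hq0 := wt_pos hε (z.1, 0)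
  have hd := diffWt_pos hε z
  have hd1 : 1 ≤ diffWt ε z := by
    unfold diffWt
    have : 0 ≤ Real.sqrt ε * wt ε z ^ 10 := by positivity
    linarith
  have hd2 : Real.sqrt ε * wt ε z ^ 10 ≤ diffWt ε z := by unfold diffWt; linarith
  have hse := Real.sqrt_nonneg ε
  have hsq : ε = Real.sqrt ε * Real.sqrt ε := (Real.mul_self_sqrt hε.le).symm
  -- Near the time axis, `(t, 0)` and `z` have comparable size. Away from it the gradient of `G̃`
  -- starts from zero, and its growth from time zero is measured by the Hölder bound.
  rcases le_or_gt (ε * |(z.2 : ℝ)|) (max (Real.sqrt |z.1|) ε) with h | h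
  · have h1 : wt ε (z.1, 0) ≤ 2 * wt ε z := by
      refine wt_le_two_mul hε ?_
      have h2 := Real.sqrt_nonneg |z.1|
      have h3 : max (Real.sqrt |z.1|) ε ≤ Real.sqrt |z.1| + ε :=
        max_le (by linarith) (by linarith)
      unfold parabolicSize
      simp only [Int.cast_zero, abs_zero, mul_zero, add_zero]
      linarith
    calc ε * |grad ε false Kt z| * wt ε (z.1, 0) ^ 4
        ≤ ε * (A * wt ε z ^ 8) * (2 * wt ε z) ^ 4 := by
          gcongr
          exact hK.grad_bound false z
      _ = 16 * A * (Real.sqrt ε * wt ε z ^ 2) * (Real.sqrt ε * wt ε z ^ 10) := by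
          nth_rw 1 [hsq]; ring
      _ ≤ 16 * A * 1 * diffWt ε z := by
          gcongr
          exact sqrt_mul_wt_sq_le hε z
      _ ≤ _ := by nlinarith [mul_nonneg hC hd.le, mul_nonneg hA hd.le]
  · have hz2 : 1 < |z.2| := by
      have h1 : ε < ε * |(z.2 : ℝ)| := (le_max_right _ _).trans_lt h
      have h2 : 1 < |(z.2 : ℝ)| := by
        by_contra hcon; push Not at hcon
        nlinarith
      exact_mod_cast h2
    have h0 : z.2 ≠ 0 := by rintro h; rw [h] at hz2; simp at hz2
    have h1 : z.2 - 1 ≠ 0 := by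
      intro h; rw [show z.2 = 1 by omega] at hz2; simp at hz2
    have hinit : |grad ε false Kt (0, z.2)| ≤ C := by
      have e1 := grad_eq_of_decomposition (ε := ε) hu false (0, z.2) le_rfl
      have e2 : grad ε false (tildeHeatKernel ε) (0, z.2) = 0 := by
        rw [grad_false_eq, tildeHeatKernel_zero hε, tildeHeatKernel_zero hε, heatKernel_zero hε,
          heatKernel_zero hε]
        simp only
        rw [if_neg h0, if_neg h1]; simp
      have e3 : grad ε false Kt (0, z.2) = -grad ε false Rt (0, z.2) := by linarith
      rw [e3, abs_neg]
      exact hR.grad_bound _ le_rfl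
    have hhol := hK.holder z (0, z.2) hz le_rfl
    have e4 : z - (0, z.2) = (z.1, 0) := by ext <;> simp
    rw [e4] at hhol
    have hq2 : wt ε (0, z.2) ≤ 2 * wt ε z := by
      refine wt_le_two_mul hε ?_
      have h3 : Real.sqrt |z.1| < ε * |(z.2 : ℝ)| := (le_max_left _ _).trans_lt h
      have h4 : 0 ≤ ε * |(z.2 : ℝ)| := by positivity
      have h5 := Real.sqrt_nonneg |z.1|
      unfold parabolicSize
      simp only [abs_zero, Real.sqrt_zero, zero_add]
      linarith
    have hq3 := wt_pos hε (0, z.2)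
    have hφ : |grad ε false Kt z| ≤ C + A * Real.sqrt (parabolicSize ε (z.1, 0)) *
        (2 ^ 11 * wt ε z ^ 10) := by
      have e5 := abs_sub_abs_le_abs_sub (grad ε false Kt z) (grad ε false Kt (0, z.2))
      have e6 : wt ε z ^ 10 + wt ε (0, z.2) ^ 10 ≤ 2 ^ 11 * wt ε z ^ 10 := by
        have e7 : wt ε (0, z.2) ^ 10 ≤ (2 * wt ε z) ^ 10 := by gcongr
        have e8 : 0 ≤ wt ε z ^ 10 := by positivity
        rw [mul_pow] at e7
        linarith
      have e9 : A * Real.sqrt (parabolicSize ε (z.1, 0)) * (wt ε z ^ 10 + wt ε (0, z.2) ^ 10) ≤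
          A * Real.sqrt (parabolicSize ε (z.1, 0)) * (2 ^ 11 * wt ε z ^ 10) := by gcongr
      linarith
    calc ε * |grad ε false Kt z| * wt ε (z.1, 0) ^ 4
        ≤ ε * (C + A * Real.sqrt (parabolicSize ε (z.1, 0)) * (2 ^ 11 * wt ε z ^ 10)) *
          wt ε (z.1, 0) ^ 4 := by gcongr
      _ = C * (ε * wt ε (z.1, 0) ^ 4) + A * 2 ^ 11 *
          (Real.sqrt (parabolicSize ε (z.1, 0)) * wt ε (z.1, 0) ^ 2) *
          (Real.sqrt ε * wt ε (z.1, 0) ^ 2) * (Real.sqrt ε * wt ε z ^ 10) := by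
          linear_combination (A * 2 ^ 11 * Real.sqrt (parabolicSize ε (z.1, 0)) * wt ε z ^ 10 *
            wt ε (z.1, 0) ^ 4) * hsq
      _ ≤ C * 1 + A * 2 ^ 11 * 1 * 1 * diffWt ε z := by
          gcongr
          · exact mul_wt_pow_four_le hε _
          · exact sqrt_size_mul_wt_sq_le hε _
          · exact sqrt_mul_wt_sq_le hε _
      _ ≤ _ := by nlinarith

lemma one_le_diffWt {ε : ℝ} (hε : 0 < ε) (z : Pt) : 1 ≤ diffWt ε z := by
  have := wt_pos hε z
  unfold diffWt
  have : 0 ≤ Real.sqrt ε * wt ε z ^ 10 := by positivity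
  linarith

lemma sqrt_mul_wt_pow_ten_le {ε : ℝ} (z : Pt) : Real.sqrt ε * wt ε z ^ 10 ≤ diffWt ε z := by
  unfold diffWt; linarith

lemma wt_le_rpow {ε : ℝ} (hε : 0 < ε) (z : Pt) : wt ε z ≤ ε ^ (-(1 / 4) : ℝ) :=
  Real.rpow_le_rpow_of_nonpos hε (by linarith [parabolicSize_nonneg hε.le z]) (by norm_num)

lemma measurable_grad_cut {ε : ℝ} {u : Pt → ℝ}
    (hu : Measurable fun z : Pt => if z.1 < 0 then 0 else u z) (s : Bool) :
    Measurable fun z : Pt => if z.1 < 0 then 0 else grad ε s u z := by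
  refine (congrArg Measurable (funext fun z => ?_)).mp (measurable_grad (ε := ε) hu s)
  cases s <;> simp only [grad] <;> split_ifs <;> simp_all

/-- The kernels `G̃` and `G` differ by a kernel of better regularity. -/
lemma exists_abs_grad_tildeHeatKernel_sub_le (c A C c₁ : ℝ) (hA : 0 ≤ A) (hC : 0 ≤ C)
    (hc : 0 ≤ c) (hc₁ : 0 ≤ c₁) :
    ∃ B : ℝ, 0 ≤ B ∧ ∀ (ε : ℝ) (K R Kt Rt : Pt → ℝ), 0 < ε → ε ≤ 1 →
      KernelBound ε c A K → RegularBound ε C R →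
      (∀ z : Pt, 0 ≤ z.1 → heatKernel ε z = K z + R z) →
      KernelBound ε c A Kt → RegularBound ε C Rt →
      (∀ z : Pt, 0 ≤ z.1 → tildeHeatKernel ε z = Kt z + Rt z) →
      ∀ z : Pt, 0 ≤ z.1 → parabolicSize ε z ≤ c₁ →
        |grad ε false (tildeHeatKernel ε) z - grad ε false (heatKernel ε) z| ≤ B * diffWt ε z := by
  obtain ⟨B₁, hB₁, h₁⟩ := mul_setIntegral_abs_gradProduct_le A C hA hC
  -- Within distance `2 c₁ + c + 4` the bounded part of `∇G` is absorbed by the weight, `1 ≤ (2 c₁ +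
  -- c + 5)² wt⁸`; squaring gives the constant for the product.
  obtain ⟨B₂, hB₂, h₂⟩ := abs_setIntegral_commutator_le A ((A + C * (2 * c₁ + c + 5) ^ 2) ^ 2) hA
    (by positivity)
  refine ⟨2 * (C * (B₁ * (1 + c₁ ^ 2)) + (B₂ + (A * (C + A * 2 ^ 11) +
    (C + 2 * C ^ 2 * c₁ ^ 2) * A))), by positivity, ?_⟩
  intro ε K R Kt Rt hε hε1 hK hR hu hKt hRt hut z hz hzc
  have hd := one_le_diffWt hε z
  have hq := wt_pos hε z
  set T := z.1 with hT
  have hsT : Real.sqrt T ≤ c₁ := by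
    have : 0 ≤ ε * |(z.2 : ℝ)| := by positivity
    unfold parabolicSize at hzc
    rw [← hT, abs_of_nonneg hz] at hzc
    linarith
  have hT1 : T ≤ c₁ ^ 2 := (Real.sqrt_le_left hc₁).1 hsT
  -- The window is large enough to contain every `w` with `∇K̃(z - w) ≠ 0`, and small enough for the
  -- singular bound on `Q` to hold throughout.
  obtain ⟨m, hm1, hm2⟩ : ∃ m : ℕ, c₁ + c + 3 ≤ ε * m ∧ ε * m ≤ c₁ + c + 4 := by
    refine ⟨⌈(c₁ + c + 3) / ε⌉₊, ?_, ?_⟩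
    · have := Nat.le_ceil ((c₁ + c + 3) / ε)
      rw [div_le_iff₀ hε] at this; linarith
    · have := (Nat.ceil_lt_add_one (show 0 ≤ (c₁ + c + 3) / ε by positivity)).le
      calc ε * _ ≤ ε * ((c₁ + c + 3) / ε + 1) := by gcongr
        _ = c₁ + c + 3 + ε := by field_simp
        _ ≤ _ := by linarith
  set S : Set Pt := Set.Icc 0 T ×ˢ (Set.univ : Set ℤ) with hS
  set N : Set Pt := Set.Icc 0 T ×ˢ (nearSet m : Set ℤ) with hN
  have hSm : MeasurableSet S := measurableSet_slab _ measurableSet_Icc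
  have hNm : MeasurableSet N := measurableSet_Icc.prod (Set.to_countable _).measurableSet
  have hNS : N ⊆ S := Set.prod_mono le_rfl (Set.subset_univ _)
  have hpos : ∀ w ∈ S, 0 ≤ (z - w).1 := fun w hw => by simpa using hw.1.2
  have hmt := measurable_cut_of_decomposition hKt hRt hut
  have hφ : Measurable fun w : Pt => if w.1 < 0 then 0 else grad ε false Kt w :=
    measurable_grad_cut ((congrArg Measurable (funext fun w => by
      split_ifs with h
      · exact hKt.eq_zero_of_neg w h
      · rfl)).mp hKt.measurable) false
  have hψ := measurable_grad_cut (ε := ε) hRt.measurable_cut false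
  have hiφ : IntegrableOn (fun w => gradProduct ε w * grad ε false Kt (z - w)) S (gridMeasure ε) :=
    integrableOn_gradProduct_mul hε (B := A * (ε ^ (-(1 / 4) : ℝ)) ^ 8) hφ (fun w _ _ =>
      (hKt.grad_bound false w).trans (by
        have := wt_pos hε w
        gcongr
        exact wt_le_rpow hε w)) z.2
  have hiψ : IntegrableOn (fun w => gradProduct ε w * grad ε false Rt (z - w)) S (gridMeasure ε) :=
    integrableOn_gradProduct_mul hε (B := C) hψ (fun w h0 _ => hRt.grad_bound w h0) z.2
  have e1 := grad_tildeHeatKernel_eq hε hmt z hz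
  have e2 : ∫ w in S, gradProduct ε w * grad ε false (tildeHeatKernel ε) (z - w) ∂(gridMeasure ε) =
      (∫ w in S, gradProduct ε w * grad ε false Kt (z - w) ∂(gridMeasure ε)) +
      ∫ w in S, gradProduct ε w * grad ε false Rt (z - w) ∂(gridMeasure ε) := by
    rw [← integral_add hiφ hiψ]
    refine setIntegral_congr_fun hSm fun w hw => ?_
    rw [grad_eq_of_decomposition hut false _ (hpos w hw)]
    ring
  have e3 : ∫ w in S, gradProduct ε w * grad ε false Kt (z - w) ∂(gridMeasure ε) =
      ∫ w in N, gradProduct ε w * grad ε false Kt (z - w) ∂(gridMeasure ε) := by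
    refine setIntegral_eq_of_subset_of_forall_sdiff_eq_zero hSm hNS fun w hw => ?_
    have h3 : w.2 ∉ nearSet m := fun h => hw.2 ⟨hw.1.1, h⟩
    rw [mem_nearSet, not_le] at h3
    have h4 : (m : ℝ) < |(w.2 : ℝ)| := by exact_mod_cast h3
    have h5 : ε * m < ε * |(w.2 : ℝ)| := by gcongr
    have h6 : ε * |(w.2 : ℝ)| ≤ parabolicSize ε w := by
      unfold parabolicSize; linarith [Real.sqrt_nonneg |w.1|]
    have h7 : ε * |(w.2 : ℝ)| ≤ ε * |((z - w).2 : ℝ)| + ε * |(z.2 : ℝ)| := by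
      rw [← mul_add]
      refine mul_le_mul_of_nonneg_left ?_ hε.le
      have := abs_sub (z.2 : ℝ) ((z - w).2 : ℝ)
      simp only [Prod.snd_sub, Int.cast_sub, sub_sub_cancel] at this ⊢
      linarith
    have h8 : ε * |((z - w).2 : ℝ)| ≤ parabolicSize ε (z - w) := by
      unfold parabolicSize; linarith [Real.sqrt_nonneg |(z - w).1|]
    have h9 : ε * |(z.2 : ℝ)| ≤ c₁ := by
      refine le_trans ?_ hzc
      unfold parabolicSize; linarith [Real.sqrt_nonneg |z.1|]
    rw [hKt.grad_eq_zero hε false (by linarith), mul_zero]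
  have hiQ : IntegrableOn (gradProduct ε) N (gridMeasure ε) :=
    (integrableOn_gradProduct hε T).mono_set hNS
  -- The value at `z` is subtracted: a commutator remains, together with `∇K̃(z)` times the signed
  -- mass of `Q`.
  have e4 : ∫ w in N, gradProduct ε w * grad ε false Kt (z - w) ∂(gridMeasure ε) =
      (∫ w in N, gradProduct ε w * (grad ε false Kt (z - w) - grad ε false Kt z) ∂(gridMeasure ε)) +
      grad ε false Kt z * ∫ w in N, gradProduct ε w ∂(gridMeasure ε) := by
    rw [← integral_const_mul, ← integral_add _ (hiQ.const_mul _)]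
    · refine integral_congr_ae (Filter.Eventually.of_forall fun w => ?_)
      simp only; ring
    · refine ((hiφ.mono_set hNS).sub (hiQ.mul_const (grad ε false Kt z))).congr
        (Filter.Eventually.of_forall fun w => ?_)
      simp only [Pi.sub_apply]; ring
  have b1 : ε * |∫ w in S, gradProduct ε w * grad ε false Rt (z - w) ∂(gridMeasure ε)| ≤
      C * (B₁ * (1 + c₁ ^ 2)) := by
    have h3 : |∫ w in S, gradProduct ε w * grad ε false Rt (z - w) ∂(gridMeasure ε)| ≤
        ∫ w in S, C * |gradProduct ε w| ∂(gridMeasure ε) := by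
      refine (Real.norm_eq_abs _).symm.trans_le <| norm_integral_le_of_norm_le ((integrableOn_gradProduct hε T).abs.const_mul C)
        ((ae_restrict_iff' hSm).2 (Filter.Eventually.of_forall fun w hw => ?_))
      rw [Real.norm_eq_abs, abs_mul, mul_comm]
      exact mul_le_mul_of_nonneg_right (hRt.grad_bound _ (hpos w hw)) (abs_nonneg _)
    rw [integral_const_mul] at h3
    have h4 := h₁ ε c K R hε hK hR hu T hz
    calc _ ≤ ε * (C * ∫ w in S, |gradProduct ε w| ∂(gridMeasure ε)) := by gcongr
      _ = C * (ε * ∫ w in S, |gradProduct ε w| ∂(gridMeasure ε)) := by ring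
      _ ≤ C * (B₁ * (1 + T)) := by gcongr
      _ ≤ _ := by gcongr
  have b2 := h₂ ε c Kt hε hKt z (nearSet m) hz (by
    intro w hw1 hw2
    have h3 : parabolicSize ε w ≤ 2 * c₁ + c + 4 := by
      have h4 : |(w.2 : ℝ)| ≤ m := by exact_mod_cast mem_nearSet.1 hw2
      have h5 : ε * |(w.2 : ℝ)| ≤ ε * m := by gcongr
      have h6 : Real.sqrt |w.1| ≤ c₁ := by
        rw [abs_of_nonneg hw1.1]
        exact (Real.sqrt_le_sqrt hw1.2).trans hsT
      unfold parabolicSize; linarith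
    have h4 := one_le_of_size_le' hε hε1 h3
    have h5 : ∀ s, |grad ε s (heatKernel ε) w| ≤ (A + C * (2 * c₁ + c + 5) ^ 2) * wt ε w ^ 8 := by
      intro s
      refine (abs_grad_le_of_decomposition hK hR hu s w hw1.1).trans ?_
      have := mul_le_mul_of_nonneg_left h4 hC
      linear_combination this
    have hw := wt_pos hε w
    unfold gradProduct
    rw [abs_mul]
    calc _ ≤ ((A + C * (2 * c₁ + c + 5) ^ 2) * wt ε w ^ 8) *
          ((A + C * (2 * c₁ + c + 5) ^ 2) * wt ε w ^ 8) :=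
          mul_le_mul (h5 false) (h5 true) (abs_nonneg _) (by positivity)
      _ = _ := by ring)
  -- The singular part of the mass is paired with `∇K̃(z)`; its bounded part needs only `ε wt⁸ ≤
  -- diffWt`.
  have b3 : ε * |grad ε false Kt z * ∫ w in N, gradProduct ε w ∂(gridMeasure ε)| ≤
      (A * (C + A * 2 ^ 11) + (C + 2 * C ^ 2 * c₁ ^ 2) * A) * diffWt ε z := by
    have h3 := abs_setIntegral_gradProduct_near_le hε hC hK hR hu (m := m) (by linarith) hz
    have h4 := mul_abs_grad_mul_wt_le hε hA hC hKt hRt hut z hz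
    have h5 := hKt.grad_bound false z
    have h6 := mul_wt_pow_eight_le hε hε1 z
    rw [abs_mul]
    calc _ ≤ ε * (|grad ε false Kt z| * (A * wt ε (T, 0) ^ 4 + C + 2 * C ^ 2 * T)) := by gcongr
      _ = A * (ε * |grad ε false Kt z| * wt ε (T, 0) ^ 4) +
          (C + 2 * C ^ 2 * T) * (ε * |grad ε false Kt z|) := by ring
      _ ≤ A * ((C + A * 2 ^ 11) * diffWt ε z) +
          (C + 2 * C ^ 2 * c₁ ^ 2) * (ε * (A * wt ε z ^ 8)) := by gcongr
      _ = A * ((C + A * 2 ^ 11) * diffWt ε z) +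
          (C + 2 * C ^ 2 * c₁ ^ 2) * A * (ε * wt ε z ^ 8) := by ring
      _ ≤ A * ((C + A * 2 ^ 11) * diffWt ε z) +
          (C + 2 * C ^ 2 * c₁ ^ 2) * A * diffWt ε z := by gcongr
      _ = _ := by ring
  have hs1 : Real.sqrt ε ≤ 1 := Real.sqrt_le_one.2 hε1
  rw [e1, e2, e3, e4, sub_sub_cancel_left, abs_neg, abs_mul, abs_mul, abs_of_pos hε,
    abs_of_nonneg (by positivity : 0 ≤ 1 + Real.sqrt ε)]
  have b4 := (abs_add_le ((∫ w in N, gradProduct ε w * (grad ε false Kt (z - w) - grad ε false Kt z)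
    ∂(gridMeasure ε)) + grad ε false Kt z * ∫ w in N, gradProduct ε w ∂(gridMeasure ε))
    (∫ w in S, gradProduct ε w * grad ε false Rt (z - w) ∂(gridMeasure ε))).trans
    (add_le_add (abs_add_le _ _) le_rfl)
  set I₁ := |∫ w in N, gradProduct ε w * (grad ε false Kt (z - w) - grad ε false Kt z)
    ∂(gridMeasure ε)|
  set I₂ := |grad ε false Kt z * ∫ w in N, gradProduct ε w ∂(gridMeasure ε)|
  set I₃ := |∫ w in S, gradProduct ε w * grad ε false Rt (z - w) ∂(gridMeasure ε)|
  have b5 := b2.trans (mul_le_mul_of_nonneg_left (sqrt_mul_wt_pow_ten_le (ε := ε) z) hB₂)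
  have b6 : C * (B₁ * (1 + c₁ ^ 2)) ≤ C * (B₁ * (1 + c₁ ^ 2)) * diffWt ε z :=
    le_mul_of_one_le_right (by positivity) hd
  calc _ ≤ ε * (1 + 1) * (I₁ + I₂ + I₃) := by gcongr
    _ = 2 * (ε * I₁ + ε * I₂ + ε * I₃) := by ring
    _ ≤ 2 * (B₂ * diffWt ε z + (A * (C + A * 2 ^ 11) + (C + 2 * C ^ 2 * c₁ ^ 2) * A) * diffWt ε z +
        C * (B₁ * (1 + c₁ ^ 2)) * diffWt ε z) := by
        have := b1.trans b6
        linarith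
    _ = _ := by ring

/-! ### Integrability of singular parts. -/

lemma integrable_of_abs_le_locWt {ε B b : ℝ} {g : Pt → ℝ} (hε : 0 < ε) (hε1 : ε ≤ 1)
    (hg : Measurable g) (h : ∀ z, |g z| ≤ B * locWt ε b z) : Integrable g (gridMeasure ε) := by
  obtain ⟨C, -, hC⟩ := lintegral_locWt_le b
  have hl : Integrable (locWt ε b) (gridMeasure ε) := by
    refine ⟨(measurable_locWt ε b).aestronglyMeasurable, ?_⟩
    rw [hasFiniteIntegral_iff_norm]
    simp_rw [Real.norm_of_nonneg (locWt_nonneg hε b _)]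
    exact (hC ε hε hε1).trans_lt ENNReal.ofReal_lt_top
  exact (hl.const_mul B).mono' hg.aestronglyMeasurable (Filter.Eventually.of_forall h)

lemma exists_integral_abs_le_of_locWt (b : ℝ) : ∃ C : ℝ, 0 ≤ C ∧ ∀ (ε B : ℝ) (g : Pt → ℝ), 0 < ε →
    ε ≤ 1 → 0 ≤ B → (∀ z, |g z| ≤ B * locWt ε b z) →
    ∫ z, |g z| ∂(gridMeasure ε) ≤ B * C := by
  obtain ⟨C, hC0, hC⟩ := lintegral_locWt_le b
  refine ⟨C, hC0, fun ε B g hε hε1 hB h => ?_⟩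
  refine (le_abs_self _).trans ((norm_integral_le_lintegral_norm (fun w => |g w|)).trans ?_)
  refine ENNReal.toReal_le_of_le_ofReal (by positivity) ?_
  rw [ENNReal.ofReal_mul hB]
  calc _ ≤ ∫⁻ z, ENNReal.ofReal B * ENNReal.ofReal (locWt ε b z) ∂(gridMeasure ε) := by
        refine lintegral_mono fun z => ?_
        rw [← ENNReal.ofReal_mul hB, norm_abs_eq_norm]
        exact ENNReal.ofReal_le_ofReal (h z)
    _ ≤ _ := by
        rw [lintegral_const_mul _ (measurable_locWt ε b).ennreal_ofReal]
        gcongr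
        exact hC ε hε hε1

namespace KernelBound

variable {ε c A C : ℝ} {K R : Pt → ℝ}

lemma abs_le_locWt (hK : KernelBound ε c A K) (hε : 0 < ε) (hε1 : ε ≤ 1) (hA : 0 ≤ A) (z : Pt) :
    |K z| ≤ A * (c + 1) * locWt ε c z := by
  unfold locWt
  split_ifs with h
  · have h1 := one_le_of_size_le hε hε1 h
    have h2 := wt_pos hε z
    calc _ ≤ A * wt ε z ^ 4 := hK.bound z
      _ ≤ A * wt ε z ^ 4 * ((c + 1) * wt ε z ^ 4) := le_mul_of_one_le_right (by positivity) h1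
      _ = _ := by ring
  · rw [hK.eq_zero_of_lt z (not_le.1 h)]; simp

lemma abs_grad_le_locWt (hK : KernelBound ε c A K) (hε : 0 < ε) (hε1 : ε ≤ 1) (s : Bool) (z : Pt) :
    |grad ε s K z| ≤ A * locWt ε (c + 1) z := by
  unfold locWt
  split_ifs with h
  · exact hK.grad_bound s z
  · rw [hK.grad_eq_zero hε s (by linarith)]; simp

lemma integrable (hK : KernelBound ε c A K) (hε : 0 < ε) (hε1 : ε ≤ 1) (hA : 0 ≤ A) :
    Integrable K (gridMeasure ε) :=
  integrable_of_abs_le_locWt hε hε1 hK.measurable (hK.abs_le_locWt hε hε1 hA)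

lemma integrable_grad (hK : KernelBound ε c A K) (hε : 0 < ε) (hε1 : ε ≤ 1) (s : Bool) :
    Integrable (grad ε s K) (gridMeasure ε) :=
  integrable_of_abs_le_locWt hε hε1 (measurable_grad hK.measurable s)
    (hK.abs_grad_le_locWt hε hε1 s)

lemma abs_grad_le_const (hK : KernelBound ε c A K) (hε : 0 < ε) (hA : 0 ≤ A) (s : Bool) (z : Pt) :
    |grad ε s K z| ≤ A * (ε ^ (-(1 / 4) : ℝ)) ^ 8 := by
  refine (hK.grad_bound s z).trans ?_
  have := wt_pos hε z
  gcongr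
  exact wt_le_rpow hε z

lemma integrable_pairingIntegrand (hK : KernelBound ε c A K) (hε : 0 < ε) (hε1 : ε ≤ 1)
    (hA : 0 ≤ A) (l₁ l₂ : Bool) (z₁ z₂ : Pt) :
    Integrable (pairingIntegrand ε K l₁ l₂ z₁ z₂) (gridMeasure ε) :=
  Integrable.bdd_mul (c := A * (ε ^ (-(1 / 4) : ℝ)) ^ 8)
    ((hK.integrable_grad hε hε1 l₂).comp_sub_left z₂)
    ((measurable_grad hK.measurable l₁).comp (measurable_const.sub measurable_id)).aestronglyMeasurable
    (Filter.Eventually.of_forall fun _ => hK.abs_grad_le_const hε hA l₁ _)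

end KernelBound

/-! ### The correlation of two noises and its comparison with the kernel. -/

/-- The correlation `∫ ∇⁻K(z + w) ∇⁻K(w) dw`. -/
def corr (ε : ℝ) (K : Pt → ℝ) (z : Pt) : ℝ := pairing ε K false false z 0

lemma corr_eq (ε : ℝ) (K : Pt → ℝ) (z : Pt) :
    corr ε K z = ∫ w, grad ε false K (z + w) * grad ε false K w ∂(gridMeasure ε) := by
  unfold corr pairing pairingIntegrand
  rw [← integral_neg_eq_self]
  simp

/-- The unit step in space for the sign `+`, none for the sign `-`. -/
def signStep (s : Bool) : Pt := if s then (0, 1) else 0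

lemma grad_eq_signStep (ε : ℝ) (K : Pt → ℝ) (s : Bool) (z : Pt) :
    grad ε s K z = grad ε false K (z + signStep s) := by
  cases s
  · simp [signStep]
  · rw [grad_true_eq]; congr 1; ext <;> simp [signStep]

/-- Translation invariance collapses all sign choices: a forward gradient only shifts the argument
by one site. -/
lemma pairing_eq_corr (ε : ℝ) (K : Pt → ℝ) (l₁ l₂ : Bool) (z₁ z₂ : Pt) :
    pairing ε K l₁ l₂ z₁ z₂ = corr ε K (z₁ - z₂ + (signStep l₁ - signStep l₂)) := by
  unfold corr pairing pairingIntegrand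
  rw [← integral_add_right_eq_self _ (z₂ + signStep l₂)]
  refine integral_congr_ae (Filter.Eventually.of_forall fun w => ?_)
  simp only [grad_eq_signStep ε K l₁, grad_eq_signStep ε K l₂]
  congr 2 <;> abel

lemma corr_neg (ε : ℝ) (K : Pt → ℝ) (z : Pt) : corr ε K (-z) = corr ε K z := by
  rw [corr_eq, corr_eq, ← integral_add_left_eq_self _ z]
  refine integral_congr_ae (Filter.Eventually.of_forall fun w => ?_)
  simp only [neg_add_cancel_left]; ring

lemma grad_false_reflect {ε : ℝ} {K : Pt → ℝ} (hK : ∀ (t : ℝ) (k : ℤ), K (t, -k) = K (t, k))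
    (z : Pt) : grad ε false K (reflect z) = -grad ε false K (z + (0, 1)) := by
  simp only [grad_false_eq, reflect, Prod.fst_add, Prod.snd_add, add_zero, add_sub_cancel_right]
  rw [show (z.1, -z.2 - 1) = ((z.1, -(z.2 + 1)) : Pt) by ext <;> simp; ring, hK, hK,
    show z + (0, 1) = (z.1, z.2 + 1) by ext <;> simp]
  ring

/-- Reflection turns `∇⁻` into `-∇⁻` shifted by one site. The two signs cancel and a translation of
the integration variable absorbs one shift from each factor. -/
lemma corr_reflect {ε : ℝ} {K : Pt → ℝ} (hK : ∀ (t : ℝ) (k : ℤ), K (t, -k) = K (t, k)) (z : Pt) :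
    corr ε K (reflect z) = corr ε K z := by
  have hinv : Function.Involutive reflect := fun w => by simp [reflect]
  have hme : MeasurableEmbedding reflect :=
    (MeasurableEquiv.ofInvolutive reflect hinv
      (measurePreserving_reflect ε).measurable).measurableEmbedding
  rw [corr_eq, corr_eq, ← (measurePreserving_reflect ε).integral_comp hme,
    ← integral_add_right_eq_self (fun w => grad ε false K (z + w) * grad ε false K w) (0, 1)]
  refine integral_congr_ae (Filter.Eventually.of_forall fun w => ?_)
  simp only
  rw [show reflect z + reflect w = reflect (z + w) by ext <;> simp [reflect]; ring,
    grad_false_reflect hK, grad_false_reflect hK, add_assoc]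
  ring

lemma corr_eq_zero_of_lt {ε c A : ℝ} {K : Pt → ℝ} (hε : 0 < ε) (hK : KernelBound ε c A K)
    {z : Pt} (hz : 2 * (c + ε) < parabolicSize ε z) : corr ε K z = 0 := by
  rw [corr_eq]
  refine integral_eq_zero_of_ae (Filter.Eventually.of_forall fun w => ?_)
  simp only [Pi.zero_apply, mul_eq_zero]
  by_contra! hcon
  have h1 : parabolicSize ε (z + w) ≤ c + ε := by
    by_contra! h; exact hcon.1 (hK.grad_eq_zero hε false h)
  have h2 : parabolicSize ε w ≤ c + ε := by
    by_contra! h; exact hcon.2 (hK.grad_eq_zero hε false h)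
  have h3 := parabolicSize_add_le hε.le (z + w) (-w)
  rw [parabolicSize_neg, add_neg_cancel_right] at h3
  linarith

lemma measurable_corr {ε : ℝ} {K : Pt → ℝ} (hK : Measurable K) : Measurable (corr ε K) := by
  have hm := measurable_grad (ε := ε) hK false
  have : Measurable (Function.uncurry fun z w : Pt => grad ε false K (z + w) * grad ε false K w) :=
    (hm.comp (measurable_fst.add measurable_snd)).mul (hm.comp measurable_snd)
  rw [show corr ε K = fun z => ∫ w, grad ε false K (z + w) * grad ε false K w ∂(gridMeasure ε)
    from funext (corr_eq ε K)]
  exact (this.stronglyMeasurable.integral_prod_right).measurable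

/-- The defect `∂ₜR - ½ΔR` of a remainder in the lattice heat equation, for times `t ≥ 0`. -/
def heatDefect (ε : ℝ) (R : Pt → ℝ) (z : Pt) : ℝ :=
  if z.1 < 0 then 0 else derivWithin (fun t => R (t, z.2)) (Set.Ici 0) z.1 -
    (R (z.1, z.2 + 1) + R (z.1, z.2 - 1) - 2 * R z) / (2 * ε ^ 2)

section Correlation

variable {ε c A C : ℝ} {K R : Pt → ℝ}

lemma RegularBound.continuousOn_heatDefect (hR : RegularBound ε C R) (k : ℤ) :
    ContinuousOn (fun t => heatDefect ε R (t, k)) (Set.Ici 0) := by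
  have h1 := (hR.contDiffOn k).continuousOn_derivWithin (uniqueDiffOn_Ici 0) le_rfl
  have h2 := fun j => (hR.contDiffOn j).continuousOn
  have h3 : ContinuousOn (fun t => derivWithin (fun t => R (t, k)) (Set.Ici 0) t -
    (R (t, k + 1) + R (t, k - 1) - 2 * R (t, k)) / (2 * ε ^ 2)) (Set.Ici 0) :=
    h1.sub ((((h2 (k + 1)).add (h2 (k - 1))).sub (continuousOn_const.mul (h2 k))).div_const _)
  refine h3.congr fun t ht => ?_
  simp only [heatDefect, if_neg (not_lt.2 (Set.mem_Ici.1 ht))]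

lemma RegularBound.measurable_heatDefect (hR : RegularBound ε C R) :
    Measurable (heatDefect ε R) :=
  measurable_of_continuousOn_slices hR.continuousOn_heatDefect fun z hz => by simp [heatDefect, hz]

lemma RegularBound.abs_heatDefect_le (hR : RegularBound ε C R) (hε : 0 < ε) (hC : 0 ≤ C) (z : Pt) :
    |heatDefect ε R z| ≤ 2 * C := by
  unfold heatDefect
  split_ifs with h
  · rw [abs_zero]; positivity
  · have hz := not_lt.1 h
    have h1 := hR.deriv_bound z hz
    have h2 := hR.grad_grad_bound (z.1, z.2 + 1) hz
    have h3 : (R (z.1, z.2 + 1) + R (z.1, z.2 - 1) - 2 * R z) / (2 * ε ^ 2) =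
        grad ε false (grad ε false R) (z.1, z.2 + 1) / 2 := by
      simp only [grad_false_eq, add_sub_cancel_right]
      field_simp; ring
    rw [h3]
    refine (abs_sub _ _).trans ?_
    rw [abs_div, abs_two]
    linarith

lemma hasDerivWithinAt_of_decomposition (hε : 0 < ε) (hR : RegularBound ε C R)
    (hu : ∀ z : Pt, 0 ≤ z.1 → heatKernel ε z = K z + R z) {t : ℝ} (ht : 0 ≤ t) (k : ℤ) :
    HasDerivWithinAt (fun t => K (t, k))
      ((K (t, k + 1) + K (t, k - 1) - 2 * K (t, k)) / (2 * ε ^ 2) - heatDefect ε R (t, k))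
      (Set.Ici 0) t := by
  have h1 := derivWithin_heatKernel hε ht k
  have h2 := (((hR.contDiffOn k).differentiableOn one_ne_zero) t ht).hasDerivWithinAt
  have h3 := h1.sub h2
  have hK : ∀ s, 0 ≤ s → ∀ j, K (s, j) = heatKernel ε (s, j) - R (s, j) := fun s hs j => by
    have := hu (s, j) hs; linarith
  refine (h3.congr (fun s hs => hK s hs k) (hK t ht k)).congr_deriv ?_
  rw [hK t ht, hK t ht, hK t ht]
  simp only [heatDefect, if_neg (not_lt.2 ht)]
  ring

/-- The lattice form of `∫ ∇G(z + w) ∇G(w) dw = G(z)`. The product `ε ∑ K(t + s, k + y) K(s, y)`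
runs from its value at `s = 0` down to zero, and its decay rate is the gradient product plus the
defect terms. -/
lemma corr_eq_sub (hε : 0 < ε) (hε1 : ε ≤ 1) (hc : 0 ≤ c) (hA : 0 ≤ A) (hC : 0 ≤ C)
    (hK : KernelBound ε c A K)
    (hR : RegularBound ε C R) (hu : ∀ z : Pt, 0 ≤ z.1 → heatKernel ε z = K z + R z)
    (z : Pt) (hz : 0 ≤ z.1) :
    corr ε K z = K z - ε * ∑' y : ℤ, K (z.1, y) * R (0, y - z.2) -
      (∫ w, heatDefect ε R (z + w) * K w ∂(gridMeasure ε)) -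
      ∫ w, K (z + w) * heatDefect ε R w ∂(gridMeasure ε) := by
  obtain ⟨t, k⟩ := z
  simp only at hz
  set ρ := heatDefect ε R with hρ
  obtain ⟨m, hm1, hm2⟩ : ∃ m : ℕ, c < ε * m ∧ c + ε * |(k : ℝ)| < ε * m := by
    obtain ⟨m, hm⟩ := exists_nat_gt ((c + ε * |(k : ℝ)|) / ε)
    rw [div_lt_iff₀ hε] at hm
    have : 0 ≤ ε * |(k : ℝ)| := by positivity
    exact ⟨m, by linarith, by linarith⟩
  -- After this time `K` vanishes identically, so the time integral stops here.
  set S : ℝ := (c + 1) ^ 2 with hS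
  have hS0 : 0 ≤ S := by positivity
  have hk1 : ∀ (s : ℝ) (y : ℤ), (m : ℤ) ≤ |y| → K (s, y) = 0 := fun s y hy => by
    refine hK.eq_zero_of_lt _ ?_
    have h1 : (m : ℝ) ≤ |(y : ℝ)| := by exact_mod_cast hy
    have h2 : ε * m ≤ ε * |(y : ℝ)| := by gcongr
    unfold parabolicSize
    have := Real.sqrt_nonneg |s|
    simp only; linarith
  have hk2 : ∀ (s : ℝ) (y : ℤ), y ∉ nearSet m → K (s, k + y) = 0 := fun s y hy => by
    refine hK.eq_zero_of_lt _ ?_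
    rw [mem_nearSet, not_le] at hy
    have h1 : (m : ℝ) ≤ |(y : ℝ)| := by exact_mod_cast hy.le
    have h2 : ε * m ≤ ε * |(y : ℝ)| := by gcongr
    have h3 : ε * |(y : ℝ)| ≤ ε * |((k + y : ℤ) : ℝ)| + ε * |(k : ℝ)| := by
      rw [← mul_add]
      refine mul_le_mul_of_nonneg_left ?_ hε.le
      have := abs_sub ((k + y : ℤ) : ℝ) (k : ℝ)
      push_cast at this ⊢
      rwa [add_sub_cancel_left] at this
    unfold parabolicSize
    have := Real.sqrt_nonneg |s|
    simp only; linarith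
  have hk3 : ∀ (s : ℝ) (y : ℤ), S ≤ s → K (s, y) = 0 := fun s y hs => by
    refine hK.eq_zero_of_lt _ ?_
    have h1 : c + 1 ≤ Real.sqrt |s| := by
      refine Real.le_sqrt_of_sq_le ?_
      rw [abs_of_nonneg (hS0.trans hs)]; exact hs
    have h2 : 0 ≤ ε * |(y : ℝ)| := by positivity
    unfold parabolicSize; simp only; linarith
  have hg1 : ∀ (s : ℝ) (y : ℤ), (s < 0 ∨ S < s ∨ y ∉ nearSet m) → grad ε false K (s, y) = 0 := by
    rintro s y (h | h | h)
    · exact grad_of_neg hK.eq_zero_of_neg false h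
    · rw [grad_false_eq, hk3 s _ h.le, hk3 s _ h.le]; simp
    · rw [mem_nearSet, not_le] at h
      rw [grad_false_eq, hk1 s _ h.le, hk1 s (y - 1) (by
        have := abs_sub_abs_le_abs_sub y 1
        rw [abs_one] at this; omega)]; simp
  have i1 : Integrable (fun w => grad ε false K ((t, k) + w) * grad ε false K w)
      (gridMeasure ε) :=
    Integrable.bdd_mul (c := A * (ε ^ (-(1 / 4) : ℝ)) ^ 8) (hK.integrable_grad hε hε1 false)
      ((measurable_grad hK.measurable false).comp
        (measurable_const.add measurable_id)).aestronglyMeasurable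
      (Filter.Eventually.of_forall fun w => hK.abs_grad_le_const hε hA false _)
  have i2 : Integrable (fun w => ρ ((t, k) + w) * K w) (gridMeasure ε) :=
    Integrable.bdd_mul (c := 2 * C) (hK.integrable hε hε1 hA)
      (hR.measurable_heatDefect.comp (measurable_const.add measurable_id)).aestronglyMeasurable
      (Filter.Eventually.of_forall fun w => hR.abs_heatDefect_le hε hC _)
  have i3 : Integrable (fun w => K ((t, k) + w) * ρ w) (gridMeasure ε) :=
    Integrable.mul_bdd (c := 2 * C) ((hK.integrable hε hε1 hA).comp_add_left (t, k))
      hR.measurable_heatDefect.aestronglyMeasurable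
      (Filter.Eventually.of_forall fun w => hR.abs_heatDefect_le hε hC _)
  set N : Set Pt := Set.Icc 0 S ×ˢ (nearSet m : Set ℤ) with hN
  set g : Pt → ℝ := fun w => grad ε false K ((t, k) + w) * grad ε false K w +
    ρ ((t, k) + w) * K w + K ((t, k) + w) * ρ w with hg
  have i12 : Integrable (fun w => grad ε false K ((t, k) + w) * grad ε false K w +
    ρ ((t, k) + w) * K w) (gridMeasure ε) := i1.add i2
  have ig : Integrable g (gridMeasure ε) := i12.add i3
  have e1 : ∫ w, g w ∂(gridMeasure ε) = corr ε K (t, k) +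
      (∫ w, ρ ((t, k) + w) * K w ∂(gridMeasure ε)) +
      ∫ w, K ((t, k) + w) * ρ w ∂(gridMeasure ε) := by
    rw [corr_eq, ← integral_add i1 i2, ← integral_add i12 i3]
  have e2 : ∫ w in N, g w ∂(gridMeasure ε) = ∫ w, g w ∂(gridMeasure ε) := by
    refine setIntegral_eq_integral_of_forall_compl_eq_zero fun w hw => ?_
    obtain ⟨s, y⟩ := w
    have h1 : s < 0 ∨ S < s ∨ y ∉ nearSet m := by
      by_contra! hcon
      exact hw ⟨⟨hcon.1, hcon.2.1⟩, hcon.2.2⟩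
    simp only [hg, hg1 s y h1, mul_zero, zero_add, Prod.mk_add_mk]
    rcases h1 with h | h | h
    · rw [hK.eq_zero_of_neg (s, y) h, show ρ (s, y) = 0 by simp [hρ, heatDefect, h]]; simp
    · rw [hk3 s y h.le, hk3 (t + s) _ (by linarith)]; simp
    · rw [hk2 _ y h]
      rw [mem_nearSet, not_le] at h
      rw [hk1 s y h.le]; simp
  set dK : ℝ → ℤ → ℝ := fun s y =>
    (K (s, y + 1) + K (s, y - 1) - 2 * K (s, y)) / (2 * ε ^ 2) - ρ (s, y) with hdK
  have hd : ∀ s, 0 ≤ s → ∀ y, HasDerivWithinAt (fun s => K (s, y)) (dK s y) (Set.Ici 0) s :=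
    fun s hs y => hasDerivWithinAt_of_decomposition hε hR hu hs y
  have hKc : ∀ y, ContinuousOn (fun s => K (s, y)) (Set.Ici 0) := fun y s hs =>
    (hd s hs y).continuousWithinAt
  have hdc : ∀ y, ContinuousOn (fun s => dK s y) (Set.Ici 0) := fun y =>
    ((((hKc (y + 1)).add (hKc (y - 1))).sub (continuousOn_const.mul (hKc y))).div_const _).sub
      (hR.continuousOn_heatDefect y)
  have hmaps : Set.MapsTo (fun s => t + s) (Set.Icc 0 S) (Set.Ici 0) := fun s hs =>
    add_nonneg hz hs.1
  have hsub : Set.Icc 0 S ⊆ Set.Ici (0 : ℝ) := Set.Icc_subset_Ici_self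
  have hadd : ContinuousOn (fun s => t + s) (Set.Icc 0 S) := by fun_prop
  set H : ℝ → ℝ := fun s => ε * ∑ y ∈ nearSet m, K (t + s, k + y) * K (s, y) with hH
  set H' : ℝ → ℝ := fun s => ε * ∑ y ∈ nearSet m,
    (dK (t + s) (k + y) * K (s, y) + K (t + s, k + y) * dK s y) with hH'
  have hHc : ContinuousOn H (Set.Icc 0 S) :=
    continuousOn_const.mul (continuousOn_finsetSum _ fun y _ =>
      ((hKc (k + y)).comp hadd hmaps).mul ((hKc y).mono hsub))
  have hHc' : ContinuousOn H' (Set.Icc 0 S) :=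
    continuousOn_const.mul (continuousOn_finsetSum _ fun y _ =>
      (((hdc (k + y)).comp hadd hmaps).mul ((hKc y).mono hsub)).add
        (((hKc (k + y)).comp hadd hmaps).mul ((hdc y).mono hsub)))
  have hHd : ∀ s ∈ Set.Ioo 0 S, HasDerivAt H (H' s) s := fun s hs => by
    refine HasDerivAt.const_mul ε (HasDerivAt.fun_sum fun y _ => ?_)
    have h1 : HasDerivAt (fun s => K (s, y)) (dK s y) s :=
      (hd s hs.1.le y).hasDerivAt (Ici_mem_nhds hs.1)
    have h2 : HasDerivAt (fun s => K (s, k + y)) (dK (t + s) (k + y)) (t + s) :=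
      (hd (t + s) (by linarith [hs.1]) (k + y)).hasDerivAt (Ici_mem_nhds (by linarith [hs.1]))
    exact (h2.comp_const_add t s).mul h1
  have hftc : ∫ s in (0)..S, H' s = H S - H 0 := by
    refine intervalIntegral.integral_eq_sub_of_hasDerivAt_of_le hS0 hHc hHd ?_
    exact hHc'.intervalIntegrable_of_Icc hS0
  have hHS : H S = 0 := by
    simp only [hH]
    rw [Finset.sum_eq_zero fun y _ => by rw [hk3 S y le_rfl, mul_zero], mul_zero]
  have e3 : ∫ w in N, g w ∂(gridMeasure ε) = H 0 := by
    rw [hN, setIntegral_slab_finset hε hS0 _ ig.integrableOn]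
    have : ∫ s in (0)..S, ε * ∑ y ∈ nearSet m, g (s, y) = ∫ s in (0)..S, -H' s := by
      refine intervalIntegral.integral_congr fun s _ => ?_
      -- The density and `-H'` differ by a spatial divergence whose two end terms lie outside the
      -- support of `K`.
      have ht := sum_Ico_int_telescope (fun y => K (t + s, k + y - 1) * K (s, y) +
        K (t + s, k + y) * K (s, y - 1) - 2 * (K (t + s, k + y - 1) * K (s, y - 1)))
        (-m) (2 * m + 1)
      rw [show -(m : ℤ) + ((2 * m + 1 : ℕ) : ℤ) = m + 1 by push_cast; ring] at ht
      change ∑ y ∈ nearSet m, _ = _ at ht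
      rw [hk1 s (m + 1) (by rw [abs_of_nonneg (by positivity)]; omega),
        hk1 s (m + 1 - 1) (by rw [add_sub_cancel_right, abs_of_nonneg (by positivity)]),
        hk1 s (-m) (by rw [abs_neg]; exact le_abs_self _), hk1 s (-m - 1) (by
          rw [abs_of_nonpos (by omega)]; omega)] at ht
      simp only [mul_zero, add_zero, sub_zero] at ht
      simp only [hg, hH', hdK, Prod.mk_add_mk]
      rw [eq_neg_iff_add_eq_zero, ← mul_add, ← Finset.sum_add_distrib]
      suffices h : ∑ y ∈ nearSet m, (K (t + s, k + (y + 1) - 1) * K (s, y + 1) +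
        K (t + s, k + (y + 1)) * K (s, y + 1 - 1) -
        2 * (K (t + s, k + (y + 1) - 1) * K (s, y + 1 - 1)) -
        (K (t + s, k + y - 1) * K (s, y) +
        K (t + s, k + y) * K (s, y - 1) - 2 * (K (t + s, k + y - 1) * K (s, y - 1)))) /
        (2 * ε ^ 2) = 0 by
        rw [← mul_zero ε, ← h]
        congr 1
        refine Finset.sum_congr rfl fun y _ => ?_
        simp only [grad_false_eq, add_sub_cancel_right, ← add_assoc]
        field_simp
        ring
      rw [← Finset.sum_div, ht, zero_div]
    rw [this, intervalIntegral.integral_neg, hftc, hHS]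
    ring
  have e4 : H 0 = K (t, k) - ε * ∑' y : ℤ, K (t, y) * R (0, y - k) := by
    have h1 : ∑' y : ℤ, K (t, y) * R (0, y - k) = ∑ y ∈ nearSet m, K (t, k + y) * R (0, y) := by
      rw [← (Equiv.addLeft k).tsum_eq, tsum_eq_sum (s := nearSet m)]
      · simp
      · intro y hy
        simp only [Equiv.coe_addLeft]
        rw [hk2 t y hy, zero_mul]
    -- The lattice delta in the initial value reproduces `K(t, k)`; the remainder gives the
    -- correction.
    have h2 : ∀ y, K (0, y) = (if y = 0 then ε⁻¹ else 0) - R (0, y) := fun y => by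
      have := hu (0, y) le_rfl
      rw [heatKernel_zero hε] at this
      linarith
    simp only [hH, h1, add_zero]
    simp_rw [h2, mul_sub, Finset.sum_sub_distrib, mul_sub, mul_ite, mul_zero]
    rw [Finset.sum_ite_eq' (nearSet m) 0, if_pos (mem_nearSet.2 (by simp)), add_zero]
    field_simp
  rw [← e2, e3, e4] at e1
  simp only
  linarith

lemma abs_integral_mul_le {f g : Pt → ℝ} {D : ℝ} (hf : Integrable f (gridMeasure ε))
    (hg : ∀ w, |g w| ≤ D) :
    |∫ w, g w * f w ∂(gridMeasure ε)| ≤ D * ∫ w, |f w| ∂(gridMeasure ε) := by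
  rw [← integral_const_mul, ← Real.norm_eq_abs]
  refine norm_integral_le_of_norm_le (hf.abs.const_mul D) (Filter.Eventually.of_forall fun w => ?_)
  rw [Real.norm_eq_abs, abs_mul]
  exact mul_le_mul_of_nonneg_right (hg w) (abs_nonneg _)

lemma KernelBound.exists_support (hK : KernelBound ε c A K) (hε : 0 < ε) (hε1 : ε ≤ 1)
    (hc : 0 ≤ c) : ∃ m : ℕ, ε * (2 * m + 1) ≤ 2 * c + 3 ∧
      ∀ t, ∀ y ∉ nearSet m, K (t, y) = 0 := by
  refine ⟨⌈c / ε⌉₊, ?_, fun t y hy => hK.eq_zero_of_lt _ ?_⟩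
  · have h := (Nat.ceil_lt_add_one (show 0 ≤ c / ε by positivity)).le
    calc _ ≤ ε * (2 * (c / ε + 1) + 1) := by gcongr
      _ = 2 * c + 3 * ε := by field_simp; ring
      _ ≤ _ := by linarith
  · rw [mem_nearSet, not_le] at hy
    have h1 : ((⌈c / ε⌉₊ : ℕ) : ℝ) < |(y : ℝ)| := by exact_mod_cast hy
    have h2 := (Nat.le_ceil (c / ε)).trans_lt h1
    rw [div_lt_iff₀ hε] at h2
    have := Real.sqrt_nonneg |t|
    unfold parabolicSize
    simp only; linarith

/-- The spatial sum of `K` is controlled by the unit mass of `G` plus a bounded remainder over a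
support of bounded length. -/
lemma abs_mul_tsum_le (hε : 0 < ε) (hε1 : ε ≤ 1) (hc : 0 ≤ c) (hC : 0 ≤ C)
    (hK : KernelBound ε c A K)
    (hR : RegularBound ε C R) (hu : ∀ z : Pt, 0 ≤ z.1 → heatKernel ε z = K z + R z)
    {t : ℝ} (ht : 0 ≤ t) {f : ℤ → ℝ} {D : ℝ} (hD : 0 ≤ D) (hf : ∀ y, |f y| ≤ D) :
    |ε * ∑' y : ℤ, K (t, y) * f y| ≤ (1 + C * (2 * c + 3)) * D := by
  obtain ⟨m, hm, hK0⟩ := hK.exists_support hε hε1 hc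
  rw [tsum_eq_sum (s := nearSet m) fun y hy => by rw [hK0 t y hy, zero_mul], abs_mul,
    abs_of_pos hε]
  have hcard : ((nearSet m).card : ℝ) = 2 * m + 1 := by
    have : (nearSet m).card = 2 * m + 1 := by rw [nearSet, Int.card_Ico]; omega
    rw [this]; push_cast; ring
  calc ε * |∑ y ∈ nearSet m, K (t, y) * f y|
      ≤ ε * ∑ y ∈ nearSet m, (heatKernel ε (t, y) + C) * D := by
        gcongr
        refine (Finset.abs_sum_le_sum_abs _ _).trans (Finset.sum_le_sum fun y _ => ?_)
        rw [abs_mul]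
        have h1 := hR.bound (t, y) ht
        have h2 := heatKernel_nonneg hε (t, y)
        have h3 : |K (t, y)| ≤ heatKernel ε (t, y) + C := by
          have h4 := hu (t, y) ht
          rw [show K (t, y) = heatKernel ε (t, y) - R (t, y) by linarith]
          refine (abs_sub _ _).trans ?_
          rw [abs_of_nonneg h2]; linarith
        exact mul_le_mul h3 (hf y) (abs_nonneg _) (by positivity)
    _ = (ε * (∑ y ∈ nearSet m, heatKernel ε (t, y)) + C * (ε * (2 * m + 1))) * D := by
        rw [← Finset.sum_mul, Finset.sum_add_distrib, Finset.sum_const, nsmul_eq_mul, hcard]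
        ring
    _ ≤ (ε * ε⁻¹ + C * (2 * c + 3)) * D := by
        gcongr
        exact sum_heatKernel_le hε t _
    _ = _ := by rw [mul_inv_cancel₀ hε.ne']

/-- In each correction term, the gradient falls either on the initial remainder, where it is
bounded, or on `K`, where it is integrable. -/
lemma exists_abs_corr_sub_le (c A C : ℝ) (hc : 0 ≤ c) (hA : 0 ≤ A) (hC : 0 ≤ C) :
    ∃ B : ℝ, 0 ≤ B ∧ ∀ (ε : ℝ) (K R : Pt → ℝ), 0 < ε → ε ≤ 1 → KernelBound ε c A K →
      RegularBound ε C R → (∀ z : Pt, 0 ≤ z.1 → heatKernel ε z = K z + R z) →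
      ∀ z : Pt, 0 ≤ z.1 → |corr ε K z - K z| ≤ B ∧
        |grad ε false (corr ε K) z - grad ε false K z| ≤ B := by
  obtain ⟨C₁, hC₁, h₁⟩ := exists_integral_abs_le_of_locWt c
  obtain ⟨C₂, hC₂, h₂⟩ := exists_integral_abs_le_of_locWt (c + 1)
  refine ⟨(1 + C * (2 * c + 3)) * C + 2 * (2 * C * (A * (c + 1) * C₁ + A * C₂)), by positivity, ?_⟩
  intro ε K R hε hε1 hK hR hu z hz
  have hi := hK.integrable hε hε1 hA
  have hig := fun s => hK.integrable_grad hε hε1 s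
  have hρ := hR.abs_heatDefect_le hε hC
  have hmρ := hR.measurable_heatDefect
  have b1 : ∫ w, |K w| ∂(gridMeasure ε) ≤ A * (c + 1) * C₁ :=
    h₁ ε _ K hε hε1 (by positivity) (hK.abs_le_locWt hε hε1 hA)
  have b2 : ∀ s, ∫ w, |grad ε s K w| ∂(gridMeasure ε) ≤ A * C₂ := fun s =>
    h₂ ε _ _ hε hε1 hA (hK.abs_grad_le_locWt hε hε1 s)
  have p1 : 0 ≤ 2 * C * (A * (c + 1) * C₁) := by positivity
  have p2 : 0 ≤ 2 * C * (A * C₂) := by positivity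
  have e0 := corr_eq_sub hε hε1 hc hA hC hK hR hu z hz
  constructor
  · have d1 := abs_mul_tsum_le hε hε1 hc hC hK hR hu hz (f := fun y => R (0, y - z.2)) hC
      fun y => hR.bound _ le_rfl
    have d2 := abs_integral_mul_le hi (g := fun w => heatDefect ε R (z + w)) fun w => hρ _
    have d3 := abs_integral_mul_le (hi.comp_add_left z) (g := heatDefect ε R) hρ
    rw [integral_add_left_eq_self (fun w => |K w|) z] at d3
    have d2' := d2.trans (mul_le_mul_of_nonneg_left b1 (by positivity))
    have d3' := d3.trans (mul_le_mul_of_nonneg_left b1 (by positivity))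
    simp_rw [mul_comm (heatDefect ε R _) (K (z + _))] at d3'
    rw [e0]
    rw [abs_le] at *
    constructor <;> linarith [d1.1, d1.2, d2'.1, d2'.2, d3'.1, d3'.2]
  · have e1 := corr_eq_sub hε hε1 hc hA hC hK hR hu (z.1, z.2 - 1) hz
    have d1 := abs_mul_tsum_le hε hε1 hc hC hK hR hu hz
      (f := fun y => grad ε true R (0, y - z.2)) hC fun y => hR.grad_true_bound _ le_rfl
    have d2 := abs_integral_mul_le ((hig true).comp_sub_right z) (g := heatDefect ε R) hρ
    have d3 := abs_integral_mul_le ((hig false).comp_add_left z) (g := heatDefect ε R) hρ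
    rw [integral_sub_right_eq_self (fun w => |grad ε true K w|) z] at d2
    rw [integral_add_left_eq_self (fun w => |grad ε false K w|) z] at d3
    have d2' := d2.trans (mul_le_mul_of_nonneg_left (b2 true) (by positivity))
    have d3' := d3.trans (mul_le_mul_of_nonneg_left (b2 false) (by positivity))
    have f1 : ε * (ε * ∑' y : ℤ, K (z.1, y) * grad ε true R (0, y - z.2)) =
        ε * (∑' y : ℤ, K (z.1, y) * R (0, y - (z.2 - 1))) -
        ε * ∑' y : ℤ, K (z.1, y) * R (0, y - z.2) := by
      obtain ⟨m, -, hK0⟩ := hK.exists_support hε hε1 hc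
      have hfin : ∀ f : ℤ → ℝ, ∑' y : ℤ, K (z.1, y) * f y = ∑ y ∈ nearSet m, K (z.1, y) * f y :=
        fun f => tsum_eq_sum fun y hy => by rw [hK0 _ y hy, zero_mul]
      rw [hfin, hfin, hfin, ← mul_sub, ← Finset.sum_sub_distrib, Finset.mul_sum]
      congr 1
      refine Finset.sum_congr rfl fun y _ => ?_
      rw [grad_true_eq, grad_false_eq]
      simp only [add_sub_cancel_right]
      rw [show y - z.2 + 1 = y - (z.2 - 1) by ring]
      field_simp
    -- The defect is merely bounded, so the difference is moved onto `K` by translating the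
    -- integral.
    have f2 : ε * ∫ w, heatDefect ε R w * grad ε true K (w - z) ∂(gridMeasure ε) =
        (∫ w, heatDefect ε R ((z.1, z.2 - 1) + w) * K w ∂(gridMeasure ε)) -
        ∫ w, heatDefect ε R (z + w) * K w ∂(gridMeasure ε) := by
      have hint : ∀ v, Integrable (fun w => heatDefect ε R w * K (w - v)) (gridMeasure ε) := fun v =>
        (hi.comp_sub_right v).bdd_mul (c := 2 * C) hmρ.aestronglyMeasurable
          (Filter.Eventually.of_forall hρ)
      have htr : ∀ v : Pt, ∫ w, heatDefect ε R (v + w) * K w ∂(gridMeasure ε) =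
          ∫ w, heatDefect ε R w * K (w - v) ∂(gridMeasure ε) := fun v => by
        rw [← integral_add_left_eq_self (fun w => heatDefect ε R w * K (w - v)) v]
        simp
      rw [htr, htr, ← integral_sub (hint _) (hint _), ← integral_const_mul]
      refine integral_congr_ae (Filter.Eventually.of_forall fun w => ?_)
      simp only
      rw [grad_true_eq, grad_false_eq, show w - (z.1, z.2 - 1) = ((w - z).1, (w - z).2 + 1) by
        ext <;> simp; ring]
      simp only [add_sub_cancel_right, Prod.mk.eta]
      field_simp
    have f3 : ε * ∫ w, heatDefect ε R w * grad ε false K (z + w) ∂(gridMeasure ε) =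
        (∫ w, K (z + w) * heatDefect ε R w ∂(gridMeasure ε)) -
        ∫ w, K ((z.1, z.2 - 1) + w) * heatDefect ε R w ∂(gridMeasure ε) := by
      have hint : ∀ v, Integrable (fun w => K (v + w) * heatDefect ε R w) (gridMeasure ε) := fun v =>
        (hi.comp_add_left v).mul_bdd (c := 2 * C) hmρ.aestronglyMeasurable
          (Filter.Eventually.of_forall hρ)
      rw [← integral_sub (hint _) (hint _), ← integral_const_mul]
      refine integral_congr_ae (Filter.Eventually.of_forall fun w => ?_)
      simp only
      rw [grad_false_eq, show (z.1, z.2 - 1) + w = ((z + w).1, (z + w).2 - 1) by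
        ext <;> simp; ring]
      field_simp
    have f4 : grad ε false (corr ε K) z - grad ε false K z =
        ε * (∑' y : ℤ, K (z.1, y) * grad ε true R (0, y - z.2)) +
        (∫ w, heatDefect ε R w * grad ε true K (w - z) ∂(gridMeasure ε)) -
        ∫ w, heatDefect ε R w * grad ε false K (z + w) ∂(gridMeasure ε) := by
      refine mul_left_cancel₀ hε.ne' ?_
      rw [mul_sub, mul_sub, mul_add, f1, f2, f3, grad_false_eq, grad_false_eq,
        mul_div_cancel₀ _ hε.ne', mul_div_cancel₀ _ hε.ne', e0, e1]
      simp only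
      ring
    rw [f4]
    rw [abs_le] at *
    constructor <;> linarith [d1.1, d1.2, d2'.1, d2'.2, d3'.1, d3'.2]

end Correlation

/-! ### The causal correlation paired with the singular part of the modified kernel. -/

/-- The correlation of two noises, restricted to nonnegative times. -/
def causalCorr (ε : ℝ) (K : Pt → ℝ) (z : Pt) : ℝ := if z.1 < 0 then 0 else corr ε K z

/-- Bounds on a pair of even causal kernels `J`, `L` with the singularity of the heat kernel
and the difference of which is less singular. -/
structure PairBound (ε b B : ℝ) (J L : Pt → ℝ) : Prop where
  measurable_left : Measurable J
  measurable_right : Measurable L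
  left_of_neg : ∀ z : Pt, z.1 < 0 → J z = 0
  right_of_neg : ∀ z : Pt, z.1 < 0 → L z = 0
  left_reflect : ∀ z : Pt, J (reflect z) = J z
  right_reflect : ∀ z : Pt, L (reflect z) = L z
  left_of_lt : ∀ z : Pt, b < parabolicSize ε z → J z = 0
  bound_left : ∀ z : Pt, |J z| ≤ B * wt ε z ^ 4
  grad_left : ∀ (s : Bool) (z : Pt), |grad ε s J z| ≤ B * locWt ε b z
  grad_right : ∀ (s : Bool) (z : Pt), |grad ε s L z| ≤ B * locWt ε b z
  lipschitz : ∀ (t : ℝ) (k l : ℤ), |J (t, k) - J (t, l)| ≤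
    B * (ε * |(k : ℝ) - l|) * (locWt ε b (t, k) + locWt ε b (t, l))
  grad_sub : ∀ (s : Bool) (z : Pt), 0 ≤ z.1 → parabolicSize ε z ≤ 2 * b + 1 →
    |grad ε s L z - grad ε s J z| ≤ B * diffWt ε z

lemma locWt_mono {ε b b' : ℝ} (hε : 0 < ε) (h : b ≤ b') (z : Pt) : locWt ε b z ≤ locWt ε b' z := by
  unfold locWt
  have := wt_pos hε z
  split_ifs with h1 h2 h2
  · exact le_rfl
  · exact absurd (h1.trans h) h2
  · positivity
  · exact le_rfl

lemma diffWt_succ_le {ε : ℝ} (hε : 0 < ε) (t : ℝ) (k : ℤ) :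
    diffWt ε (t, k + 1) ≤ 2 ^ 10 * diffWt ε (t, k) := by
  have h1 := wt_succ_le hε t k
  have h2 := wt_pos hε (t, k + 1)
  have h3 : wt ε (t, k + 1) ^ 10 ≤ (2 * wt ε (t, k)) ^ 10 := by gcongr
  unfold diffWt
  have h4 := mul_le_mul_of_nonneg_left h3 (Real.sqrt_nonneg ε)
  rw [mul_pow] at h4
  linarith

/-- Up to bounded terms `∇J` is `∇G` and `∇L` is `∇G̃`, so their difference inherits the gain of `G̃
- G`. -/
lemma exists_pairBound (c A C : ℝ) (hc : 0 ≤ c) (hA : 0 ≤ A) (hC : 0 ≤ C) :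
    ∃ B : ℝ, 0 ≤ B ∧ ∀ (ε : ℝ) (K R Kt Rt : Pt → ℝ), 0 < ε → ε ≤ 1 →
      KernelBound ε c A K → RegularBound ε C R →
      (∀ z : Pt, 0 ≤ z.1 → heatKernel ε z = K z + R z) →
      KernelBound ε c A Kt → RegularBound ε C Rt →
      (∀ z : Pt, 0 ≤ z.1 → tildeHeatKernel ε z = Kt z + Rt z) →
      PairBound ε (2 * c + 3) B (causalCorr ε K) Kt := by
  obtain ⟨E, hE, h₁⟩ := exists_abs_corr_sub_le c A C hc hA hC
  -- With `b = 2 c + 3` this is the radius `2 b + 1` asked for in `PairBound`, plus one unit for the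
  -- shift in a forward gradient.
  obtain ⟨B₁, hB₁, h₂⟩ := exists_abs_grad_tildeHeatKernel_sub_le c A C (2 * (2 * c + 3) + 2) hA hC hc
    (by positivity)
  -- The correlation lives within `2 (c + ε) ≤ 2 c + 2`; one more unit covers its gradient.
  set b : ℝ := 2 * c + 3 with hb
  have hb0 : 0 ≤ b := by positivity
  -- Inside the ball of radius `b` the bounded error `E` is absorbed by `1 ≤ (b + 1)² wt⁸`.
  set B₂ : ℝ := 2 * A + E * (b + 1) ^ 2 with hB₂
  set B₃ : ℝ := 2 ^ 10 * (B₁ + 2 * C + E) with hB₃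
  have hB₂0 : 0 ≤ B₂ := by positivity
  have hB₃0 : 0 ≤ B₃ := by positivity
  refine ⟨B₂ + B₃, by positivity, ?_⟩
  intro ε K R Kt Rt hε hε1 hK hR hu hKt hRt hut
  have hd := h₁ ε K R hε hε1 hK hR hu
  have hdd := h₂ ε K R Kt Rt hε hε1 hK hR hu hKt hRt hut
  have hJ : ∀ z : Pt, 0 ≤ z.1 → causalCorr ε K z = corr ε K z := fun z hz => if_neg (not_lt.2 hz)
  have hneg : ∀ z : Pt, z.1 < 0 → causalCorr ε K z = 0 := fun z hz => if_pos hz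
  have hgJ : ∀ s (z : Pt), 0 ≤ z.1 → grad ε s (causalCorr ε K) z = grad ε s (corr ε K) z :=
    fun s z hz => grad_congr fun k => hJ (z.1, k) hz
  have hsupp : ∀ z : Pt, 2 * (c + ε) < parabolicSize ε z → causalCorr ε K z = 0 := fun z hz => by
    unfold causalCorr
    rw [corr_eq_zero_of_lt hε hK hz, ite_self]
  have hgd : ∀ s (z : Pt), 0 ≤ z.1 → |grad ε s (corr ε K) z - grad ε s K z| ≤ E := by
    rintro (_ | _) z hz
    · exact (hd z hz).2
    · rw [grad_true_eq, grad_true_eq]; exact (hd (z.1, z.2 + 1) hz).2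
  have hgsupp : ∀ s (z : Pt), b < parabolicSize ε z → grad ε s (causalCorr ε K) z = 0 := by
    intro s z hz
    have h0 := hsupp z (by linarith)
    have h1 : causalCorr ε K (z.1, z.2 + 1) = 0 := by
      refine hsupp _ ?_
      have := parabolicSize_shift_le hε.le z.1 (z.2 + 1) (-1)
      simp only [add_neg_cancel_right, Int.cast_neg, Int.cast_one, abs_neg, abs_one, mul_one,
        Prod.mk.eta] at this
      linarith
    have h2 : causalCorr ε K (z.1, z.2 - 1) = 0 := by
      refine hsupp _ ?_
      have := parabolicSize_shift_le hε.le z.1 (z.2 - 1) 1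
      simp only [sub_add_cancel, Int.cast_one, abs_one, mul_one, Prod.mk.eta] at this
      linarith
    cases s <;> simp [grad, h0, h1, h2]
  have hlip : ∀ t, 0 ≤ t → ∀ k l : ℤ, |causalCorr ε K (t, k) - causalCorr ε K (t, l)| ≤
      (ε * |(k : ℝ) - l|) * (A * (wt ε (t, k) ^ 8 + wt ε (t, l) ^ 8) + E) := by
    intro t ht k l
    have h3 := hK.lipschitz t k l
    have h4 := abs_sub_le_mul_of_grad_bound (ε := ε) (B := E)
      (u := fun k => corr ε K (t, k) - K (t, k)) (fun k => by
        have h5 := (hd (t, k) ht).2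
        rw [grad_false_eq, grad_false_eq, ← sub_div, abs_div, abs_of_pos hε, div_le_iff₀ hε] at h5
        simp only at h5
        rw [show corr ε K (t, k) - K (t, k) - (corr ε K (t, k - 1) - K (t, k - 1)) =
          corr ε K (t, k) - corr ε K (t, k - 1) - (K (t, k) - K (t, k - 1)) by ring]
        linarith) k l
    rw [hJ (t, k) ht, hJ (t, l) ht, show corr ε K (t, k) - corr ε K (t, l) =
      (K (t, k) - K (t, l)) + (corr ε K (t, k) - K (t, k) - (corr ε K (t, l) - K (t, l))) by ring]
    refine (abs_add_le _ _).trans ?_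
    linarith
  refine ⟨?_, hKt.measurable, hneg, hKt.eq_zero_of_neg, ?_, fun z => hKt.even _ _,
    fun z hz => hsupp z (by linarith), ?_, ?_, ?_, ?_, ?_⟩
  · exact Measurable.ite (measurableSet_lt measurable_fst measurable_const) measurable_const
      (measurable_corr hK.measurable)
  · intro z
    unfold causalCorr
    rw [corr_reflect hK.even]
    rfl
  · intro z
    have hq := wt_pos hε z
    rcases lt_or_ge z.1 0 with hz | hz
    · rw [hneg z hz, abs_zero]; positivity
    rcases lt_or_ge b (parabolicSize ε z) with h | h
    · rw [hsupp z (by linarith), abs_zero]; positivity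
    have h3 := one_le_of_size_le hε hε1 h
    have h4 := (hd z hz).1
    have h5 := hK.bound z
    have h6 : |causalCorr ε K z| ≤ A * wt ε z ^ 4 + E := by
      rw [hJ z hz]
      have := abs_add_le (corr ε K z - K z) (K z)
      rw [sub_add_cancel] at this
      linarith
    refine h6.trans ?_
    have h7 : E ≤ E * (b + 1) ^ 2 * wt ε z ^ 4 := by
      calc E = E * 1 := by ring
        _ ≤ E * ((b + 1) * ((b + 1) * wt ε z ^ 4)) := by
          gcongr
          nlinarith
        _ = _ := by ring
    have h8 : 0 ≤ (A + B₃) * wt ε z ^ 4 := by positivity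
    rw [hB₂]
    linarith
  · intro s z
    rcases lt_or_ge b (parabolicSize ε z) with h | h
    · rw [hgsupp s z h, abs_zero]
      have := locWt_nonneg hε b z
      positivity
    rcases lt_or_ge z.1 0 with hz | hz
    · rw [grad_of_neg hneg s hz, abs_zero]
      have := locWt_nonneg hε b z
      positivity
    have hq := wt_pos hε z
    have h3 := one_le_of_size_le' hε hε1 h
    have h4 := hgd s z hz
    have h5 := hK.grad_bound s z
    have h6 : |grad ε s (corr ε K) z| ≤ A * wt ε z ^ 8 + E := by
      have := abs_add_le (grad ε s (corr ε K) z - grad ε s K z) (grad ε s K z)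
      rw [sub_add_cancel] at this
      linarith
    rw [hgJ s z hz, locWt, if_pos h]
    refine h6.trans ?_
    have h7 := mul_le_mul_of_nonneg_left h3 hE
    have h8 : 0 ≤ (A + B₃) * wt ε z ^ 8 := by positivity
    rw [hB₂]
    linarith
  · intro s z
    have h3 := hKt.abs_grad_le_locWt hε hε1 s z
    have h4 := locWt_mono hε (show c + 1 ≤ b by linarith) z
    have h5 := locWt_nonneg hε b z
    have h6 := mul_le_mul_of_nonneg_left h4 hA
    have h7 : 0 ≤ (A + E * (b + 1) ^ 2 + B₃) * locWt ε b z := by positivity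
    rw [hB₂]
    linarith
  · intro t k l
    have n1 := locWt_nonneg hε b (t, k)
    have n2 := locWt_nonneg hε b (t, l)
    have q1 := wt_pos hε (t, k)
    have q2 := wt_pos hε (t, l)
    have n3 : 0 ≤ ε * |(k : ℝ) - l| := by positivity
    rcases lt_or_ge t 0 with ht | ht
    · rw [hneg (t, k) ht, hneg (t, l) ht, sub_self, abs_zero]; positivity
    -- If only one of the two points lies in the ball, its weight dominates that of the other, which
    -- is farther out.
    suffices h : (b < parabolicSize ε (t, k) ∧ b < parabolicSize ε (t, l)) ∨
        A * (wt ε (t, k) ^ 8 + wt ε (t, l) ^ 8) + E ≤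
        B₂ * (locWt ε b (t, k) + locWt ε b (t, l)) by
      rcases h with h | h
      · rw [hsupp _ (by linarith [h.1]), hsupp _ (by linarith [h.2]), sub_self, abs_zero]
        positivity
      · refine (hlip t ht k l).trans ((mul_le_mul_of_nonneg_left h n3).trans ?_)
        have : 0 ≤ B₃ * (ε * |(k : ℝ) - l|) * (locWt ε b (t, k) + locWt ε b (t, l)) := by positivity
        linarith
    rcases lt_or_ge b (parabolicSize ε (t, k)) with h1 | h1 <;>
      rcases lt_or_ge b (parabolicSize ε (t, l)) with h2 | h2
    · exact Or.inl ⟨h1, h2⟩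
    · right
      have h3 := mul_le_mul_of_nonneg_left (one_le_of_size_le' hε hε1 h2) hE
      have h4 : wt ε (t, k) ^ 8 ≤ wt ε (t, l) ^ 8 :=
        pow_le_pow_left₀ q1.le (wt_anti hε (by linarith)) 8
      rw [locWt, if_neg (not_le.2 h1), locWt, if_pos h2, hB₂]
      have h5 := mul_le_mul_of_nonneg_left h4 hA
      linarith
    · right
      have h3 := mul_le_mul_of_nonneg_left (one_le_of_size_le' hε hε1 h1) hE
      have h4 : wt ε (t, l) ^ 8 ≤ wt ε (t, k) ^ 8 :=
        pow_le_pow_left₀ q2.le (wt_anti hε (by linarith)) 8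
      rw [locWt, if_pos h1, locWt, if_neg (not_le.2 h2), hB₂]
      have h5 := mul_le_mul_of_nonneg_left h4 hA
      linarith
    · right
      have h3 := mul_le_mul_of_nonneg_left (one_le_of_size_le' hε hε1 h1) hE
      rw [locWt, if_pos h1, locWt, if_pos h2, hB₂]
      have h5 : 0 ≤ A * wt ε (t, k) ^ 8 := by positivity
      have h6 : 0 ≤ A * wt ε (t, l) ^ 8 := by positivity
      have h7 : 0 ≤ E * (b + 1) ^ 2 * wt ε (t, l) ^ 8 := by positivity
      linarith
  · have hmain : ∀ z : Pt, 0 ≤ z.1 → parabolicSize ε z ≤ 2 * b + 2 →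
        |grad ε false Kt z - grad ε false (causalCorr ε K) z| ≤ (B₁ + 2 * C + E) * diffWt ε z := by
      intro z hz hs
      have h3 := hdd z hz hs
      have h4 := hR.grad_bound z hz
      have h5 := hRt.grad_bound z hz
      have h6 := (hd z hz).2
      have h7 := grad_eq_of_decomposition (ε := ε) hu false z hz
      have h8 := grad_eq_of_decomposition (ε := ε) hut false z hz
      have h9 := one_le_diffWt hε z
      rw [hgJ false z hz, show grad ε false Kt z - grad ε false (corr ε K) z =
        (grad ε false (tildeHeatKernel ε) z - grad ε false (heatKernel ε) z) -
        grad ε false Rt z + grad ε false R z -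
        (grad ε false (corr ε K) z - grad ε false K z) by rw [h7, h8]; ring]
      have h10 : (2 * C + E) * 1 ≤ (2 * C + E) * diffWt ε z := by gcongr
      rw [abs_le] at *
      constructor <;> linarith [h3.1, h3.2, h4.1, h4.2, h5.1, h5.2, h6.1, h6.2]
    intro s z hz hs
    have hp := diffWt_pos hε z
    have h0 : 0 ≤ (B₁ + 2 * C + E) * diffWt ε z := by positivity
    have h1 : 0 ≤ B₂ * diffWt ε z := by positivity
    cases s
    · have := hmain z hz (by linarith)
      rw [hB₃]; linarith
    · rw [grad_true_eq, grad_true_eq]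
      have h2 := parabolicSize_shift_le hε.le z.1 z.2 1
      rw [Int.cast_one, abs_one, mul_one] at h2
      have h3 := hmain (z.1, z.2 + 1) hz (by linarith)
      have h4 := mul_le_mul_of_nonneg_left (diffWt_succ_le hε z.1 z.2)
        (show 0 ≤ B₁ + 2 * C + E by positivity)
      rw [hB₃]; linarith

/-! ### Qualitative integrability at a fixed mesh. -/

/-- Bounded measurable functions. -/
structure BddMeas {α : Type*} [MeasurableSpace α] (f : α → ℝ) : Prop where
  measurable : Measurable f
  bdd : ∃ M, ∀ x, |f x| ≤ M

namespace BddMeas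

variable {α β : Type*} [MeasurableSpace α] [MeasurableSpace β] {f g : α → ℝ}

lemma add (hf : BddMeas f) (hg : BddMeas g) : BddMeas fun x => f x + g x := by
  obtain ⟨M, hM⟩ := hf.bdd
  obtain ⟨N, hN⟩ := hg.bdd
  exact ⟨hf.measurable.add hg.measurable, M + N, fun x =>
    (abs_add_le _ _).trans (add_le_add (hM x) (hN x))⟩

lemma sub (hf : BddMeas f) (hg : BddMeas g) : BddMeas fun x => f x - g x := by
  obtain ⟨M, hM⟩ := hf.bdd
  obtain ⟨N, hN⟩ := hg.bdd
  exact ⟨hf.measurable.sub hg.measurable, M + N, fun x =>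
    (abs_sub _ _).trans (add_le_add (hM x) (hN x))⟩

lemma mul (hf : BddMeas f) (hg : BddMeas g) : BddMeas fun x => f x * g x := by
  obtain ⟨M, hM⟩ := hf.bdd
  obtain ⟨N, hN⟩ := hg.bdd
  refine ⟨hf.measurable.mul hg.measurable, M * N, fun x => ?_⟩
  rw [abs_mul]
  exact mul_le_mul (hM x) (hN x) (abs_nonneg _) ((abs_nonneg _).trans (hM x))

lemma const (a : ℝ) : BddMeas fun _ : α => a := ⟨measurable_const, |a|, fun _ => le_rfl⟩

lemma comp {h : β → α} (hf : BddMeas f) (hh : Measurable h) : BddMeas fun x => f (h x) := by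
  obtain ⟨M, hM⟩ := hf.bdd
  exact ⟨hf.measurable.comp hh, M, fun x => hM _⟩

lemma grad {ε : ℝ} {u : Pt → ℝ} (hu : BddMeas u) (s : Bool) : BddMeas (grad ε s u) := by
  obtain ⟨M, hM⟩ := hu.bdd
  refine ⟨measurable_grad hu.measurable s, (M + M) / |ε|, fun z => ?_⟩
  cases s
  · simp only [LatticeKPZ.grad, Bool.false_eq_true, if_false, abs_div]
    gcongr
    exact (abs_sub _ _).trans (add_le_add (hM _) (hM _))
  · simp only [LatticeKPZ.grad, if_true, abs_div]
    gcongr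
    exact (abs_sub _ _).trans (add_le_add (hM _) (hM _))

/-- For fixed `ε` every integrand is bounded, so bounded support is all that matters; `locWt`,
bounded below on its ball, serves as the dominating function. -/
lemma integrable {ε b : ℝ} (hε : 0 < ε) (hε1 : ε ≤ 1) {f : Pt × Pt → ℝ} (hf : BddMeas f)
    (h : ∀ p, f p ≠ 0 → parabolicSize ε p.1 ≤ b ∧ parabolicSize ε p.2 ≤ b) :
    Integrable f ((gridMeasure ε).prod (gridMeasure ε)) := by
  obtain ⟨M, hM⟩ := hf.bdd
  have hl : Integrable (locWt ε b) (gridMeasure ε) :=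
    integrable_of_abs_le_locWt (B := 1) hε hε1 (measurable_locWt ε b) fun z => by
      rw [abs_of_nonneg (locWt_nonneg hε b z), one_mul]
  refine ((hl.mul_prod hl).const_mul (M * ((b + 1) ^ 2) ^ 2)).mono' hf.measurable.aestronglyMeasurable
    (Filter.Eventually.of_forall fun p => ?_)
  have hM0 : 0 ≤ M := (abs_nonneg _).trans (hM p)
  have n1 := locWt_nonneg hε b p.1
  have n2 := locWt_nonneg hε b p.2
  rw [Real.norm_eq_abs]
  rcases eq_or_ne (f p) 0 with h0 | h0
  · rw [h0, abs_zero]; positivity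
  · obtain ⟨h1, h2⟩ := h p h0
    have e1 := one_le_of_size_le' hε hε1 h1
    have e2 := one_le_of_size_le' hε hε1 h2
    rw [locWt, if_pos h1, locWt, if_pos h2]
    calc |f p| ≤ M * (1 * 1) := by rw [one_mul, mul_one]; exact hM p
      _ ≤ M * (((b + 1) ^ 2 * wt ε p.1 ^ 8) * ((b + 1) ^ 2 * wt ε p.2 ^ 8)) := by gcongr
      _ = _ := by ring

end BddMeas

/-! ### The algebraic cancellation. -/

lemma grad_true_apply (ε : ℝ) (u : Pt → ℝ) (z : Pt) :
    grad ε true u z = (u (z + (0, 1)) - u z) / ε := by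
  rw [show z + (0, 1) = (z.1, z.2 + 1) by ext <;> simp]
  simp [grad]

lemma grad_false_apply (ε : ℝ) (u : Pt → ℝ) (z : Pt) :
    grad ε false u z = (u z - u (z - (0, 1))) / ε := by
  rw [show z - (0, 1) = (z.1, z.2 - 1) by ext <;> simp]
  simp [grad]

/-- The correlation `J(z)² + J(z + e) J(z - e)` of two pairs of noises, for the unit step `e`. -/
def quadCorr (J : Pt → ℝ) (z : Pt) : ℝ := J z ^ 2 + J (z + (0, 1)) * J (z - (0, 1))

/-- `p J(z - e) + q J(z)` for the forward and backward gradients `p`, `q` of a kernel. -/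
def flowLeft (J p q : Pt → ℝ) (z : Pt) : ℝ := p z * J (z - (0, 1)) + q z * J z

/-- `p J(z) + q J(z + e)` for the forward and backward gradients `p`, `q` of a kernel. -/
def flowRight (J p q : Pt → ℝ) (z : Pt) : ℝ := p z * J z + q z * J (z + (0, 1))

/-- Sum of the integrands of the renormalisation constants with outer derivative `∇ˢ`. -/
def totalIntegrand (ε : ℝ) (J L : Pt → ℝ) (s : Bool) (p : Pt × Pt) : ℝ :=
  grad ε s L p.1 * (quadCorr J p.2 * grad ε (!s) L (p.1 + p.2) +
    J (p.1 + p.2 + signStep (!s)) * flowLeft J (grad ε true L) (grad ε false L) p.2 +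
    J (p.1 + p.2 - signStep s) * flowRight J (grad ε true L) (grad ε false L) p.2)

/-- The difference of the gradients of two kernels. -/
def gradDiff (ε : ℝ) (J L : Pt → ℝ) (s : Bool) (z : Pt) : ℝ := grad ε s L z - grad ε s J z

/-- The telescoping part of `totalIntegrand`. -/
def telescopePart (ε : ℝ) (J L : Pt → ℝ) (s : Bool) (p : Pt × Pt) : ℝ :=
  grad ε s L p.1 * (ε⁻¹ * (J (p.1 + p.2 + signStep (!s)) * (2 * (J p.2 * J (p.2 + (0, 1))))))

/-- The part of `totalIntegrand` which is odd under reflection. -/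
def oddPart (ε : ℝ) (J L : Pt → ℝ) (s : Bool) (p : Pt × Pt) : ℝ :=
  grad ε s L p.1 * J (p.1 + p.2) *
    (flowLeft J (gradDiff ε J L true) (gradDiff ε J L false) p.2 +
      flowRight J (gradDiff ε J L true) (gradDiff ε J L false) p.2)

/-- What survives the cancellation when the inner gradients of `L` are those of `J`: the defect of
the discrete Leibniz rule. -/
def errorQuartic (ε : ℝ) (J L : Pt → ℝ) (s : Bool) (p : Pt × Pt) : ℝ :=
  grad ε s L p.1 * grad ε (!s) J (p.1 + p.2) *
    (2 * ε ^ 2 * (grad ε true J p.2 * grad ε false J p.2))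

/-- The error of putting `J` for `L` at the far vertex `p.1 + p.2`. -/
def errorQuad (ε : ℝ) (J L : Pt → ℝ) (s : Bool) (p : Pt × Pt) : ℝ :=
  grad ε s L p.1 * quadCorr J p.2 * gradDiff ε J L (!s) (p.1 + p.2)

/-- The error of moving `J` to the common point `p.1 + p.2`, so that the rest becomes odd under
reflection. -/
def errorShift (ε : ℝ) (J L : Pt → ℝ) (s : Bool) (p : Pt × Pt) : ℝ :=
  grad ε s L p.1 * ((J (p.1 + p.2 + signStep (!s)) - J (p.1 + p.2)) *
      flowLeft J (gradDiff ε J L true) (gradDiff ε J L false) p.2 +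
    (J (p.1 + p.2 - signStep s) - J (p.1 + p.2)) *
      flowRight J (gradDiff ε J L true) (gradDiff ε J L false) p.2)

/-- Writing `a`, `b` for the two shifted values of `J` at `p.1 + p.2` and `J₊`, `J₋` for the
neighbours of `J(p.2)`, the terms with gradients of `J` add up to `2 (a J J₊ - b J J₋) / ε`, a
difference in `p.2`, plus `2 (a - b) (J₊ - J)(J₋ - J) / ε`. The factor `grad ε s L p.1` does not
depend on `p.2` and takes no part. -/
lemma totalIntegrand_eq {ε : ℝ} (hε : ε ≠ 0) (J L : Pt → ℝ) (s : Bool) (p : Pt × Pt) :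
    totalIntegrand ε J L s p = (errorQuad ε J L s p + errorShift ε J L s p -
      errorQuartic ε J L s p) + oddPart ε J L s p +
      (telescopePart ε J L s p - telescopePart ε J L s (p.1, p.2 - (0, 1))) := by
  unfold totalIntegrand errorQuad errorShift errorQuartic oddPart telescopePart flowLeft flowRight
    gradDiff quadCorr
  simp only
  rw [show p.1 + (p.2 - (0, 1)) + signStep (!s) = p.1 + p.2 - signStep s by
    cases s <;> simp [signStep] <;> abel, sub_add_cancel]
  generalize grad ε s L p.1 = a
  generalize hv : p.1 + p.2 = v
  -- For either sign the two shifted arguments are exactly one site apart.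
  have h1 : J (v + signStep (!s)) = J (v - signStep s) + ε * grad ε (!s) J v := by
    cases s
    · simp only [signStep, Bool.not_false, if_true, grad_true_apply, Bool.false_eq_true, if_false,
        sub_zero]
      field_simp; ring
    · simp only [signStep, Bool.not_true, if_true, grad_false_apply, Bool.false_eq_true, if_false,
        add_zero]
      field_simp; ring
  rw [h1]
  simp only [grad_true_apply ε J, grad_false_apply ε J p.2]
  generalize grad ε true L p.2 = l₁
  generalize grad ε false L p.2 = l₂
  generalize grad ε (!s) L v = l₃
  generalize grad ε (!s) J v = l₄
  field_simp
  ring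

/-! ### Pointwise bounds on the pieces. -/

lemma sq_mul_wt_pow_le {ε : ℝ} (hε : 0 < ε) (z : Pt) : ε ^ 2 * wt ε z ^ 16 ≤ diffWt ε z := by
  have h1 := sqrt_mul_wt_sq_le hε z
  have h2 := wt_pos hε z
  have h3 : ε = Real.sqrt ε * Real.sqrt ε := (Real.mul_self_sqrt hε.le).symm
  have h4 := Real.sqrt_nonneg ε
  calc ε ^ 2 * wt ε z ^ 16 = (Real.sqrt ε * wt ε z ^ 2) ^ 3 * (Real.sqrt ε * wt ε z ^ 10) := by
        have : ε ^ 2 = Real.sqrt ε ^ 4 := by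
          linear_combination (ε + Real.sqrt ε * Real.sqrt ε) * h3
        rw [this]; ring
    _ ≤ 1 ^ 3 * diffWt ε z := by
        gcongr
        exact sqrt_mul_wt_pow_ten_le z
    _ = _ := by ring

lemma parabolicSize_step_le {ε : ℝ} (hε : 0 < ε) (z : Pt) :
    parabolicSize ε (z + (0, 1)) ≤ parabolicSize ε z + ε ∧
      parabolicSize ε (z - (0, 1)) ≤ parabolicSize ε z + ε := by
  have h : parabolicSize ε (0, 1) = ε := by simp [parabolicSize]
  have h1 := parabolicSize_add_le hε.le z (0, 1)
  have h2 := parabolicSize_add_le hε.le z (-(0, 1))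
  rw [parabolicSize_neg, h, ← sub_eq_add_neg] at h2
  rw [h] at h1
  exact ⟨h1, h2⟩

lemma wt_step_le {ε : ℝ} (hε : 0 < ε) (z : Pt) :
    wt ε (z + (0, 1)) ≤ 2 * wt ε z ∧ wt ε (z - (0, 1)) ≤ 2 * wt ε z := by
  constructor
  · have := wt_succ_le hε z.1 z.2
    rwa [show z + (0, 1) = (z.1, z.2 + 1) by ext <;> simp]
  · have := wt_pred_le hε z.1 z.2
    rwa [show z - (0, 1) = (z.1, z.2 - 1) by ext <;> simp]

lemma diffWt_reflect (ε : ℝ) (z : Pt) : diffWt ε (reflect z) = diffWt ε z := by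
  simp [diffWt, wt_reflect]

/-- A weight at the three points `u`, `z`, `u + z` which is less singular at `z`. -/
def weightOuter (ε b : ℝ) (p : Pt × Pt) : ℝ :=
  locWt ε b p.1 * locWt ε b (p.1 + p.2) * diffWt ε p.2

/-- A weight at the three points `u`, `z`, `u + z` which is less singular at `u + z`. -/
def weightInner (ε b : ℝ) (p : Pt × Pt) : ℝ :=
  locWt ε b p.1 * locWt ε b p.2 * diffWt ε (p.1 + p.2)

namespace PairBound

variable {ε b B : ℝ} {J L : Pt → ℝ}

lemma left_step_of_lt (h : PairBound ε b B J L) (hε : 0 < ε) (hε1 : ε ≤ 1) {z : Pt}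
    (hz : b + 1 < parabolicSize ε z) : J z = 0 ∧ J (z + (0, 1)) = 0 ∧ J (z - (0, 1)) = 0 := by
  have h1 := parabolicSize_step_le hε (z + (0, 1))
  have h2 := parabolicSize_step_le hε (z - (0, 1))
  rw [add_sub_cancel_right] at h1
  rw [sub_add_cancel] at h2
  exact ⟨h.left_of_lt z (by linarith), h.left_of_lt _ (by linarith [h1.2]),
    h.left_of_lt _ (by linarith [h2.1])⟩

lemma left_step_of_neg (h : PairBound ε b B J L) {z : Pt}
    (hz : z.1 < 0) : J z = 0 ∧ J (z + (0, 1)) = 0 ∧ J (z - (0, 1)) = 0 :=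
  ⟨h.left_of_neg z hz, h.left_of_neg _ (by simpa using hz), h.left_of_neg _ (by simpa using hz)⟩

lemma abs_left_step_le (h : PairBound ε b B J L) (hε : 0 < ε) (hB : 0 ≤ B) (z : Pt) :
    |J z| ≤ 16 * B * wt ε z ^ 4 ∧ |J (z + (0, 1))| ≤ 16 * B * wt ε z ^ 4 ∧
      |J (z - (0, 1))| ≤ 16 * B * wt ε z ^ 4 := by
  have hq := wt_pos hε z
  have hq1 := wt_pos hε (z + (0, 1))
  have hq2 := wt_pos hε (z - (0, 1))
  have h1 := wt_step_le hε z
  refine ⟨(h.bound_left z).trans ?_, (h.bound_left _).trans ?_, (h.bound_left _).trans ?_⟩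
  · have : 0 ≤ B * wt ε z ^ 4 := by positivity
    linarith
  · calc B * wt ε (z + (0, 1)) ^ 4 ≤ B * (2 * wt ε z) ^ 4 := by gcongr; exact h1.1
      _ = _ := by ring
  · calc B * wt ε (z - (0, 1)) ^ 4 ≤ B * (2 * wt ε z) ^ 4 := by gcongr; exact h1.2
      _ = _ := by ring

lemma quadCorr_eq_zero_of_lt (h : PairBound ε b B J L) (hε : 0 < ε) (hε1 : ε ≤ 1) {z : Pt}
    (hz : b + 1 < parabolicSize ε z) : quadCorr J z = 0 := by
  obtain ⟨h1, h2, h3⟩ := h.left_step_of_lt hε hε1 hz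
  simp [quadCorr, h1, h2]

lemma flow_eq_zero_of_lt (h : PairBound ε b B J L) (hε : 0 < ε) (hε1 : ε ≤ 1) (p q : Pt → ℝ) {z : Pt}
    (hz : b + 1 < parabolicSize ε z) : flowLeft J p q z = 0 ∧ flowRight J p q z = 0 := by
  obtain ⟨h1, h2, h3⟩ := h.left_step_of_lt hε hε1 hz
  simp [flowLeft, flowRight, h1, h2, h3]

lemma abs_quadCorr_le (h : PairBound ε b B J L) (hε : 0 < ε) (hε1 : ε ≤ 1) (hB : 0 ≤ B) (z : Pt) :
    |quadCorr J z| ≤ 512 * B ^ 2 * locWt ε (b + 1) z := by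
  have hq := wt_pos hε z
  rcases lt_or_ge (b + 1) (parabolicSize ε z) with hz | hz
  · rw [h.quadCorr_eq_zero_of_lt hε hε1 hz, abs_zero]
    have := locWt_nonneg hε (b + 1) z
    positivity
  · obtain ⟨h1, h2, h3⟩ := h.abs_left_step_le hε hB z
    rw [locWt, if_pos hz]
    unfold quadCorr
    refine (abs_add_le _ _).trans ?_
    rw [abs_mul, abs_pow]
    calc |J z| ^ 2 + |J (z + (0, 1))| * |J (z - (0, 1))| ≤
          (16 * B * wt ε z ^ 4) ^ 2 + (16 * B * wt ε z ^ 4) * (16 * B * wt ε z ^ 4) := by gcongr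
      _ = _ := by ring

lemma abs_flow_le (h : PairBound ε b B J L) (hε : 0 < ε) (hε1 : ε ≤ 1) (hb : 0 ≤ b) (hB : 0 ≤ B)
    (z : Pt) :
    |flowLeft J (gradDiff ε J L true) (gradDiff ε J L false) z| ≤
        32 * B ^ 2 * (diffWt ε z * wt ε z ^ 4) ∧
      |flowRight J (gradDiff ε J L true) (gradDiff ε J L false) z| ≤
        32 * B ^ 2 * (diffWt ε z * wt ε z ^ 4) := by
  have hq := wt_pos hε z
  have hd := diffWt_pos hε z
  by_cases hz : 0 ≤ z.1 ∧ parabolicSize ε z ≤ b + 1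
  · obtain ⟨h1, h2, h3⟩ := h.abs_left_step_le hε hB z
    have g := fun s => h.grad_sub s z hz.1 (by linarith [hz.2])
    have key : ∀ x y s s', |x| ≤ 16 * B * wt ε z ^ 4 → |y| ≤ 16 * B * wt ε z ^ 4 →
        |gradDiff ε J L s z * x + gradDiff ε J L s' z * y| ≤
          32 * B ^ 2 * (diffWt ε z * wt ε z ^ 4) := by
      intro x y s s' hx hy
      refine (abs_add_le _ _).trans ?_
      rw [abs_mul, abs_mul]
      calc _ ≤ (B * diffWt ε z) * (16 * B * wt ε z ^ 4) +
            (B * diffWt ε z) * (16 * B * wt ε z ^ 4) :=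
            add_le_add (mul_le_mul (g s) hx (abs_nonneg _) (by positivity))
              (mul_le_mul (g s') hy (abs_nonneg _) (by positivity))
        _ = _ := by ring
    exact ⟨key _ _ _ _ h3 h1, key _ _ _ _ h1 h2⟩
  · have h0 : J z = 0 ∧ J (z + (0, 1)) = 0 ∧ J (z - (0, 1)) = 0 := by
      rcases lt_or_ge z.1 0 with h1 | h1
      · exact h.left_step_of_neg h1
      · exact h.left_step_of_lt hε hε1 (by by_contra! h2; exact hz ⟨h1, h2⟩)
    obtain ⟨h1, h2, h3⟩ := h0
    simp only [flowLeft, flowRight, h1, h2, h3, mul_zero, add_zero, abs_zero]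
    constructor <;> positivity

lemma abs_grad_right_le (h : PairBound ε b B J L) (hε : 0 < ε) (hB : 0 ≤ B) (s : Bool) (z : Pt) :
    |grad ε s L z| ≤ B * locWt ε (b + 1) z :=
  (h.grad_right s z).trans (mul_le_mul_of_nonneg_left (locWt_mono hε (by linarith) z) hB)

lemma abs_grad_left_le (h : PairBound ε b B J L) (hε : 0 < ε) (hB : 0 ≤ B) (s : Bool) (z : Pt) :
    |grad ε s J z| ≤ B * locWt ε (b + 1) z :=
  (h.grad_left s z).trans (mul_le_mul_of_nonneg_left (locWt_mono hε (by linarith) z) hB)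

/-- The factor `ε²` reduces the two gradients at `p.2`, of size `wt ^ 16`, to `diffWt`. -/
lemma abs_errorQuartic_le (h : PairBound ε b B J L) (hε : 0 < ε) (hB : 0 ≤ B) (s : Bool)
    (p : Pt × Pt) : |errorQuartic ε J L s p| ≤ 2 * B ^ 4 * weightOuter ε (b + 1) p := by
  have hq := wt_pos hε p.2
  have n1 := locWt_nonneg hε (b + 1) p.1
  have n2 := locWt_nonneg hε (b + 1) (p.1 + p.2)
  have h1 := h.abs_grad_right_le hε hB s p.1
  have h2 := h.abs_grad_left_le hε hB (!s) (p.1 + p.2)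
  have h3 : ∀ s, |grad ε s J p.2| ≤ B * wt ε p.2 ^ 8 := fun s =>
    (h.grad_left s p.2).trans (mul_le_mul_of_nonneg_left (locWt_le hε b p.2) hB)
  have h4 := sq_mul_wt_pow_le hε p.2
  unfold errorQuartic weightOuter
  rw [abs_mul, abs_mul, abs_mul (2 * ε ^ 2), abs_mul (grad ε true J p.2),
    abs_of_nonneg (by positivity : 0 ≤ 2 * ε ^ 2)]
  calc _ ≤ ((B * locWt ε (b + 1) p.1) * (B * locWt ε (b + 1) (p.1 + p.2))) *
        (2 * ε ^ 2 * ((B * wt ε p.2 ^ 8) * (B * wt ε p.2 ^ 8))) := by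
        gcongr
        · exact h3 true
        · exact h3 false
    _ = 2 * B ^ 4 * (locWt ε (b + 1) p.1 * locWt ε (b + 1) (p.1 + p.2) *
        (ε ^ 2 * wt ε p.2 ^ 16)) := by ring
    _ ≤ _ := by gcongr

lemma abs_errorQuad_le (h : PairBound ε b B J L) (hε : 0 < ε) (hε1 : ε ≤ 1) (hB : 0 ≤ B)
    (s : Bool) (p : Pt × Pt) :
    |errorQuad ε J L s p| ≤ 512 * B ^ 4 * weightInner ε (b + 1) p := by
  have hd := diffWt_pos hε (p.1 + p.2)
  have n1 := locWt_nonneg hε (b + 1) p.1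
  have n2 := locWt_nonneg hε (b + 1) p.2
  have h1 := h.abs_grad_right_le hε hB s p.1
  have h2 := h.abs_quadCorr_le hε hε1 hB p.2
  unfold errorQuad weightInner
  by_cases h0 : grad ε s L p.1 * quadCorr J p.2 = 0
  · rw [h0, zero_mul, abs_zero]; positivity
  · rw [mul_eq_zero, not_or] at h0
    have h3 : |gradDiff ε J L (!s) (p.1 + p.2)| ≤ B * diffWt ε (p.1 + p.2) := by
      have t1 : 0 ≤ p.1.1 := by
        by_contra! hc; exact h0.1 (grad_of_neg h.right_of_neg s hc)
      have t2 : 0 ≤ p.2.1 := by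
        by_contra! hc
        obtain ⟨a1, a2, a3⟩ := h.left_step_of_neg hc
        exact h0.2 (by simp [quadCorr, a1, a2])
      have t3 : parabolicSize ε p.1 ≤ b := by
        by_contra! hc
        have := h.grad_right s p.1
        rw [locWt, if_neg (not_le.2 hc), mul_zero] at this
        exact h0.1 (abs_nonpos_iff.1 this)
      have t4 : parabolicSize ε p.2 ≤ b + 1 := by
        by_contra! hc; exact h0.2 (h.quadCorr_eq_zero_of_lt hε hε1 hc)
      -- The sum has size at most `b + (b + 1)`, the radius up to which `grad_sub` is assumed.
      have t5 := parabolicSize_add_le hε.le p.1 p.2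
      exact h.grad_sub _ _ (add_nonneg t1 t2) (by linarith)
    rw [abs_mul, abs_mul]
    calc _ ≤ ((B * locWt ε (b + 1) p.1) * (512 * B ^ 2 * locWt ε (b + 1) p.2)) *
          (B * diffWt ε (p.1 + p.2)) := by gcongr
      _ = _ := by ring

lemma abs_sub_step_le (h : PairBound ε b B J L) (hε : 0 < ε) (hB : 0 ≤ B) (s : Bool) (z : Pt) :
    |J (z + signStep s) - J z| ≤ ε * (B * locWt ε (b + 1) z) ∧
      |J (z - signStep s) - J z| ≤ ε * (B * locWt ε (b + 1) z) := by
  have n := locWt_nonneg hε (b + 1) z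
  cases s
  · simp only [signStep, Bool.false_eq_true, if_false, add_zero, sub_zero, sub_self, abs_zero]
    constructor <;> positivity
  · have h1 := h.abs_grad_left_le hε hB true z
    have h2 := h.abs_grad_left_le hε hB false z
    rw [grad_true_apply, abs_div, abs_of_pos hε, div_le_iff₀ hε, mul_comm _ ε] at h1
    rw [grad_false_apply, abs_div, abs_of_pos hε, div_le_iff₀ hε, mul_comm _ ε, abs_sub_comm] at h2
    exact ⟨h1, h2⟩

/-- Moving `J` by one site yields `ε` and a gradient; this `ε` cancels the factor `wt ^ 4` coming
from `J` in the flows. -/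
lemma abs_errorShift_le (h : PairBound ε b B J L) (hε : 0 < ε) (hε1 : ε ≤ 1) (hb : 0 ≤ b)
    (hB : 0 ≤ B) (s : Bool) (p : Pt × Pt) :
    |errorShift ε J L s p| ≤ 64 * B ^ 4 * weightOuter ε (b + 1) p := by
  have hd := diffWt_pos hε p.2
  have hq := wt_pos hε p.2
  have n1 := locWt_nonneg hε (b + 1) p.1
  have n2 := locWt_nonneg hε (b + 1) (p.1 + p.2)
  have h1 := h.abs_grad_right_le hε hB s p.1
  have h2 := (h.abs_sub_step_le hε hB (!s) (p.1 + p.2)).1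
  have h3 := (h.abs_sub_step_le hε hB s (p.1 + p.2)).2
  obtain ⟨h4, h5⟩ := h.abs_flow_le hε hε1 hb hB p.2
  have h6 := mul_wt_pow_four_le hε p.2
  unfold errorShift weightOuter
  rw [abs_mul]
  have h7 := (abs_add_le ((J (p.1 + p.2 + signStep (!s)) - J (p.1 + p.2)) *
      flowLeft J (gradDiff ε J L true) (gradDiff ε J L false) p.2)
    ((J (p.1 + p.2 - signStep s) - J (p.1 + p.2)) *
      flowRight J (gradDiff ε J L true) (gradDiff ε J L false) p.2))
  rw [abs_mul, abs_mul] at h7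
  have h8 := add_le_add (mul_le_mul h2 h4 (abs_nonneg _) (by positivity))
    (mul_le_mul h3 h5 (abs_nonneg _) (by positivity))
  calc _ ≤ (B * locWt ε (b + 1) p.1) * (ε * (B * locWt ε (b + 1) (p.1 + p.2)) *
        (32 * B ^ 2 * (diffWt ε p.2 * wt ε p.2 ^ 4)) +
        ε * (B * locWt ε (b + 1) (p.1 + p.2)) *
        (32 * B ^ 2 * (diffWt ε p.2 * wt ε p.2 ^ 4))) :=
        mul_le_mul h1 (h7.trans h8) (abs_nonneg _) (by positivity)
    _ = 64 * B ^ 4 * (locWt ε (b + 1) p.1 * locWt ε (b + 1) (p.1 + p.2) * diffWt ε p.2) *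
        (ε * wt ε p.2 ^ 4) := by ring
    _ ≤ 64 * B ^ 4 * (locWt ε (b + 1) p.1 * locWt ε (b + 1) (p.1 + p.2) * diffWt ε p.2) * 1 := by
        gcongr
    _ = _ := by ring

lemma grad_reflect {u : Pt → ℝ} (hu : ∀ z, u (reflect z) = u z) (s : Bool) (z : Pt) :
    grad ε s u (reflect z) = -grad ε (!s) u z := by
  have h1 : reflect z + (0, 1) = reflect (z - (0, 1)) := by ext <;> simp [reflect]; ring
  have h2 : reflect z - (0, 1) = reflect (z + (0, 1)) := by ext <;> simp [reflect]; ring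
  cases s
  · rw [Bool.not_false, grad_true_apply, grad_false_apply, h2, hu, hu]; ring
  · rw [Bool.not_true, grad_true_apply, grad_false_apply, h1, hu, hu]; ring

/-- Reflection exchanges the two flows with a minus sign; only their sum is odd. -/
lemma flow_reflect (h : PairBound ε b B J L) (z : Pt) :
    flowLeft J (gradDiff ε J L true) (gradDiff ε J L false) (reflect z) +
      flowRight J (gradDiff ε J L true) (gradDiff ε J L false) (reflect z) =
    -(flowLeft J (gradDiff ε J L true) (gradDiff ε J L false) z +
      flowRight J (gradDiff ε J L true) (gradDiff ε J L false) z) := by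
  have h1 : reflect z + (0, 1) = reflect (z - (0, 1)) := by ext <;> simp [reflect]; ring
  have h2 : reflect z - (0, 1) = reflect (z + (0, 1)) := by ext <;> simp [reflect]; ring
  simp only [flowLeft, flowRight, gradDiff, h1, h2, h.left_reflect, grad_reflect h.left_reflect,
    grad_reflect h.right_reflect, Bool.not_true, Bool.not_false]
  ring

/-- In absolute value the weight `√ε wt ^ 14` at `p.2` would concentrate at the mesh scale and leave
the marginal power 12 at `p.1`. After symmetrisation, `J(p.1 + p.2)` becomes a difference between
two reflected points, and the Lipschitz factor `ε |p.2.2|` removes `wt ^ 4` at `p.2`. -/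
lemma abs_oddPart_add_le (h : PairBound ε b B J L) (hε : 0 < ε) (hε1 : ε ≤ 1) (hb : 0 ≤ b)
    (hB : 0 ≤ B) (s : Bool) (p : Pt × Pt) :
    |oddPart ε J L s p + oddPart ε J L s (p.1, reflect p.2)| ≤
      128 * B ^ 4 * (weightOuter ε (b + 1) p + weightOuter ε (b + 1) (p.1, reflect p.2)) := by
  have hd := diffWt_pos hε p.2
  have hq := wt_pos hε p.2
  have n1 := locWt_nonneg hε (b + 1) p.1
  have n2 := locWt_nonneg hε (b + 1) (p.1 + p.2)
  have n3 := locWt_nonneg hε (b + 1) (p.1 + reflect p.2)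
  have h1 := h.abs_grad_right_le hε hB s p.1
  obtain ⟨h4, h5⟩ := h.abs_flow_le hε hε1 hb hB p.2
  have h6 : |J (p.1 + p.2) - J (p.1 + reflect p.2)| ≤ B * (2 * (ε * |(p.2.2 : ℝ)|)) *
      (locWt ε (b + 1) (p.1 + p.2) + locWt ε (b + 1) (p.1 + reflect p.2)) := by
    have h7 := h.lipschitz (p.1.1 + p.2.1) (p.1.2 + p.2.2) (p.1.2 + -p.2.2)
    have h8 : |((p.1.2 + p.2.2 : ℤ) : ℝ) - ((p.1.2 + -p.2.2 : ℤ) : ℝ)| = 2 * |(p.2.2 : ℝ)| := by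
      push_cast
      rw [show (p.1.2 : ℝ) + p.2.2 - (p.1.2 + -p.2.2) = 2 * p.2.2 by ring, abs_mul, abs_two]
    rw [h8] at h7
    have e1 : p.1 + p.2 = (p.1.1 + p.2.1, p.1.2 + p.2.2) := rfl
    have e2 : p.1 + reflect p.2 = (p.1.1 + p.2.1, p.1.2 + -p.2.2) := rfl
    rw [e1, e2]
    refine h7.trans ?_
    rw [show ε * (2 * |(p.2.2 : ℝ)|) = 2 * (ε * |(p.2.2 : ℝ)|) by ring]
    gcongr <;> exact locWt_mono hε (by linarith) _
  have h9 : ε * |(p.2.2 : ℝ)| * wt ε p.2 ^ 4 ≤ 1 := by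
    rw [← wt_pow_four_mul hε p.2, mul_comm]
    refine mul_le_mul_of_nonneg_left ?_ (by positivity)
    unfold parabolicSize
    linarith [Real.sqrt_nonneg |p.2.1|]
  have e0 : oddPart ε J L s p + oddPart ε J L s (p.1, reflect p.2) =
      grad ε s L p.1 * ((J (p.1 + p.2) - J (p.1 + reflect p.2)) *
      (flowLeft J (gradDiff ε J L true) (gradDiff ε J L false) p.2 +
      flowRight J (gradDiff ε J L true) (gradDiff ε J L false) p.2)) := by
    unfold oddPart
    simp only
    rw [h.flow_reflect]; ring
  have h10 := (abs_add_le (flowLeft J (gradDiff ε J L true) (gradDiff ε J L false) p.2)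
      (flowRight J (gradDiff ε J L true) (gradDiff ε J L false) p.2)).trans (add_le_add h4 h5)
  rw [e0, abs_mul, abs_mul]
  unfold weightOuter
  simp only
  rw [diffWt_reflect]
  calc _ ≤ (B * locWt ε (b + 1) p.1) * ((B * (2 * (ε * |(p.2.2 : ℝ)|)) *
      (locWt ε (b + 1) (p.1 + p.2) + locWt ε (b + 1) (p.1 + reflect p.2))) *
      (32 * B ^ 2 * (diffWt ε p.2 * wt ε p.2 ^ 4) +
        32 * B ^ 2 * (diffWt ε p.2 * wt ε p.2 ^ 4))) := by gcongr
    _ = 128 * B ^ 4 * (locWt ε (b + 1) p.1 * (locWt ε (b + 1) (p.1 + p.2) +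
        locWt ε (b + 1) (p.1 + reflect p.2)) * diffWt ε p.2) *
        (ε * |(p.2.2 : ℝ)| * wt ε p.2 ^ 4) := by ring
    _ ≤ 128 * B ^ 4 * (locWt ε (b + 1) p.1 * (locWt ε (b + 1) (p.1 + p.2) +
        locWt ε (b + 1) (p.1 + reflect p.2)) * diffWt ε p.2) * 1 := by gcongr
    _ = _ := by ring

end PairBound

/-! ### The uniform bound on the integrated integrand. -/

lemma exists_lintegral_weight_le (b : ℝ) : ∃ C : ℝ, 0 ≤ C ∧ ∀ ε : ℝ, 0 < ε → ε ≤ 1 →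
    ∫⁻ p, ENNReal.ofReal (weightOuter ε b p) ∂((gridMeasure ε).prod (gridMeasure ε)) ≤
      ENNReal.ofReal C ∧
    ∫⁻ p, ENNReal.ofReal (weightInner ε b p) ∂((gridMeasure ε).prod (gridMeasure ε)) ≤
      ENNReal.ofReal C := by
  obtain ⟨C, hC, h⟩ := lintegral_locWt_locWt_diffWt_le b
  refine ⟨C, hC, fun ε hε hε1 => ?_⟩
  have hm := measurable_locWt ε b
  have hd := measurable_diffWt ε
  obtain ⟨h1, h2⟩ := h ε hε hε1
  have hp := measurePreserving_prod_add (gridMeasure ε) (gridMeasure ε)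
  rw [← hp.lintegral_comp (by fun_prop)] at h1 h2
  simp only [add_sub_cancel_left] at h1 h2
  exact ⟨h1, h2⟩

lemma abs_integral_le_of_lintegral_le {α : Type*} [MeasurableSpace α] {μ : Measure α} {f W : α → ℝ}
    {C : ℝ} (hC : 0 ≤ C) (h : ∀ x, |f x| ≤ W x)
    (hW : ∫⁻ x, ENNReal.ofReal (W x) ∂μ ≤ ENNReal.ofReal C) : |∫ x, f x ∂μ| ≤ C := by
  refine (norm_integral_le_lintegral_norm f).trans (ENNReal.toReal_le_of_le_ofReal hC ?_)
  exact (lintegral_mono fun x => ENNReal.ofReal_le_ofReal (h x)).trans hW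

lemma lintegral_ofReal_const_mul_le {α : Type*} [MeasurableSpace α] {μ : Measure α} {W : α → ℝ}
    {C M : ℝ} (hM : 0 ≤ M) (hW : ∫⁻ x, ENNReal.ofReal (W x) ∂μ ≤ ENNReal.ofReal C) :
    ∫⁻ x, ENNReal.ofReal (M * W x) ∂μ ≤ ENNReal.ofReal (M * C) := by
  simp_rw [ENNReal.ofReal_mul hM]
  rw [lintegral_const_mul' _ _ ENNReal.ofReal_ne_top]
  gcongr

namespace PairBound

variable {ε b B : ℝ} {J L : Pt → ℝ}

lemma bddMeas_left (h : PairBound ε b B J L) (hε : 0 < ε) (hB : 0 ≤ B) : BddMeas J := by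
  refine ⟨h.measurable_left, B * (ε ^ (-(1 / 4) : ℝ)) ^ 4, fun z => (h.bound_left z).trans ?_⟩
  have := wt_pos hε z
  gcongr
  exact wt_le_rpow hε z

lemma bddMeas_grad_right (h : PairBound ε b B J L) (hε : 0 < ε) (hB : 0 ≤ B) (s : Bool) :
    BddMeas (grad ε s L) := by
  refine ⟨measurable_grad h.measurable_right s, B * (ε ^ (-(1 / 4) : ℝ)) ^ 8, fun z =>
    (h.grad_right s z).trans ?_⟩
  have := wt_pos hε z
  gcongr
  refine (locWt_le hε b z).trans ?_
  gcongr
  exact wt_le_rpow hε z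

lemma size_le_of_grad_right_ne (h : PairBound ε b B J L) {s : Bool} {z : Pt}
    (hz : grad ε s L z ≠ 0) : parabolicSize ε z ≤ b := by
  by_contra! hc
  have := h.grad_right s z
  rw [locWt, if_neg (not_le.2 hc), mul_zero] at this
  exact hz (abs_nonpos_iff.1 this)

lemma bddMeas_quadCorr (hJ : BddMeas J) : BddMeas (quadCorr J) := by
  have h := (hJ.mul hJ).add ((hJ.comp (measurable_id.add_const ((0, 1) : Pt))).mul
    (hJ.comp (measurable_id.sub_const ((0, 1) : Pt))))
  refine (congrArg BddMeas (funext fun z => ?_)).mp h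
  simp only [quadCorr, id]; ring

lemma bddMeas_flowLeft {p q : Pt → ℝ} (hJ : BddMeas J) (hp : BddMeas p) (hq : BddMeas q) :
    BddMeas (flowLeft J p q) :=
  (hp.mul (hJ.comp (measurable_id.sub_const ((0, 1) : Pt)))).add (hq.mul hJ)

lemma bddMeas_flowRight {p q : Pt → ℝ} (hJ : BddMeas J) (hp : BddMeas p) (hq : BddMeas q) :
    BddMeas (flowRight J p q) :=
  (hp.mul hJ).add (hq.mul (hJ.comp (measurable_id.add_const ((0, 1) : Pt))))

lemma integrable_mul (h : PairBound ε b B J L) (hε : 0 < ε) (hε1 : ε ≤ 1) (hB : 0 ≤ B) (s : Bool)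
    {g : Pt × Pt → ℝ} (hg : BddMeas g) (h0 : ∀ p, g p ≠ 0 → parabolicSize ε p.2 ≤ b + 1) :
    Integrable (fun p => grad ε s L p.1 * g p) ((gridMeasure ε).prod (gridMeasure ε)) := by
  refine (((h.bddMeas_grad_right hε hB s).comp measurable_fst).mul hg).integrable (b := b + 1) hε hε1
    fun p hp => ?_
  rw [mul_ne_zero_iff] at hp
  exact ⟨(h.size_le_of_grad_right_ne hp.1).trans (by linarith), h0 p hp.2⟩

lemma bddMeas_sum_add (hJ : BddMeas J) (v : Pt) : BddMeas fun p : Pt × Pt => J (p.1 + p.2 + v) :=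
  hJ.comp ((measurable_fst.add measurable_snd).add_const v)

lemma bddMeas_sum (hJ : BddMeas J) : BddMeas fun p : Pt × Pt => J (p.1 + p.2) :=
  hJ.comp (measurable_fst.add measurable_snd)

lemma bddMeas_sum_sub (hJ : BddMeas J) (v : Pt) : BddMeas fun p : Pt × Pt => J (p.1 + p.2 - v) :=
  hJ.comp ((measurable_fst.add measurable_snd).sub_const v)

lemma bddMeas_gradDiff (h : PairBound ε b B J L) (hε : 0 < ε) (hB : 0 ≤ B) (s : Bool) :
    BddMeas (gradDiff ε J L s) :=
  (h.bddMeas_grad_right hε hB s).sub ((h.bddMeas_left hε hB).grad s)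

lemma integrable_telescopePart (h : PairBound ε b B J L) (hε : 0 < ε) (hε1 : ε ≤ 1) (hB : 0 ≤ B)
    (s : Bool) : Integrable (telescopePart ε J L s) ((gridMeasure ε).prod (gridMeasure ε)) := by
  have hJ := h.bddMeas_left hε hB
  refine h.integrable_mul hε hε1 hB s ((BddMeas.const _).mul ((bddMeas_sum_add hJ _).mul
    ((BddMeas.const _).mul ((hJ.comp measurable_snd).mul
      (hJ.comp (measurable_snd.add_const ((0, 1) : Pt))))))) fun p hp => ?_
  by_contra! hc
  simp [(h.left_step_of_lt hε hε1 hc).1] at hp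

lemma integrable_oddPart (h : PairBound ε b B J L) (hε : 0 < ε) (hε1 : ε ≤ 1) (hB : 0 ≤ B)
    (s : Bool) : Integrable (oddPart ε J L s) ((gridMeasure ε).prod (gridMeasure ε)) := by
  have hJ := h.bddMeas_left hε hB
  have hD := h.bddMeas_gradDiff hε hB
  have := h.integrable_mul hε hε1 hB s ((bddMeas_sum hJ).mul
    (((bddMeas_flowLeft hJ (hD true) (hD false)).comp measurable_snd).add
      ((bddMeas_flowRight hJ (hD true) (hD false)).comp measurable_snd))) fun p hp => by
    by_contra! hc
    have h0 := h.flow_eq_zero_of_lt hε hε1 (gradDiff ε J L true) (gradDiff ε J L false) hc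
    simp [h0.1, h0.2] at hp
  refine this.congr (Filter.Eventually.of_forall fun p => ?_)
  simp only [oddPart]; ring

lemma integrable_errorQuartic (h : PairBound ε b B J L) (hε : 0 < ε) (hε1 : ε ≤ 1) (hB : 0 ≤ B)
    (s : Bool) : Integrable (errorQuartic ε J L s) ((gridMeasure ε).prod (gridMeasure ε)) := by
  have hJ := h.bddMeas_left hε hB
  have := h.integrable_mul hε hε1 hB s ((bddMeas_sum (hJ.grad (ε := ε) (!s))).mul
    ((BddMeas.const (2 * ε ^ 2)).mul (((hJ.grad (ε := ε) true).comp measurable_snd).mul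
      ((hJ.grad (ε := ε) false).comp measurable_snd)))) fun p hp => by
    by_contra! hc
    have h0 := h.left_step_of_lt hε hε1 hc
    simp [grad_true_apply, h0.1, h0.2.1] at hp
  refine this.congr (Filter.Eventually.of_forall fun p => ?_)
  simp only [errorQuartic]; ring

lemma integrable_errorQuad (h : PairBound ε b B J L) (hε : 0 < ε) (hε1 : ε ≤ 1) (hB : 0 ≤ B)
    (s : Bool) : Integrable (errorQuad ε J L s) ((gridMeasure ε).prod (gridMeasure ε)) := by
  have hJ := h.bddMeas_left hε hB
  have := h.integrable_mul hε hε1 hB s (((bddMeas_quadCorr hJ).comp measurable_snd).mul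
    (bddMeas_sum (h.bddMeas_gradDiff hε hB (!s)))) fun p hp => by
    by_contra! hc
    simp [h.quadCorr_eq_zero_of_lt hε hε1 hc] at hp
  refine this.congr (Filter.Eventually.of_forall fun p => ?_)
  simp only [errorQuad]; ring

lemma integrable_errorShift (h : PairBound ε b B J L) (hε : 0 < ε) (hε1 : ε ≤ 1) (hB : 0 ≤ B)
    (s : Bool) : Integrable (errorShift ε J L s) ((gridMeasure ε).prod (gridMeasure ε)) := by
  have hJ := h.bddMeas_left hε hB
  have hD := h.bddMeas_gradDiff hε hB
  refine h.integrable_mul hε hε1 hB s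
    ((((bddMeas_sum_add hJ _).sub (bddMeas_sum hJ)).mul
      ((bddMeas_flowLeft hJ (hD true) (hD false)).comp measurable_snd)).add
    (((bddMeas_sum_sub hJ _).sub (bddMeas_sum hJ)).mul
      ((bddMeas_flowRight hJ (hD true) (hD false)).comp measurable_snd))) fun p hp => ?_
  by_contra! hc
  have h0 := h.flow_eq_zero_of_lt hε hε1 (gradDiff ε J L true) (gradDiff ε J L false) hc
  simp [h0.1, h0.2] at hp

/-- Translation invariance in `p.2`. Both terms are separately integrable for fixed mesh, despite
the prefactor `ε⁻¹`. -/
lemma integral_telescope_eq_zero (h : PairBound ε b B J L) (hε : 0 < ε) (hε1 : ε ≤ 1) (hB : 0 ≤ B)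
    (s : Bool) :
    Integrable (fun p : Pt × Pt => telescopePart ε J L s p -
      telescopePart ε J L s (p.1, p.2 - (0, 1))) ((gridMeasure ε).prod (gridMeasure ε)) ∧
    ∫ p : Pt × Pt, (telescopePart ε J L s p - telescopePart ε J L s (p.1, p.2 - (0, 1)))
      ∂((gridMeasure ε).prod (gridMeasure ε)) = 0 := by
  have hi := h.integrable_telescopePart hε hε1 hB s
  have hp : MeasurePreserving (fun p : Pt × Pt => (p.1, p.2 - (0, 1)))
      ((gridMeasure ε).prod (gridMeasure ε)) ((gridMeasure ε).prod (gridMeasure ε)) :=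
    (MeasurePreserving.id _).prod (measurePreserving_sub_right _ _)
  have hi2 : Integrable (fun p : Pt × Pt => telescopePart ε J L s (p.1, p.2 - (0, 1)))
      ((gridMeasure ε).prod (gridMeasure ε)) := hp.integrable_comp_of_integrable hi
  refine ⟨hi.sub hi2, ?_⟩
  have h1 : ∫ p : Pt × Pt, telescopePart ε J L s (p.1, p.2 - (0, 1))
      ∂((gridMeasure ε).prod (gridMeasure ε)) =
      ∫ p, telescopePart ε J L s p ∂((gridMeasure ε).prod (gridMeasure ε)) := by
    have := integral_map hp.measurable.aemeasurable (by rw [hp.map_eq]; exact hi.1)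
    rw [hp.map_eq] at this
    exact this.symm
  rw [integral_sub hi hi2, sub_eq_zero]
  exact h1.symm

end PairBound

lemma measurePreserving_prod_reflect (ε : ℝ) :
    MeasurePreserving (fun p : Pt × Pt => (p.1, reflect p.2))
      ((gridMeasure ε).prod (gridMeasure ε)) ((gridMeasure ε).prod (gridMeasure ε)) :=
  (MeasurePreserving.id _).prod (measurePreserving_reflect ε)

lemma exists_abs_integral_totalIntegrand_le (b B : ℝ) (hb : 0 ≤ b) (hB : 0 ≤ B) :
    ∃ C : ℝ, ∀ (ε : ℝ) (J L : Pt → ℝ), 0 < ε → ε ≤ 1 → PairBound ε b B J L → ∀ s,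
      |∫ p, totalIntegrand ε J L s p ∂((gridMeasure ε).prod (gridMeasure ε))| ≤ C := by
  obtain ⟨C, hC, hw⟩ := exists_lintegral_weight_le (b + 1)
  refine ⟨512 * B ^ 4 * C + 64 * B ^ 4 * C + 2 * B ^ 4 * C + 128 * B ^ 4 * (C + C) / 2, ?_⟩
  intro ε J L hε hε1 h s
  obtain ⟨ho, hin⟩ := hw ε hε hε1
  set μ := (gridMeasure ε).prod (gridMeasure ε) with hμ
  have i1 := h.integrable_errorQuad hε hε1 hB s
  have i2 := h.integrable_errorShift hε hε1 hB s
  have i3 := h.integrable_errorQuartic hε hε1 hB s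
  have i4 := h.integrable_oddPart hε hε1 hB s
  obtain ⟨i5, e5⟩ := h.integral_telescope_eq_zero hε hε1 hB s
  have i12 : Integrable (fun p => errorQuad ε J L s p + errorShift ε J L s p) μ := i1.add i2
  have i123 : Integrable (fun p => errorQuad ε J L s p + errorShift ε J L s p -
    errorQuartic ε J L s p) μ := i12.sub i3
  have i1234 : Integrable (fun p => errorQuad ε J L s p + errorShift ε J L s p -
    errorQuartic ε J L s p + oddPart ε J L s p) μ := i123.add i4
  have e : ∫ p, totalIntegrand ε J L s p ∂μ = (∫ p, errorQuad ε J L s p ∂μ) +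
      (∫ p, errorShift ε J L s p ∂μ) - (∫ p, errorQuartic ε J L s p ∂μ) +
      ∫ p, oddPart ε J L s p ∂μ := by
    simp_rw [totalIntegrand_eq hε.ne' J L s]
    rw [integral_add i1234 i5, e5, add_zero, integral_add i123 i4, integral_sub i12 i3,
      integral_add i1 i2]
  have b1 := abs_integral_le_of_lintegral_le (by positivity)
    (h.abs_errorQuad_le hε hε1 hB s) (lintegral_ofReal_const_mul_le (by positivity) hin)
  have b2 := abs_integral_le_of_lintegral_le (by positivity)
    (h.abs_errorShift_le hε hε1 hb hB s) (lintegral_ofReal_const_mul_le (by positivity) ho)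
  have b3 := abs_integral_le_of_lintegral_le (by positivity)
    (h.abs_errorQuartic_le hε hB s) (lintegral_ofReal_const_mul_le (by positivity) ho)
  have hp := measurePreserving_prod_reflect ε
  have hmo : Measurable (weightOuter ε (b + 1)) := by
    have hm := measurable_locWt ε (b + 1)
    have hd := measurable_diffWt ε
    unfold weightOuter
    fun_prop
  have ho' : ∫⁻ p, ENNReal.ofReal (weightOuter ε (b + 1) p +
      weightOuter ε (b + 1) (p.1, reflect p.2)) ∂μ ≤ ENNReal.ofReal (C + C) := by
    rw [ENNReal.ofReal_add hC hC]
    calc _ ≤ ∫⁻ p, (ENNReal.ofReal (weightOuter ε (b + 1) p) +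
          ENNReal.ofReal (weightOuter ε (b + 1) (p.1, reflect p.2))) ∂μ :=
          lintegral_mono fun p => ENNReal.ofReal_add_le
      _ ≤ _ := by
          rw [lintegral_add_left hmo.ennreal_ofReal]
          refine add_le_add ho (le_trans (le_of_eq ?_) ho)
          exact hp.lintegral_comp hmo.ennreal_ofReal
  -- Only the symmetrised integrand is bounded; reflection preserves the measure, so its integral is
  -- twice that of `oddPart`.
  have b4 := abs_integral_le_of_lintegral_le (by positivity)
    (h.abs_oddPart_add_le hε hε1 hb hB s) (lintegral_ofReal_const_mul_le (by positivity) ho')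
  have i4' : Integrable (fun p : Pt × Pt => oddPart ε J L s (p.1, reflect p.2)) μ :=
    hp.integrable_comp_of_integrable i4
  have e4 : ∫ p : Pt × Pt, oddPart ε J L s (p.1, reflect p.2) ∂μ = ∫ p, oddPart ε J L s p ∂μ := by
    have := integral_map hp.measurable.aemeasurable (by rw [hp.map_eq]; exact i4.1)
    rw [hp.map_eq] at this
    exact this.symm
  rw [integral_add i4 i4', e4] at b4
  rw [e]
  rw [abs_le] at *
  constructor <;> linarith [b1.1, b1.2, b2.1, b2.2, b3.1, b3.2, b4.1, b4.2]

/-! ### Reduction of the renormalisation constants to the total integrand. -/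

/-- The change of variables `(u, z) ↦ (-u, -(u + z))`. -/
lemma measurePreserving_neg_prod_neg_add (ε : ℝ) :
    MeasurePreserving (fun p : Pt × Pt => (-p.1, -(p.1 + p.2)))
      ((gridMeasure ε).prod (gridMeasure ε)) ((gridMeasure ε).prod (gridMeasure ε)) :=
  ((Measure.measurePreserving_neg _).prod (Measure.measurePreserving_neg _)).comp
    (measurePreserving_prod_add _ _)

/-- The change of variables `(u, z) ↦ (u + z, -z)`. -/
lemma measurePreserving_add_prod_neg_snd (ε : ℝ) :
    MeasurePreserving (fun p : Pt × Pt => (p.1 + p.2, -p.2))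
      ((gridMeasure ε).prod (gridMeasure ε)) ((gridMeasure ε).prod (gridMeasure ε)) := by
  have h1 := measurePreserving_prod_add (gridMeasure ε) (gridMeasure ε)
  have h2 := Measure.measurePreserving_swap (μ := gridMeasure ε) (ν := gridMeasure ε)
  have h3 := measurePreserving_prod_sub (gridMeasure ε) (gridMeasure ε)
  refine (congrArg (fun f => MeasurePreserving f _ _) (funext fun p => ?_)).mp
    (h3.comp (h2.comp h1))
  ext <;> simp

lemma _root_.MeasureTheory.MeasurePreserving.integral_comp_of_aesm {α β : Type*}
    [MeasurableSpace α] [MeasurableSpace β] {μ : Measure α} {ν : Measure β} {f : α → β} {g : β → ℝ}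
    (hf : MeasurePreserving f μ ν) (hg : AEStronglyMeasurable g ν) :
    ∫ x, g (f x) ∂μ = ∫ y, g y ∂ν := by
  have := integral_map hf.measurable.aemeasurable (by rw [hf.map_eq]; exact hg)
  rw [hf.map_eq] at this
  exact this.symm

lemma corr_of_nonneg {ε : ℝ} {K : Pt → ℝ} {z : Pt} (hz : 0 ≤ z.1) :
    corr ε K z = causalCorr ε K z := (if_neg (not_lt.2 hz)).symm

lemma symIntegrand_apply (ε : ℝ) (K L : Pt → ℝ) (w : Pt × Pt) : symIntegrand ε K L w =
    grad ε false L (-w.1) * grad ε true L (-w.2) * quadCorr (corr ε K) (w.1 - w.2) := by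
  unfold symIntegrand quadCorr
  simp only [pairing_eq_corr, sub_self, add_zero]
  simp only [signStep, if_true, Bool.false_eq_true, if_false, sub_zero, zero_sub,
    ← sub_eq_add_neg]
  ring

lemma chainIntegrand_apply (ε : ℝ) (K L : Pt → ℝ) (a b : Bool) (w : Pt × Pt) :
    chainIntegrand ε K L a b w = grad ε a L (-w.1) * (grad ε b L (w.1 - w.2) *
      (corr ε K (w.1 - w.2 - signStep b) * corr ε K (-w.2 + signStep (!a)) +
      corr ε K (w.1 - w.2 + signStep (!b)) * corr ε K (-w.2 - signStep a))) := by
  have h : ∀ s, signStep (!s) - signStep true = -signStep s := by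
    rintro (_ | _) <;> simp [signStep]
  have h' : ∀ s, signStep s - signStep false = signStep s := by
    intro s; simp [signStep]
  unfold chainIntegrand
  simp only [pairing_eq_corr, h, h', ← sub_eq_add_neg, zero_sub]
  ring

section Constants

variable {ε b B : ℝ} {K L : Pt → ℝ}

lemma PairBound.bddMeas_corr (h : PairBound ε b B (causalCorr ε K) L) (hε : 0 < ε) (hB : 0 ≤ B)
    (hK : Measurable K) : BddMeas (corr ε K) := by
  obtain ⟨M, hM⟩ := (h.bddMeas_left hε hB).bdd
  refine ⟨measurable_corr hK, M, fun z => ?_⟩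
  rcases le_total 0 z.1 with hz | hz
  · rw [corr_of_nonneg hz]; exact hM z
  · rw [← corr_neg, corr_of_nonneg (by simpa using hz)]; exact hM _

lemma PairBound.integrable_symIntegrand (h : PairBound ε b B (causalCorr ε K) L) (hε : 0 < ε)
    (hε1 : ε ≤ 1) (hB : 0 ≤ B) (hK : Measurable K) :
    Integrable (symIntegrand ε K L) ((gridMeasure ε).prod (gridMeasure ε)) := by
  have hc := h.bddMeas_corr hε hB hK
  have hg := h.bddMeas_grad_right hε hB
  rw [show symIntegrand ε K L = _ from funext (symIntegrand_apply ε K L)]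
  refine ((((hg false).comp measurable_fst.neg).mul ((hg true).comp measurable_snd.neg)).mul
    ((PairBound.bddMeas_quadCorr hc).comp (measurable_fst.sub measurable_snd))).integrable (b := b)
    hε hε1 fun p hp => ?_
  simp only [Pi.neg_apply, ne_eq, mul_eq_zero, not_or] at hp
  have h1 := h.size_le_of_grad_right_ne hp.1.1
  have h2 := h.size_le_of_grad_right_ne hp.1.2
  rw [parabolicSize_neg] at h1 h2
  exact ⟨h1, h2⟩

lemma PairBound.integrable_chainIntegrand (h : PairBound ε b B (causalCorr ε K) L) (hε : 0 < ε)
    (hε1 : ε ≤ 1) (hb : 0 ≤ b) (hB : 0 ≤ B) (hK : Measurable K) (a s : Bool) :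
    Integrable (chainIntegrand ε K L a s) ((gridMeasure ε).prod (gridMeasure ε)) := by
  have hc := h.bddMeas_corr hε hB hK
  have hg := h.bddMeas_grad_right hε hB
  have hs : Measurable fun p : Pt × Pt => p.1 - p.2 := measurable_fst.sub measurable_snd
  rw [show chainIntegrand ε K L a s = _ from funext (chainIntegrand_apply ε K L a s)]
  refine (((hg a).comp measurable_fst.neg).mul (((hg s).comp hs).mul
    (((hc.comp (hs.sub_const (signStep s))).mul
      (hc.comp (measurable_snd.neg.add_const (signStep (!a))))).add
    ((hc.comp (hs.add_const (signStep (!s)))).mul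
      (hc.comp (measurable_snd.neg.sub_const (signStep a))))))).integrable (b := 2 * b)
    hε hε1 fun p hp => ?_
  simp only [Pi.neg_apply, ne_eq, mul_eq_zero, not_or] at hp
  have h1 := h.size_le_of_grad_right_ne hp.1
  have h2 := h.size_le_of_grad_right_ne hp.2.1
  have h3 := parabolicSize_add_le hε.le (-p.1) (p.1 - p.2)
  rw [neg_add_eq_sub, sub_sub_cancel_left, parabolicSize_neg] at h3
  rw [parabolicSize_neg] at h1
  rw [parabolicSize_neg] at h3
  exact ⟨by linarith, by linarith⟩

/-- The part of `totalIntegrand` which comes from the symmetric tree. -/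
def symPart (ε : ℝ) (J L : Pt → ℝ) (s : Bool) (p : Pt × Pt) : ℝ :=
  grad ε s L p.1 * (quadCorr J p.2 * grad ε (!s) L (p.1 + p.2))

lemma PairBound.integrable_symPart {J : Pt → ℝ} (h : PairBound ε b B J L) (hε : 0 < ε)
    (hε1 : ε ≤ 1) (hB : 0 ≤ B) (s : Bool) :
    Integrable (symPart ε J L s) ((gridMeasure ε).prod (gridMeasure ε)) := by
  have hJ := h.bddMeas_left hε hB
  refine h.integrable_mul hε hε1 hB s (((PairBound.bddMeas_quadCorr hJ).comp measurable_snd).mul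
    (PairBound.bddMeas_sum (h.bddMeas_grad_right hε hB (!s)))) fun p hp => ?_
  by_contra! hc
  simp [h.quadCorr_eq_zero_of_lt hε hε1 hc] at hp

/-- The correlation is even in space-time while its causal version lives on one side of time zero,
so exactly one of `z`, `-z` contributes. At time zero both would, whence the exclusion. -/
lemma quadCorr_corr (ε : ℝ) (K : Pt → ℝ) {z : Pt} (hz : z.1 ≠ 0) :
    quadCorr (corr ε K) z = quadCorr (causalCorr ε K) z + quadCorr (causalCorr ε K) (-z) := by
  have key : ∀ z : Pt, 0 < z.1 → quadCorr (corr ε K) z = quadCorr (causalCorr ε K) z ∧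
      quadCorr (causalCorr ε K) (-z) = 0 := by
    intro z hz
    have h1 : ∀ v : Pt, 0 < v.1 → causalCorr ε K (-v) = 0 := fun v hv =>
      if_pos (by simpa using hv)
    constructor
    · unfold quadCorr
      rw [corr_of_nonneg hz.le, corr_of_nonneg (by simpa using hz.le),
        corr_of_nonneg (by simpa using hz.le)]
    · unfold quadCorr
      rw [h1 z hz, show -z + (0, 1) = -(z - (0, 1)) by abel, h1 _ (by simpa using hz)]
      simp
  rcases hz.lt_or_gt with h | h
  · obtain ⟨h1, h2⟩ := key (-z) (by simpa using h)
    rw [neg_neg] at h2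
    rw [h2, zero_add, ← h1]
    unfold quadCorr
    rw [← corr_neg ε K z, ← corr_neg ε K (z + (0, 1)), ← corr_neg ε K (z - (0, 1)), neg_add',
      neg_sub, neg_add_eq_sub]
    ring
  · obtain ⟨h1, h2⟩ := key z h
    rw [h1, h2, add_zero]

/-- The two time orders of the inner vertices give the two signs of the outer derivative; one half
is brought to standard form by exchanging the roles of the vertices. -/
lemma PairBound.symConst_eq (h : PairBound ε b B (causalCorr ε K) L) (hε : 0 < ε) (hε1 : ε ≤ 1)
    (hB : 0 ≤ B) (hK : Measurable K) : symConst ε K L =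
      (∫ p, symPart ε (causalCorr ε K) L true p ∂((gridMeasure ε).prod (gridMeasure ε))) +
      ∫ p, symPart ε (causalCorr ε K) L false p ∂((gridMeasure ε).prod (gridMeasure ε)) := by
  have hi := h.integrable_symPart hε hε1 hB
  have hp := measurePreserving_neg_prod_neg_add ε
  have hp' := measurePreserving_add_prod_neg_snd ε
  unfold symConst
  rw [← hp.integral_comp_of_aesm (h.integrable_symIntegrand hε hε1 hB hK).1,
    ← hp'.integral_comp_of_aesm (hi true).1]
  have hi' : Integrable (fun p : Pt × Pt => symPart ε (causalCorr ε K) L true (p.1 + p.2, -p.2))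
    ((gridMeasure ε).prod (gridMeasure ε)) := hp'.integrable_comp_of_integrable (hi true)
  rw [← integral_add hi' (hi false)]
  refine integral_congr_ae ?_
  filter_upwards [Measure.quasiMeasurePreserving_snd.ae (ae_fst_ne ε 0)] with p hp0
  rw [symIntegrand_apply]
  simp only [symPart, neg_neg, neg_sub_neg, add_sub_cancel_left, add_neg_cancel_right,
    Bool.not_true, Bool.not_false, quadCorr_corr ε K hp0]
  ring

/-- The kernels `L` force a time order along the chain, so the correlations are only met at
nonnegative times and may be replaced by the causal ones. -/
lemma chainIntegrand_comp (hL : ∀ z : Pt, z.1 < 0 → L z = 0) (a s : Bool) (p : Pt × Pt) :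
    chainIntegrand ε K L a s (-p.1, -(p.1 + p.2)) = grad ε a L p.1 * (grad ε s L p.2 *
      (causalCorr ε K (p.2 - signStep s) * causalCorr ε K (p.1 + p.2 + signStep (!a)) +
      causalCorr ε K (p.2 + signStep (!s)) * causalCorr ε K (p.1 + p.2 - signStep a))) := by
  have h0 : ∀ s, (signStep s).1 = 0 := by rintro (_ | _) <;> rfl
  rw [chainIntegrand_apply]
  simp only [neg_neg, neg_sub_neg, add_sub_cancel_left]
  rcases lt_or_ge p.1.1 0 with h1 | h1
  · rw [grad_of_neg hL a h1, zero_mul, zero_mul]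
  rcases lt_or_ge p.2.1 0 with h2 | h2
  · rw [grad_of_neg hL s h2, zero_mul, zero_mul]
  have h3 := add_nonneg h1 h2
  rw [corr_of_nonneg (by simp [h0, h2]), corr_of_nonneg (by simp [h0, h3]),
    corr_of_nonneg (by simp [h0, h2]), corr_of_nonneg (by simp [h0, h3])]

/-- For each outer sign, one half of the symmetric constant is grouped with the two chains having
that outer sign. The inner sign is summed and yields the two gradients in `flowLeft` and
`flowRight`. -/
lemma PairBound.constants_eq (h : PairBound ε b B (causalCorr ε K) L) (hε : 0 < ε) (hε1 : ε ≤ 1)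
    (hb : 0 ≤ b) (hB : 0 ≤ B) (hK : Measurable K) :
    symConst ε K L + (chainConst ε K L true true + chainConst ε K L false true +
      chainConst ε K L true false + chainConst ε K L false false) =
      (∫ p, totalIntegrand ε (causalCorr ε K) L true p ∂((gridMeasure ε).prod (gridMeasure ε))) +
      ∫ p, totalIntegrand ε (causalCorr ε K) L false p
        ∂((gridMeasure ε).prod (gridMeasure ε)) := by
  have hp := measurePreserving_neg_prod_neg_add ε
  have hs := h.integrable_symPart hε hε1 hB
  have hci := h.integrable_chainIntegrand hε hε1 hb hB hK
  have hi : ∀ a s, Integrable (fun p : Pt × Pt => chainIntegrand ε K L a s (-p.1, -(p.1 + p.2)))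
      ((gridMeasure ε).prod (gridMeasure ε)) := fun a s =>
    hp.integrable_comp_of_integrable (hci a s)
  have hc : ∀ a s, chainConst ε K L a s = ∫ p : Pt × Pt,
      chainIntegrand ε K L a s (-p.1, -(p.1 + p.2)) ∂((gridMeasure ε).prod (gridMeasure ε)) :=
    fun a s => (hp.integral_comp_of_aesm (hci a s).1).symm
  have ht : ∀ a, ∫ p, totalIntegrand ε (causalCorr ε K) L a p
      ∂((gridMeasure ε).prod (gridMeasure ε)) =
      (∫ p, symPart ε (causalCorr ε K) L a p ∂((gridMeasure ε).prod (gridMeasure ε))) +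
      chainConst ε K L a true + chainConst ε K L a false := by
    intro a
    have h1 : Integrable (fun p : Pt × Pt => symPart ε (causalCorr ε K) L a p +
      chainIntegrand ε K L a true (-p.1, -(p.1 + p.2)))
      ((gridMeasure ε).prod (gridMeasure ε)) := (hs a).add (hi a true)
    rw [hc, hc, ← integral_add (hs a) (hi a true), ← integral_add h1 (hi a false)]
    refine integral_congr_ae (Filter.Eventually.of_forall fun p => ?_)
    simp only [chainIntegrand_comp h.right_of_neg, totalIntegrand, symPart, flowLeft, flowRight]
    simp only [signStep, Bool.not_true, Bool.not_false, if_true, Bool.false_eq_true, if_false,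
      add_zero, sub_zero]
    ring
  rw [ht, ht, h.symConst_eq hε hε1 hB hK]
  ring

end Constants

lemma mesh_pos (N : ℕ) : 0 < mesh N := by unfold mesh; positivity

end LatticeKPZ

end

theorem lemma6p6 :
    ∃ ε₀ : ℝ, 0 < ε₀ ∧ ε₀ < 1 ∧
      (∀ N : ℕ, LatticeKPZ.mesh N < ε₀ → ∀ z : LatticeKPZ.Pt, 0 ≤ z.1 →
        Summable fun n : ℕ => |LatticeKPZ.neumannTerm (LatticeKPZ.mesh N) n z|) ∧
      ∀ r : ℕ, 2 ≤ r → ∀ c C : ℝ, ∃ B : ℝ, ∀ N : ℕ, LatticeKPZ.mesh N < ε₀ →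
        ∀ K Kt : LatticeKPZ.Pt → ℝ,
          LatticeKPZ.IsSingularPart (LatticeKPZ.mesh N) r c C
            (LatticeKPZ.heatKernel (LatticeKPZ.mesh N)) K →
          LatticeKPZ.IsSingularPart (LatticeKPZ.mesh N) r c C
            (LatticeKPZ.tildeHeatKernel (LatticeKPZ.mesh N)) Kt →
          (∀ (l₁ l₂ : Bool) (z₁ z₂ : LatticeKPZ.Pt),
            MeasureTheory.Integrable
              (LatticeKPZ.pairingIntegrand (LatticeKPZ.mesh N) K l₁ l₂ z₁ z₂)
              (LatticeKPZ.gridMeasure (LatticeKPZ.mesh N))) ∧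
          MeasureTheory.Integrable (LatticeKPZ.symIntegrand (LatticeKPZ.mesh N) K Kt)
            ((LatticeKPZ.gridMeasure (LatticeKPZ.mesh N)).prod
              (LatticeKPZ.gridMeasure (LatticeKPZ.mesh N))) ∧
          (∀ a b : Bool,
            MeasureTheory.Integrable (LatticeKPZ.chainIntegrand (LatticeKPZ.mesh N) K Kt a b)
              ((LatticeKPZ.gridMeasure (LatticeKPZ.mesh N)).prod
                (LatticeKPZ.gridMeasure (LatticeKPZ.mesh N)))) ∧
          |LatticeKPZ.symConst (LatticeKPZ.mesh N) K Kt +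
            (LatticeKPZ.chainConst (LatticeKPZ.mesh N) K Kt true true +
              LatticeKPZ.chainConst (LatticeKPZ.mesh N) K Kt false true +
              LatticeKPZ.chainConst (LatticeKPZ.mesh N) K Kt true false +
              LatticeKPZ.chainConst (LatticeKPZ.mesh N) K Kt false false)| ≤ B := by
  -- Any threshold below 1 would do: the series converges for every mesh, and the estimates use only
  -- `ε < 1`.
  refine ⟨1 / 2, by norm_num, by norm_num, fun N _ z hz =>
    LatticeKPZ.summable_neumannTerm (LatticeKPZ.mesh_pos N) z hz, fun r hr c C => ?_⟩
  -- The constants come from `IsSingularPart.exists_bounds`; of the order `r`, only `2 ≤ r` enters.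
  obtain ⟨B, hB, hpair⟩ := LatticeKPZ.exists_pairBound (max c 1)
    (512 * |C| * (max c 1 + 4) ^ 3) |C| (by positivity) (by positivity) (abs_nonneg C)
  have hb : 0 ≤ 2 * max c 1 + 3 := by positivity
  obtain ⟨D, hD⟩ := LatticeKPZ.exists_abs_integral_totalIntegrand_le (2 * max c 1 + 3) B hb hB
  refine ⟨D + D, fun N hN K Kt hK hKt => ?_⟩
  have hε := LatticeKPZ.mesh_pos N
  have hε1 : LatticeKPZ.mesh N ≤ 1 := by linarith
  obtain ⟨kK, R, hR, hu⟩ := hK.exists_bounds hε (by linarith) hr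
  obtain ⟨kKt, Rt, hRt, hut⟩ := hKt.exists_bounds hε (by linarith) hr
  have h := hpair _ K R Kt Rt hε hε1 kK hR hu kKt hRt hut
  refine ⟨kK.integrable_pairingIntegrand hε hε1 (by positivity),
    h.integrable_symIntegrand hε hε1 hB kK.measurable,
    h.integrable_chainIntegrand hε hε1 hb hB kK.measurable, ?_⟩
  rw [h.constants_eq hε hε1 hb hB kK.measurable]
  exact (abs_add_le _ _).trans (add_le_add (hD _ _ _ hε hε1 h true) (hD _ _ _ hε hε1 h false))
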